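/- Let $\mathcal H$ be a complex Hilbert space with scalar product $(\cdot|\cdot)$ antilinear in the first argument, let $\varepsilon\ge 0$ be a selfadjoint operator on $\mathcal H$, put $h_0=\varepsilon^2$, and let $0\le\theta\le\frac12$. Write $\langle a\rangle=(1+a^2)^{1/2}$. Let $\langle h_0\rangle^{-\theta}\mathcal H$ be the domain of $|h_0|^{\theta}$ with the norm $\|\langle h_0\rangle^{\theta}u\|$, let $\langle h_0\rangle^{\theta}\mathcal H$ be its adjoint space (the continuous antilinear forms on it), in which $\mathcal H$ is embedded by $v\mapsto(\cdot|v)$, and let $\mathcal K_\theta=\langle h_0\rangle^{-\theta}\mathcal H\oplus\langle h_0\rangle^{\theta}\mathcal H$. Let $K_{0,\theta}$ be the free charge operator, i.e. the operator in $\mathcal K_\theta$ given by $K_{0,\theta}(u_0,u_1)=(u_1,h_0u_0)$ on the set of all $(u_0,u_1)\in\mathcal E:=\mathrm{Dom}\,\varepsilon\oplus\mathcal H$ with $(u_1,h_0u_0)\in\mathcal K_\theta$; here $h_0u_0$ is the antilinear form $w\mapsto(\varepsilon w|\varepsilon u_0)$ on $\mathrm{Dom}\,\varepsilon$. For $\varphi:\mathbb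 R\to\mathbb C$ put $\varphi_\pm(x)=(\varphi(x)\pm\varphi(-x))/2$. Let $\Lambda_\theta$ be the space of Borel functions $\varphi:\mathbb R\to\mathbb C$ with $$\|\varphi\|_{\Lambda_\theta}:=\|\varphi\|_{\Lambda}+\sup_{x>0}\Big|\frac{\varphi_-(x)}{x}\Big|+\sup_{x\in\mathbb R}|\varphi_-(x)|\langle x\rangle^{|4\theta-1|}<\infty,\qquad \|\varphi\|_\Lambda:=\sup_{x\in\mathbb R}|\varphi(x)|+\sup_{x>0}\Big|\frac{\varphi_-(x)}{x}\Big| ,$$ and let $\Lambda_\theta^{1}$ be the set of those $\varphi\in\Lambda_\theta$ that are differentiable at $0$. These are algebras for pointwise multiplication. The value of $\varphi_-(x)/x$ at $x=0$ is $\varphi'(0)$ by definition, if this derivative exists. (a) There is a unique linear map $\Lambda_\theta^{1}\ni\varphi\mapsto\varphi(K_{0,\theta})\in B(\mathcal K_\theta)$ such that (i) $\varphi(K_{0,\theta})=(K_{0,\theta}-z)^{-1}$ if $\varphi(x)=(x-z)^{-1}$ with $z\in\mathbb C\setminus\mathbb R$ (in particular these functions belong to the space and the resolvents exist as bounded operators);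 (ii) if $\varphi_n$ is a sequence in the space with $\sup_n\|\varphi_n\|_{\Lambda_\theta}<\infty$, if $\varphi$ is in the space, and if $\varphi_n(x)\to\varphi(x)$ and $\varphi_{n,-}(x)/x\to\varphi_-(x)/x$ for each real $x$ (at $x=0$ the latter means $\varphi_n'(0)\to\varphi'(0)$), then $\varphi_n(K_{0,\theta})\to\varphi(K_{0,\theta})$ weakly. The map $\varphi\mapsto\varphi(K_{0,\theta})$ is a morphism of unital algebras. On the dense subspace $\mathcal E$ of $\mathcal K_\theta$ it is given by $$\varphi(K_{0,\theta})\begin{pmatrix}u_0\\u_1\end{pmatrix}=\begin{pmatrix}\varphi_+(\varepsilon)&\varphi_-(\varepsilon)/\varepsilon\\ \varphi_-(\varepsilon)\varepsilon&\varphi_+(\varepsilon)\end{pmatrix}\begin{pmatrix}u_0\\u_1\end{pmatrix},\qquad u_0\in\mathrm{Dom}\,\varepsilon,\ u_1\in\mathcal H ,$$ where functions of $\varepsilon$ are taken in the sense of the Borel functional calculus of a selfadjoint operator. There is a constant $C\ge0$ with $\|\varphi(K_{0,\theta})\|_{B(\mathcal K_\theta)}\le C\|\varphi\|_{\Lambda_\theta}$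 for all $\varphi$ in the space. (b) If moreover $\varepsilon$ is injective, then all the assertions of (a) hold with $\Lambda_\theta^1$ replaced by $\Lambda_\theta$ and with (ii) required for all bounded sequences that satisfy only $\varphi_n(x)\to\varphi(x)$ for each real $x$; the value of $\varphi_-(x)/x$ at $x=0$ is then irrelevant. -/

import Mathlib

open MeasureTheory Filter Topology
open scoped ENNReal NNReal InnerProductSpace LinearPMap

noncomputable section

namespace KleinGordon

section Spectral

variable {H : Type*} [NormedAddCommGroup H] [InnerProductSpace ℂ H] [CompleteSpace H]

/-- A (projection valued) spectral measure on the Borel subsets of the real line: every Borel set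
is sent to an orthogonal projection, the whole line to the identity, and the map is strongly
countably additive. -/
structure SpectralMeasure (H : Type*) [NormedAddCommGroup H] [InnerProductSpace ℂ H]
    [CompleteSpace H] where
  proj : Set ℝ → H →L[ℂ] H
  isStarProjection : ∀ S, MeasurableSet S → IsStarProjection (proj S)
  univ : proj Set.univ = 1
  hasSum_iUnion : ∀ S : ℕ → Set ℝ, (∀ n, MeasurableSet (S n)) →
    Pairwise (Function.onFun Disjoint S) →
    ∀ u : H, HasSum (fun n => proj (S n) u) (proj (⋃ n, S n) u)

theorem inner_proj_self {P : H →L[ℂ] H} (hP : IsStarProjection P) (u : H) :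
    ⟪u, P u⟫_ℂ = ((‖P u‖ ^ 2 : ℝ) : ℂ) := by
  have h1 : P (P u) = P u := by
    have := congrArg (fun T : H →L[ℂ] H => T u) hP.isIdempotentElem.eq
    simpa using this
  have h2 : ContinuousLinearMap.adjoint P = P := by
    have := hP.isSelfAdjoint.star_eq
    rwa [ContinuousLinearMap.star_eq_adjoint] at this
  calc ⟪u, P u⟫_ℂ = ⟪u, P (P u)⟫_ℂ := by rw [h1]
    _ = ⟪ContinuousLinearMap.adjoint P u, P u⟫_ℂ := by
        rw [ContinuousLinearMap.adjoint_inner_left]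
    _ = ((‖P u‖ ^ 2 : ℝ) : ℂ) := by
        rw [h2, inner_self_eq_norm_sq_to_K]; push_cast; rfl

namespace SpectralMeasure

variable (E : SpectralMeasure H)

theorem proj_empty : E.proj ∅ = 0 := by
  ext u
  have h := E.hasSum_iUnion (fun _ => ∅) (fun _ => MeasurableSet.empty)
    (fun i j _ => by simp [Function.onFun]) u
  have h2 := h.summable.tendsto_atTop_zero
  simpa using tendsto_nhds_unique tendsto_const_nhds h2

theorem hasSum_norm_sq (S : ℕ → Set ℝ) (hS : ∀ n, MeasurableSet (S n))
    (hd : Pairwise (Function.onFun Disjoint S)) (u : H) :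
    HasSum (fun n => ‖E.proj (S n) u‖ ^ 2) (‖E.proj (⋃ n, S n) u‖ ^ 2) := by
  have h := (E.hasSum_iUnion S hS hd u).mapL (innerSL ℂ u)
  simp only [innerSL_apply_apply] at h
  rw [inner_proj_self (E.isStarProjection _ (MeasurableSet.iUnion hS))] at h
  have h' : (fun n => ⟪u, E.proj (S n) u⟫_ℂ) =
      fun n => ((‖E.proj (S n) u‖ ^ 2 : ℝ) : ℂ) := by
    funext n
    exact inner_proj_self (E.isStarProjection _ (hS n)) u
  rw [h'] at h
  exact_mod_cast h

/-- The scalar spectral measure `S ↦ ‖E(S)u‖² = (u | E(S)u)` of the vector `u`. -/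
def measure (u : H) : Measure ℝ :=
  Measure.ofMeasurable (fun S _ => ENNReal.ofReal (‖E.proj S u‖ ^ 2))
    (by simp [E.proj_empty])
    (by
      intro S hS hd
      have h := E.hasSum_norm_sq S hS hd u
      rw [← h.tsum_eq, ENNReal.ofReal_tsum_of_nonneg (fun n => by positivity) h.summable])

theorem measure_apply (u : H) {S : Set ℝ} (hS : MeasurableSet S) :
    E.measure u S = ENNReal.ofReal (‖E.proj S u‖ ^ 2) :=
  Measure.ofMeasurable_apply S hS

theorem measure_univ (u : H) : E.measure u Set.univ = ENNReal.ofReal (‖u‖ ^ 2) := by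
  rw [E.measure_apply u MeasurableSet.univ, E.univ]; simp

theorem measure_smul (c : ℂ) (u : H) :
    E.measure (c • u) = ENNReal.ofReal (‖c‖ ^ 2) • E.measure u := by
  ext S hS
  rw [Measure.smul_apply, E.measure_apply _ hS, E.measure_apply _ hS, map_smul, norm_smul,
    mul_pow, ENNReal.ofReal_mul (by positivity), smul_eq_mul]

theorem measure_add_le (u v : H) {t : ℝ} (ht : 0 < t) :
    E.measure (u + v) ≤
      ENNReal.ofReal (1 + t) • E.measure u + ENNReal.ofReal (1 + t⁻¹) • E.measure v := by
  refine Measure.le_iff.mpr fun S hS => ?_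
  rw [Measure.add_apply, Measure.smul_apply, Measure.smul_apply, E.measure_apply _ hS,
    E.measure_apply _ hS, E.measure_apply _ hS, smul_eq_mul, smul_eq_mul,
    ← ENNReal.ofReal_mul (by positivity), ← ENNReal.ofReal_mul (by positivity),
    ← ENNReal.ofReal_add (by positivity) (by positivity), map_add]
  apply ENNReal.ofReal_le_ofReal
  set a := ‖E.proj S u‖
  set b := ‖E.proj S v‖
  have h1 : ‖E.proj S u + E.proj S v‖ ^ 2 ≤ (a + b) ^ 2 :=
    pow_le_pow_left₀ (norm_nonneg _) (norm_add_le _ _) 2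
  have h2 : 0 ≤ t⁻¹ * (t * a - b) ^ 2 := by positivity
  have h3 : t⁻¹ * (t * a - b) ^ 2 = t * a ^ 2 - 2 * a * b + t⁻¹ * b ^ 2 := by
    field_simp
    ring
  nlinarith

/-- `E` is the spectral measure of the operator `ε`, i.e. `ε = ∫ x dE(x)`: the domain of `ε` is
the set of `u` with `∫ x² d(u|E(x)u) < ∞`, and `(u|εu) = ∫ x d(u|E(x)u)` on it. -/
def IsSpectralMeasureOf (ε : H →ₗ.[ℂ] H) : Prop :=
  (∀ u : H, u ∈ ε.domain ↔ ∫⁻ x : ℝ, ENNReal.ofReal (x ^ 2) ∂(E.measure u) < ⊤) ∧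
    ∀ u : ε.domain, ⟪(u : H), ε u⟫_ℂ = ∫ x : ℝ, (x : ℂ) ∂(E.measure (u : H))

/-- The spectral measure of the zero operator. -/
def dirac : SpectralMeasure H where
  proj S := Set.indicator S (fun _ => (1 : H →L[ℂ] H)) 0
  isStarProjection S _ := by
    by_cases h : (0 : ℝ) ∈ S
    · simp [h, IsStarProjection.one]
    · simp [h, IsStarProjection.zero]
  univ := by simp
  hasSum_iUnion S _ hd u := by
    by_cases h : ∃ n, (0 : ℝ) ∈ S n
    · obtain ⟨n, hn⟩ := h
      have h0 : (0 : ℝ) ∈ ⋃ n, S n := Set.mem_iUnion.mpr ⟨n, hn⟩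
      have hs := hasSum_single (f := fun k => (Set.indicator (S k)
        (fun _ => (1 : H →L[ℂ] H)) 0) u) n (fun k hk => by
          have : (0 : ℝ) ∉ S k := fun hk' => (Set.disjoint_left.mp (hd hk)) hk' hn
          simp [this])
      simpa [h0, hn] using hs
    · have h0 : (0 : ℝ) ∉ ⋃ n, S n := by simpa using h
      push Not at h
      simp [h0, h, hasSum_zero]

instance : Nonempty (SpectralMeasure H) := ⟨dirac⟩

end SpectralMeasure

/-- The spectral measure of the selfadjoint operator `ε`. -/
def spectralMeasure (ε : H →ₗ.[ℂ] H) : SpectralMeasure H :=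
  Classical.epsilon fun E => E.IsSpectralMeasureOf ε

open Classical in
/-- The bounded operator `f(ε) = ∫ f(x) dE(x)`, for a bounded Borel function `f`: the bounded
operator `T` with `(u|Tu) = ∫ f(x) d(u|E(x)u)` for all `u`. -/
def borelFun (ε : H →ₗ.[ℂ] H) (f : ℝ → ℂ) : H →L[ℂ] H :=
  if h : ∃ T : H →L[ℂ] H, ∀ u : H, ⟪u, T u⟫_ℂ = ∫ x, f x ∂((spectralMeasure ε).measure u)
  then h.choose else 0

end Spectral

section Spaces

variable {H : Type*} [NormedAddCommGroup H] [InnerProductSpace ℂ H] [CompleteSpace H]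

/-- The function `x ↦ ⟨x²⟩^{2s}`, which gives `⟨h₀⟩^{2s}` with `h₀ = ε²`. -/
def weight (s x : ℝ) : ℝ := (1 + (x ^ 2) ^ 2) ^ s

theorem weight_pos (s x : ℝ) : 0 < weight s x := Real.rpow_pos_of_pos (by positivity) s

theorem measurable_weight (s : ℝ) : Measurable (weight s) := by
  unfold weight
  fun_prop

/-- The quadratic form `u ↦ ‖⟨h₀⟩ˢ u‖²`, with value `∞` outside the domain of `⟨h₀⟩ˢ`. -/
def sobolevForm (ε : H →ₗ.[ℂ] H) (s : ℝ) (u : H) : ℝ≥0∞ :=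
  ∫⁻ x, ENNReal.ofReal (weight s x) ∂((spectralMeasure ε).measure u)

theorem sobolevForm_add_le (ε : H →ₗ.[ℂ] H) (s : ℝ) (u v : H) {t : ℝ} (ht : 0 < t) :
    sobolevForm ε s (u + v) ≤ ENNReal.ofReal (1 + t) * sobolevForm ε s u +
      ENNReal.ofReal (1 + t⁻¹) * sobolevForm ε s v := by
  unfold sobolevForm
  refine (lintegral_mono' ((spectralMeasure ε).measure_add_le u v ht) le_rfl).trans ?_
  rw [lintegral_add_measure, lintegral_smul_measure, lintegral_smul_measure, smul_eq_mul,
    smul_eq_mul]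

theorem sobolevForm_smul (ε : H →ₗ.[ℂ] H) (s : ℝ) (c : ℂ) (u : H) :
    sobolevForm ε s (c • u) = ENNReal.ofReal (‖c‖ ^ 2) * sobolevForm ε s u := by
  unfold sobolevForm
  rw [(spectralMeasure ε).measure_smul, lintegral_smul_measure, smul_eq_mul]

theorem sobolevForm_eq_zero (ε : H →ₗ.[ℂ] H) (s : ℝ) (u : H) :
    sobolevForm ε s u = 0 ↔ u = 0 := by
  constructor
  · intro h
    unfold sobolevForm at h
    rw [lintegral_eq_zero_iff (measurable_weight s).ennreal_ofReal] at h
    have h2 : ∀ᵐ x ∂((spectralMeasure ε).measure u), False := by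
      filter_upwards [h] with x hx
      simp only [Pi.zero_apply, ENNReal.ofReal_eq_zero] at hx
      exact absurd hx (not_le.mpr (weight_pos s x))
    have h3 : (spectralMeasure ε).measure u Set.univ = 0 := by
      simpa [ae_iff] using h2
    rw [(spectralMeasure ε).measure_univ, ENNReal.ofReal_eq_zero] at h3
    have : ‖u‖ = 0 := by nlinarith [norm_nonneg u]
    exact norm_eq_zero.mp this
  · rintro rfl
    have := sobolevForm_smul ε s 0 0
    simpa using this

/-- The domain of `⟨h₀⟩ˢ`, where `h₀ = ε²`. -/
def sobolevSubmodule (ε : H →ₗ.[ℂ] H) (s : ℝ) : Submodule ℂ H where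
  carrier := {u | sobolevForm ε s u < ⊤}
  zero_mem' := by simp [(sobolevForm_eq_zero ε s 0).mpr rfl]
  add_mem' := by
    intro u v hu hv
    refine (sobolevForm_add_le ε s u v one_pos).trans_lt ?_
    exact ENNReal.add_lt_top.mpr
      ⟨ENNReal.mul_lt_top ENNReal.ofReal_lt_top hu, ENNReal.mul_lt_top ENNReal.ofReal_lt_top hv⟩
  smul_mem' := by
    intro c u hu
    change sobolevForm ε s (c • u) < ⊤
    rw [sobolevForm_smul]
    exact ENNReal.mul_lt_top ENNReal.ofReal_lt_top hu

/-- The Sobolev space `⟨h₀⟩⁻ˢ H = Dom |h₀|ˢ`, `s ≥ 0`, with the norm `‖⟨h₀⟩ˢ u‖`, where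
`h₀ = ε²`. -/
def Sobolev (ε : H →ₗ.[ℂ] H) (s : ℝ) : Type _ := sobolevSubmodule ε s

namespace Sobolev

variable (ε : H →ₗ.[ℂ] H) (s : ℝ)

instance : AddCommGroup (Sobolev ε s) := inferInstanceAs (AddCommGroup (sobolevSubmodule ε s))

instance : Module ℂ (Sobolev ε s) := inferInstanceAs (Module ℂ (sobolevSubmodule ε s))

/-- The inclusion of `⟨h₀⟩⁻ˢ H` in `H`. -/
def toH : Sobolev ε s →ₗ[ℂ] H := (sobolevSubmodule ε s).subtype

theorem toH_injective : Function.Injective (toH ε s) := Subtype.val_injective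

theorem form_lt_top (u : Sobolev ε s) : sobolevForm ε s (toH ε s u) < ⊤ := u.2

instance : Norm (Sobolev ε s) := ⟨fun u => √(sobolevForm ε s (toH ε s u)).toReal⟩

theorem norm_def (u : Sobolev ε s) : ‖u‖ = √(sobolevForm ε s (toH ε s u)).toReal := rfl

theorem norm_eq_zero_iff' (u : Sobolev ε s) : ‖u‖ = 0 ↔ u = 0 := by
  rw [norm_def, Real.sqrt_eq_zero ENNReal.toReal_nonneg, ENNReal.toReal_eq_zero_iff,
    or_iff_left (form_lt_top ε s u).ne, sobolevForm_eq_zero, map_eq_zero_iff _ (toH_injective ε s)]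

theorem norm_sq_add_le (u v : Sobolev ε s) {t : ℝ} (ht : 0 < t) :
    ‖u + v‖ ^ 2 ≤ (1 + t) * ‖u‖ ^ 2 + (1 + t⁻¹) * ‖v‖ ^ 2 := by
  have hu := (form_lt_top ε s u).ne
  have hv := (form_lt_top ε s v).ne
  have h := sobolevForm_add_le ε s (toH ε s u) (toH ε s v) ht
  have h1 := ENNReal.mul_ne_top (ENNReal.ofReal_ne_top (r := 1 + t)) hu
  have h2 := ENNReal.mul_ne_top (ENNReal.ofReal_ne_top (r := 1 + t⁻¹)) hv
  have h3 := ENNReal.toReal_mono (ENNReal.add_ne_top.mpr ⟨h1, h2⟩) h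
  rw [ENNReal.toReal_add h1 h2, ENNReal.toReal_mul, ENNReal.toReal_mul,
    ENNReal.toReal_ofReal (by positivity), ENNReal.toReal_ofReal (by positivity)] at h3
  simp only [norm_def, Real.sq_sqrt ENNReal.toReal_nonneg, map_add]
  exact h3

theorem core : NormedSpace.Core ℂ (Sobolev ε s) where
  norm_nonneg u := Real.sqrt_nonneg _
  norm_smul c u := by
    rw [norm_def, norm_def, map_smul, sobolevForm_smul, ENNReal.toReal_mul,
      ENNReal.toReal_ofReal (by positivity), Real.sqrt_mul (by positivity),
      Real.sqrt_sq (norm_nonneg c)]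
  norm_triangle u v := by
    have hu0 : 0 ≤ ‖u‖ := Real.sqrt_nonneg _
    have hv0 : 0 ≤ ‖v‖ := Real.sqrt_nonneg _
    rcases hu0.eq_or_lt with hu | hu
    · have : u = 0 := (norm_eq_zero_iff' ε s u).mp hu.symm
      rw [← hu, this, zero_add, zero_add]
    rcases hv0.eq_or_lt with hv | hv
    · have : v = 0 := (norm_eq_zero_iff' ε s v).mp hv.symm
      rw [← hv, this, add_zero, add_zero]
    have h := norm_sq_add_le ε s u v (t := ‖v‖ / ‖u‖) (by positivity)
    have h2 : (1 + ‖v‖ / ‖u‖) * ‖u‖ ^ 2 + (1 + (‖v‖ / ‖u‖)⁻¹) * ‖v‖ ^ 2 = (‖u‖ + ‖v‖) ^ 2 := by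
      field_simp
      ring
    rw [h2] at h
    exact le_of_sq_le_sq h (by positivity)
  norm_eq_zero_iff u := norm_eq_zero_iff' ε s u

instance : NormedAddCommGroup (Sobolev ε s) := NormedAddCommGroup.ofCore (core ε s)

instance : NormedSpace ℂ (Sobolev ε s) := NormedSpace.ofCore (core ε s)

instance : CoeOut (Sobolev ε s) H := ⟨toH ε s⟩

end Sobolev

/-- The charge space `K_θ = ⟨h₀⟩^{-θ}H ⊕ ⟨h₀⟩^{θ}H`, where `h₀ = ε²`. The second summand is the
adjoint space of the first one, that is its space of continuous antilinear forms; a vector `v` of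
`H` is viewed as an element of it through `w ↦ (w|v)`. -/
abbrev ChargeSpace (ε : H →ₗ.[ℂ] H) (θ : ℝ) : Type _ :=
  Sobolev ε θ × (Sobolev ε θ →L⋆[ℂ] ℂ)

/-- The graph of the free charge operator. On the energy space, i.e. for `u₀ ∈ Dom ε` and
`u₁ ∈ H`, put `K̂₀(u₀, u₁) = (u₁, h₀u₀)`, where `h₀u₀` is the antilinear form `w ↦ (εw|εu₀)` on
`Dom ε = ⟨h₀⟩^{-1/2}H`. The graph consists of the pairs `(u, K̂₀u)` such that `u` is in the energy
space and both `u` and `K̂₀u` are in `K_θ`. -/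
def chargeGraph (ε : H →ₗ.[ℂ] H) (θ : ℝ) :
    Submodule ℂ (ChargeSpace ε θ × ChargeSpace ε θ) where
  carrier := {p | (∀ w : Sobolev ε θ, p.1.2 w = ⟪(w : H), (p.2.1 : H)⟫_ℂ) ∧
    ∃ h : (p.1.1 : H) ∈ ε.domain, ∀ (w : Sobolev ε θ) (hw : (w : H) ∈ ε.domain),
      p.2.2 w = ⟪ε ⟨w, hw⟩, ε ⟨p.1.1, h⟩⟫_ℂ}
  zero_mem' := by
    refine ⟨fun w => by simp, by simp, fun w hw => ?_⟩
    have : (⟨((0 : ChargeSpace ε θ × ChargeSpace ε θ).1.1 : H), by simp⟩ : ε.domain) = 0 :=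
      Subtype.ext (by simp)
    rw [this]
    simp
  add_mem' := by
    rintro p q ⟨hp1, hp2, hp3⟩ ⟨hq1, hq2, hq3⟩
    refine ⟨fun w => ?_, ?_, fun w hw => ?_⟩
    · simp [hp1, hq1]
    · simpa using ε.domain.add_mem hp2 hq2
    · have : (⟨((p + q).1.1 : H), by simpa using ε.domain.add_mem hp2 hq2⟩ : ε.domain)
          = ⟨p.1.1, hp2⟩ + ⟨q.1.1, hq2⟩ := Subtype.ext (by simp)
      rw [this, LinearPMap.map_add, inner_add_right, ← hp3 w hw, ← hq3 w hw]
      simp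
  smul_mem' := by
    rintro c p ⟨hp1, hp2, hp3⟩
    refine ⟨fun w => ?_, ?_, fun w hw => ?_⟩
    · simp [hp1]
    · simpa using ε.domain.smul_mem c hp2
    · have : (⟨((c • p).1.1 : H), by simpa using ε.domain.smul_mem c hp2⟩ : ε.domain)
          = c • ⟨p.1.1, hp2⟩ := Subtype.ext (by simp)
      rw [this, LinearPMap.map_smul, inner_smul_right, ← hp3 w hw]
      simp

/-- The free charge operator `K_{0,θ}`, the (in general unbounded) operator induced in `K_θ` by
`K̂₀ = (0, 1; h₀, 0)`, where `h₀ = ε²`. -/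
def chargeOperator (ε : H →ₗ.[ℂ] H) (θ : ℝ) : ChargeSpace ε θ →ₗ.[ℂ] ChargeSpace ε θ :=
  (chargeGraph ε θ).toLinearPMap

/-- `R = (T - z)⁻¹` for a partially defined operator `T`: `T - z` is a bijection of its domain
onto the whole space with bounded inverse `R`. -/
def IsResolventAt {X : Type*} [NormedAddCommGroup X] [NormedSpace ℂ X] (T : X →ₗ.[ℂ] X) (z : ℂ)
    (R : X →L[ℂ] X) : Prop :=
  (∀ y : X, ∃ h : R y ∈ T.domain, T ⟨R y, h⟩ - z • R y = y) ∧
    ∀ u : T.domain, R (T u - z • (u : X)) = u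

end Spaces

section Functions

/-- `φ₊(x) = (φ(x) + φ(-x)) / 2`. -/
def evenPart (φ : ℝ → ℂ) (x : ℝ) : ℂ := (φ x + φ (-x)) / 2

/-- `φ₋(x) = (φ(x) - φ(-x)) / 2`. -/
def oddPart (φ : ℝ → ℂ) (x : ℝ) : ℂ := (φ x - φ (-x)) / 2

/-- The function `φ₋(x) / x`, with the value `φ'(0)` at `x = 0`. -/
def oddQuot (φ : ℝ → ℂ) (x : ℝ) : ℂ := if x = 0 then deriv φ 0 else oddPart φ x / x

/-- `‖φ‖_Λ = sup_x |φ(x)| + sup_{x ≥ 0} |φ₋(x)/x|`. The quotient `0/0` at `x = 0` counts as `0`;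
if `φ` is differentiable at `0`, then the value `φ'(0)` there gives the same supremum. -/
def normLambda (φ : ℝ → ℂ) : ℝ≥0∞ :=
  (⨆ x : ℝ, ‖φ x‖ₑ) + ⨆ x : ℝ, ⨆ _ : 0 ≤ x, ‖oddPart φ x / (x : ℂ)‖ₑ

/-- `‖φ‖_{Λ_θ} = ‖φ‖_Λ + sup_{x ≥ 0} |φ₋(x)/x| + sup_x |φ₋(x)| ⟨x⟩^{|4θ-1|}`, where
`⟨x⟩ = (1 + x²)^{1/2}`. -/
def normLambdaTheta (θ : ℝ) (φ : ℝ → ℂ) : ℝ≥0∞ :=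
  normLambda φ + (⨆ x : ℝ, ⨆ _ : 0 ≤ x, ‖oddPart φ x / (x : ℂ)‖ₑ) +
    ⨆ x : ℝ, ‖oddPart φ x‖ₑ * ENNReal.ofReal (√(1 + x ^ 2) ^ |4 * θ - 1|)

theorem normLambdaTheta_lt_top_iff (θ : ℝ) (φ : ℝ → ℂ) :
    normLambdaTheta θ φ < ⊤ ↔ ∃ M : ℝ, ∀ x : ℝ, ‖φ x‖ ≤ M ∧
      (0 ≤ x → ‖oddPart φ x / (x : ℂ)‖ ≤ M) ∧
      ‖oddPart φ x‖ * √(1 + x ^ 2) ^ |4 * θ - 1| ≤ M := by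
  have key : ∀ y : ℂ, ∀ A : ℝ≥0∞, A ≠ ⊤ → ‖y‖ₑ ≤ A → ‖y‖ ≤ A.toReal := by
    intro y A hA h
    rw [← ofReal_norm] at h
    exact (ENNReal.ofReal_le_iff_le_toReal hA).mp h
  constructor
  · intro h
    unfold normLambdaTheta normLambda at h
    rw [ENNReal.add_lt_top, ENNReal.add_lt_top, ENNReal.add_lt_top] at h
    obtain ⟨⟨⟨h1, h2⟩, -⟩, h3⟩ := h
    refine ⟨max (max (⨆ x : ℝ, ‖φ x‖ₑ).toReal
      (⨆ x : ℝ, ⨆ _ : 0 ≤ x, ‖oddPart φ x / (x : ℂ)‖ₑ).toReal)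
      (⨆ x : ℝ, ‖oddPart φ x‖ₑ * ENNReal.ofReal (√(1 + x ^ 2) ^ |4 * θ - 1|)).toReal,
      fun x => ⟨?_, fun hx => ?_, ?_⟩⟩
    · exact le_max_of_le_left (le_max_of_le_left
        (key _ _ h1.ne (le_iSup (fun x : ℝ => ‖φ x‖ₑ) x)))
    · exact le_max_of_le_left (le_max_of_le_right
        (key _ _ h2.ne (le_iSup₂ (f := fun (x : ℝ) (_ : 0 ≤ x) => ‖oddPart φ x / (x : ℂ)‖ₑ) x hx)))
    · refine le_max_of_le_right ?_
      have h4 := le_iSup (fun x : ℝ => ‖oddPart φ x‖ₑ *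
        ENNReal.ofReal (√(1 + x ^ 2) ^ |4 * θ - 1|)) x
      simp only [← ofReal_norm] at h4
      rw [← ENNReal.ofReal_mul (norm_nonneg _)] at h4
      simp only [ofReal_norm] at h4
      exact (ENNReal.ofReal_le_iff_le_toReal h3.ne).mp h4
  · rintro ⟨M, hM⟩
    unfold normLambdaTheta normLambda
    have h1 : (⨆ x : ℝ, ‖φ x‖ₑ) < ⊤ := by
      refine (iSup_le fun x => ?_ : _ ≤ ENNReal.ofReal M).trans_lt ENNReal.ofReal_lt_top
      rw [← ofReal_norm]
      exact ENNReal.ofReal_le_ofReal (hM x).1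
    have h2 : (⨆ x : ℝ, ⨆ _ : 0 ≤ x, ‖oddPart φ x / (x : ℂ)‖ₑ) < ⊤ := by
      refine (iSup₂_le fun x hx => ?_ : _ ≤ ENNReal.ofReal M).trans_lt ENNReal.ofReal_lt_top
      rw [← ofReal_norm]
      exact ENNReal.ofReal_le_ofReal ((hM x).2.1 hx)
    have h3 : (⨆ x : ℝ, ‖oddPart φ x‖ₑ *
        ENNReal.ofReal (√(1 + x ^ 2) ^ |4 * θ - 1|)) < ⊤ := by
      refine (iSup_le fun x => ?_ : _ ≤ ENNReal.ofReal M).trans_lt ENNReal.ofReal_lt_top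
      rw [← ofReal_norm, ← ENNReal.ofReal_mul (norm_nonneg _)]
      exact ENNReal.ofReal_le_ofReal (hM x).2.2
    exact ENNReal.add_lt_top.mpr
      ⟨ENNReal.add_lt_top.mpr ⟨ENNReal.add_lt_top.mpr ⟨h1, h2⟩, h2⟩, h3⟩

theorem oddPart_add (φ χ : ℝ → ℂ) (x : ℝ) :
    oddPart (φ + χ) x = oddPart φ x + oddPart χ x := by
  simp only [oddPart, Pi.add_apply]; ring

theorem oddPart_mul (φ χ : ℝ → ℂ) (x : ℝ) :
    oddPart (φ * χ) x = evenPart φ x * oddPart χ x + evenPart χ x * oddPart φ x := by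
  simp only [oddPart, evenPart, Pi.mul_apply]; ring

theorem norm_evenPart_le {φ : ℝ → ℂ} {M : ℝ} (h : ∀ x, ‖φ x‖ ≤ M) (x : ℝ) :
    ‖evenPart φ x‖ ≤ M := by
  unfold evenPart
  rw [norm_div]
  have h1 := norm_add_le (φ x) (φ (-x))
  have h2 := h x
  have h3 := h (-x)
  simp only [Complex.norm_ofNat]
  linarith

/-- The algebra `Λ_θ` of Borel functions `φ : ℝ → ℂ` with `‖φ‖_{Λ_θ} < ∞`. -/
def Lambda (θ : ℝ) : Subalgebra ℂ (ℝ → ℂ) where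
  carrier := {φ | Measurable φ ∧ normLambdaTheta θ φ < ⊤}
  algebraMap_mem' := by
    intro c
    refine ⟨measurable_const, (normLambdaTheta_lt_top_iff θ _).mpr ⟨‖c‖, fun x => ?_⟩⟩
    have : oddPart (algebraMap ℂ (ℝ → ℂ) c) x = 0 := by simp [oddPart]
    simp [this]
  add_mem' := by
    rintro φ χ ⟨hφ, hφ'⟩ ⟨hχ, hχ'⟩
    refine ⟨hφ.add hχ, ?_⟩
    rw [normLambdaTheta_lt_top_iff] at *
    obtain ⟨M, hM⟩ := hφ'
    obtain ⟨N, hN⟩ := hχ'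
    refine ⟨M + N, fun x => ⟨?_, fun hx => ?_, ?_⟩⟩
    · exact (norm_add_le _ _).trans (add_le_add (hM x).1 (hN x).1)
    · rw [oddPart_add, add_div]
      exact (norm_add_le _ _).trans (add_le_add ((hM x).2.1 hx) ((hN x).2.1 hx))
    · rw [oddPart_add]
      refine le_trans (mul_le_mul_of_nonneg_right (norm_add_le _ _) (by positivity)) ?_
      rw [add_mul]
      exact add_le_add (hM x).2.2 (hN x).2.2
  mul_mem' := by
    rintro φ χ ⟨hφ, hφ'⟩ ⟨hχ, hχ'⟩
    refine ⟨hφ.mul hχ, ?_⟩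
    rw [normLambdaTheta_lt_top_iff] at *
    obtain ⟨M, hM⟩ := hφ'
    obtain ⟨N, hN⟩ := hχ'
    have hM0 : 0 ≤ M := (norm_nonneg _).trans (hM 0).1
    have hN0 : 0 ≤ N := (norm_nonneg _).trans (hN 0).1
    have he := norm_evenPart_le fun x => (hM x).1
    have he' := norm_evenPart_le fun x => (hN x).1
    have hMN : M * N ≤ M * N + N * M := by nlinarith
    refine ⟨M * N + N * M, fun x => ⟨?_, fun hx => ?_, ?_⟩⟩
    · refine le_trans ?_ hMN
      rw [Pi.mul_apply, norm_mul]
      exact mul_le_mul (hM x).1 (hN x).1 (norm_nonneg _) hM0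
    · rw [oddPart_mul, add_div, mul_div_assoc, mul_div_assoc]
      refine (norm_add_le _ _).trans ?_
      rw [norm_mul, norm_mul]
      exact add_le_add (mul_le_mul (he x) ((hN x).2.1 hx) (norm_nonneg _) hM0)
        (mul_le_mul (he' x) ((hM x).2.1 hx) (norm_nonneg _) hN0)
    · rw [oddPart_mul]
      refine le_trans (mul_le_mul_of_nonneg_right (norm_add_le _ _) (by positivity)) ?_
      rw [norm_mul, norm_mul, add_mul, mul_assoc, mul_assoc]
      exact add_le_add (mul_le_mul (he x) (hN x).2.2 (by positivity) hM0)
        (mul_le_mul (he' x) (hM x).2.2 (by positivity) hN0)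

/-- The subalgebra of the functions in `Λ_θ` that are differentiable at `0`, so that the value
`φ'(0)` of `φ₋(x)/x` at `x = 0` makes sense. -/
def LambdaDiff (θ : ℝ) : Subalgebra ℂ (ℝ → ℂ) where
  carrier := {φ | φ ∈ Lambda θ ∧ DifferentiableAt ℝ φ 0}
  algebraMap_mem' c := ⟨(Lambda θ).algebraMap_mem c, differentiableAt_const c⟩
  add_mem' h h' := ⟨(Lambda θ).add_mem h.1 h'.1, h.2.add h'.2⟩
  mul_mem' h h' := ⟨(Lambda θ).mul_mem h.1 h'.1, h.2.mul h'.2⟩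

/-- Pointwise convergence of a sequence of functions on the real line. -/
def PtConv (φn : ℕ → ℝ → ℂ) (φ : ℝ → ℂ) : Prop :=
  ∀ x : ℝ, Tendsto (fun n => φn n x) atTop (𝓝 (φ x))

/-- Pointwise convergence of `φₙ` and of `φₙ₋(x)/x`, the latter having the value `φₙ'(0)` at
`x = 0`; for `x ≠ 0` the second convergence follows from the first one. -/
def PtConvDiff (φn : ℕ → ℝ → ℂ) (φ : ℝ → ℂ) : Prop :=
  PtConv φn φ ∧ ∀ x : ℝ, Tendsto (fun n => oddQuot (φn n) x) atTop (𝓝 (oddQuot φ x))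

end Functions

section Calculus

variable {H : Type*} [NormedAddCommGroup H] [InnerProductSpace ℂ H] [CompleteSpace H]

/-- The two characteristic properties of the functional calculus `φ ↦ φ(K_{0,θ})` on an algebra
`A` of functions: it sends `x ↦ (x - z)⁻¹` to `(K_{0,θ} - z)⁻¹` for all non-real `z`, and if a
sequence bounded in `Λ_θ` converges to a function of `A` in the sense `conv`, then the operators
converge weakly. -/
def IsBorelCalculus (ε : H →ₗ.[ℂ] H) (θ : ℝ) (A : Subalgebra ℂ (ℝ → ℂ))
    (conv : (ℕ → ℝ → ℂ) → (ℝ → ℂ) → Prop)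
    (F : A →ₗ[ℂ] (ChargeSpace ε θ →L[ℂ] ChargeSpace ε θ)) : Prop :=
  (∀ z : ℂ, z.im ≠ 0 → ∃ hz : (fun x : ℝ => ((x : ℂ) - z)⁻¹) ∈ A,
      IsResolventAt (chargeOperator ε θ) z (F ⟨_, hz⟩)) ∧
    ∀ (φn : ℕ → A) (φ : A),
      (∃ M : ℝ≥0, ∀ n, normLambdaTheta θ (φn n) ≤ M) →
      conv (fun n => (φn n : ℝ → ℂ)) φ →
      ∀ (u : ChargeSpace ε θ) (ℓ : StrongDual ℂ (ChargeSpace ε θ)),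
        Tendsto (fun n => ℓ (F (φn n) u)) atTop (𝓝 (ℓ (F φ u)))

/-- The operator `T` in `K_θ` is given by the matrix
`(φ₊(ε), φ₋(ε)/ε; φ₋(ε)ε, φ₊(ε))`
on the energy space, that is for all `u₀ ∈ Dom ε`, `u₁ ∈ H`. Recall that a vector of `H` stands
for the antilinear form it defines in the second summand of `K_θ`. -/
def HasMatrix (ε : H →ₗ.[ℂ] H) (θ : ℝ) (φ : ℝ → ℂ)
    (T : ChargeSpace ε θ →L[ℂ] ChargeSpace ε θ) : Prop :=
  ∀ (u : ChargeSpace ε θ) (h : (u.1 : H) ∈ ε.domain) (u₁ : H),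
    (∀ w : Sobolev ε θ, u.2 w = ⟪(w : H), u₁⟫_ℂ) →
      ((T u).1 : H) = borelFun ε (evenPart φ) (u.1 : H) + borelFun ε (oddQuot φ) u₁ ∧
      ∀ w : Sobolev ε θ, (T u).2 w =
        ⟪(w : H), borelFun ε (oddPart φ) (ε ⟨u.1, h⟩) + borelFun ε (evenPart φ) u₁⟫_ℂ

end Calculus

end KleinGordon

end

open KleinGordon

noncomputable section

set_option linter.unusedSectionVars false

namespace KleinGordon

section MonotoneClass

/-- Bounded Borel functions on the real line. -/
def BoundedBorel (f : ℝ → ℂ) : Prop := Measurable f ∧ ∃ C : ℝ, ∀ x, ‖f x‖ ≤ C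

namespace BoundedBorel

variable {f g : ℝ → ℂ}

theorem measurable (hf : BoundedBorel f) : Measurable f := hf.1

theorem add (hf : BoundedBorel f) (hg : BoundedBorel g) : BoundedBorel (f + g) := by
  obtain ⟨hf, C, hC⟩ := hf
  obtain ⟨hg, D, hD⟩ := hg
  exact ⟨hf.add hg, C + D, fun x => (norm_add_le _ _).trans (add_le_add (hC x) (hD x))⟩

theorem mul (hf : BoundedBorel f) (hg : BoundedBorel g) : BoundedBorel (f * g) := by
  obtain ⟨hf, C, hC⟩ := hf
  obtain ⟨hg, D, hD⟩ := hg
  refine ⟨hf.mul hg, C * D, fun x => ?_⟩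
  rw [Pi.mul_apply, norm_mul]
  exact mul_le_mul (hC x) (hD x) (norm_nonneg _) ((norm_nonneg _).trans (hC x))

theorem smul (c : ℂ) (hf : BoundedBorel f) : BoundedBorel (c • f) := by
  obtain ⟨hf, C, hC⟩ := hf
  refine ⟨hf.const_smul c, ‖c‖ * C, fun x => ?_⟩
  rw [Pi.smul_apply, norm_smul]
  exact mul_le_mul_of_nonneg_left (hC x) (norm_nonneg _)

theorem star (hf : BoundedBorel f) : BoundedBorel (star f) := by
  obtain ⟨hf, C, hC⟩ := hf
  exact ⟨Complex.continuous_conj.measurable.comp hf, C, fun x => by simpa using hC x⟩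

theorem one : BoundedBorel 1 := ⟨measurable_one, 1, fun x => by simp⟩

theorem indicator (hf : BoundedBorel f) {S : Set ℝ} (hS : MeasurableSet S) :
    BoundedBorel (S.indicator f) := by
  obtain ⟨hf, C, hC⟩ := hf
  exact ⟨hf.indicator hS, C, fun x => (norm_indicator_le_norm_self _ _).trans (hC x)⟩

theorem indicator_one {S : Set ℝ} (hS : MeasurableSet S) :
    BoundedBorel (S.indicator 1) := one.indicator hS

theorem integrable (hf : BoundedBorel f) (ν : Measure ℝ) [IsFiniteMeasure ν] :
    Integrable f ν := by
  obtain ⟨hf, C, hC⟩ := hf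
  exact Integrable.of_bound hf.aestronglyMeasurable C (Eventually.of_forall hC)

end BoundedBorel

theorem tendsto_integral_of_bounded {fn : ℕ → ℝ → ℂ} {f : ℝ → ℂ} {C : ℝ}
    (hm : ∀ n, Measurable (fn n)) (hC : ∀ n x, ‖fn n x‖ ≤ C) (hf : PtConv fn f)
    (ν : Measure ℝ) [IsFiniteMeasure ν] :
    Tendsto (fun n => ∫ x, fn n x ∂ν) atTop (𝓝 (∫ x, f x ∂ν)) :=
  tendsto_integral_of_dominated_convergence (fun _ => C)
    (fun n => (hm n).aestronglyMeasurable) (integrable_const C)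
    (fun n => Eventually.of_forall (hC n)) (Eventually.of_forall hf)

/-- A linear space of bounded Borel functions that is closed under bounded pointwise limits of
sequences. -/
structure IsMonotoneClass (𝒞 : (ℝ → ℂ) → Prop) : Prop where
  add : ∀ f g, BoundedBorel f → BoundedBorel g → 𝒞 f → 𝒞 g → 𝒞 (f + g)
  smul : ∀ (c : ℂ) f, BoundedBorel f → 𝒞 f → 𝒞 (c • f)
  lim : ∀ (fn : ℕ → ℝ → ℂ) (f : ℝ → ℂ) (C : ℝ), (∀ n, Measurable (fn n)) →
    (∀ n x, ‖fn n x‖ ≤ C) → PtConv fn f → (∀ n, 𝒞 (fn n)) → 𝒞 f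

theorem IsMonotoneClass.of_indicator {𝒞 : (ℝ → ℂ) → Prop} (h𝒞 : IsMonotoneClass 𝒞)
    (h : ∀ S, MeasurableSet S → 𝒞 (S.indicator 1)) {f : ℝ → ℂ} (hf : BoundedBorel f) : 𝒞 f := by
  obtain ⟨hf, C, hC⟩ := hf
  have hsm := hf.stronglyMeasurable
  have key : ∀ g : SimpleFunc ℝ ℂ, BoundedBorel g ∧ 𝒞 g := by
    intro g
    induction g using SimpleFunc.induction with
    | @const c s hs =>
      have : ((SimpleFunc.piecewise _ hs (SimpleFunc.const ℝ c) (SimpleFunc.const ℝ 0)) : ℝ → ℂ)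
          = c • s.indicator 1 := by
        ext x
        simp [Set.indicator, Set.piecewise]
      rw [this]
      exact ⟨(BoundedBorel.indicator_one hs).smul c,
        h𝒞.smul c _ (BoundedBorel.indicator_one hs) (h _ hs)⟩
    | add _ hf hg =>
      rw [SimpleFunc.coe_add]
      exact ⟨hf.1.add hg.1, h𝒞.add _ _ hf.1 hg.1 hf.2 hg.2⟩
  have hC0 : 0 ≤ C := (norm_nonneg _).trans (hC 0)
  exact h𝒞.lim (fun n => hsm.approxBounded C n) f C
    (fun n => (hsm.approxBounded C n).measurable)
    (fun n x => hsm.norm_approxBounded_le hC0 n x)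
    (fun x => hsm.tendsto_approxBounded_of_norm_le (hC x)) fun n => (key _).2

/-- A piecewise linear function with values in `[0, 1]` that vanishes on `[b, ∞)`. -/
def ramp (b : ℝ) (n : ℕ) (x : ℝ) : ℝ := min 1 (n * max 0 (b - x))

theorem continuous_ramp (b : ℝ) (n : ℕ) : Continuous (ramp b n) := by
  unfold ramp; fun_prop

theorem ramp_nonneg (b : ℝ) (n : ℕ) (x : ℝ) : 0 ≤ ramp b n x := by
  unfold ramp; positivity

theorem ramp_le_one (b : ℝ) (n : ℕ) (x : ℝ) : ramp b n x ≤ 1 := min_le_left _ _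

theorem ramp_eq_zero {b x : ℝ} (h : b ≤ x) (n : ℕ) : ramp b n x = 0 := by
  simp [ramp, max_eq_left (sub_nonpos.mpr h)]

theorem norm_ramp_le (b : ℝ) (n : ℕ) (x : ℝ) : ‖(ramp b n x : ℂ)‖ ≤ 1 := by
  rw [Complex.norm_real, Real.norm_of_nonneg (ramp_nonneg _ _ _)]
  exact ramp_le_one _ _ _

theorem tendsto_ramp (b x : ℝ) :
    Tendsto (fun n => (ramp b n x : ℂ)) atTop (𝓝 ((Set.Iio b).indicator 1 x)) := by
  by_cases hx : x < b
  · rw [Set.indicator_of_mem (by exact hx)]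
    have h1 : ∀ᶠ n : ℕ in atTop, 1 ≤ n * (b - x) :=
      (tendsto_natCast_atTop_atTop.atTop_mul_const (sub_pos.mpr hx)).eventually_ge_atTop 1
    refine tendsto_const_nhds.congr' ?_
    filter_upwards [h1] with n hn
    simp [ramp, max_eq_right (sub_pos.mpr hx).le, min_eq_left hn]
  · rw [Set.indicator_of_notMem (by exact hx)]
    simp [ramp_eq_zero (not_lt.mp hx)]

theorem IsMonotoneClass.of_continuous {𝒞 : (ℝ → ℂ) → Prop} (h𝒞 : IsMonotoneClass 𝒞)
    (h : ∀ g : ℝ → ℝ, Continuous g → (∃ C, ∀ x, |g x| ≤ C) → 𝒞 fun x => g x)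
    {f : ℝ → ℂ} (hf : BoundedBorel f) : 𝒞 f := by
  refine h𝒞.of_indicator (fun S hS => ?_) hf
  have h1 : 𝒞 1 := by
    have := h (fun _ => 1) continuous_const ⟨1, by simp⟩
    convert this using 1
    ext x
    simp
  have h0 : 𝒞 0 := by
    simpa using h𝒞.smul 0 1 BoundedBorel.one h1
  induction S, hS using MeasurableSpace.induction_on_inter
    (borel_eq_generateFrom_Iio ℝ ▸ BorelSpace.measurable_eq) isPiSystem_Iio with
  | empty => rwa [Set.indicator_empty']
  | basic t ht =>
    obtain ⟨b, rfl⟩ := ht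
    exact h𝒞.lim (fun n x => (ramp b n x : ℂ)) _ 1
      (fun n => (Complex.continuous_ofReal.comp (continuous_ramp b n)).measurable)
      (fun n x => norm_ramp_le b n x) (tendsto_ramp b)
      fun n => h _ (continuous_ramp b n) ⟨1, fun x => by
        simpa using norm_ramp_le b n x⟩
  | compl t ht ih =>
    have : (tᶜ).indicator (1 : ℝ → ℂ) = 1 + (-1 : ℂ) • t.indicator 1 := by
      ext x
      by_cases hx : x ∈ t <;> simp [hx]
    rw [this]
    exact h𝒞.add _ _ BoundedBorel.one ((BoundedBorel.indicator_one ht).smul _) h1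
      (h𝒞.smul _ _ (BoundedBorel.indicator_one ht) ih)
  | iUnion s hd hm ih =>
    have hpart : ∀ n : ℕ, MeasurableSet (⋃ i ∈ Finset.range n, s i) := fun n =>
      Finset.measurableSet_biUnion _ fun i _ => hm i
    have hn : ∀ n : ℕ, 𝒞 ((⋃ i ∈ Finset.range n, s i).indicator 1) := by
      intro n
      induction n with
      | zero =>
        have : (⋃ i ∈ Finset.range 0, s i) = ∅ := by simp
        rwa [this, Set.indicator_empty']
      | succ n ihn =>
        have : (⋃ i ∈ Finset.range (n + 1), s i).indicator (1 : ℝ → ℂ) =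
            (⋃ i ∈ Finset.range n, s i).indicator 1 + (s n).indicator 1 := by
          refine Eq.trans ?_ (Set.indicator_union_of_disjoint ?_ _)
          · congr 1
            ext x
            simp only [Finset.mem_range, Set.mem_iUnion, Set.mem_union, exists_prop,
              Nat.lt_succ_iff_lt_or_eq]
            grind
          · rw [Set.disjoint_iUnion₂_left]
            intro i hi
            exact hd (Finset.mem_range.mp hi).ne
        rw [this]
        exact h𝒞.add _ _ (BoundedBorel.indicator_one (hpart n))
          (BoundedBorel.indicator_one (hm n)) ihn (ih n)
    refine h𝒞.lim _ _ 1 (fun n => (BoundedBorel.indicator_one (hpart n)).measurable)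
      (fun n x => ?_) (fun x => ?_) hn
    · exact (norm_indicator_le_norm_self _ _).trans (by simp)
    · by_cases hx : x ∈ ⋃ i, s i
      · rw [Set.indicator_of_mem hx]
        obtain ⟨k, hk⟩ := Set.mem_iUnion.mp hx
        refine tendsto_const_nhds.congr' ?_
        filter_upwards [eventually_gt_atTop k] with n hn
        rw [Set.indicator_of_mem]
        exact Set.mem_biUnion (Finset.mem_coe.mpr (Finset.mem_range.mpr hn)) hk
      · rw [Set.indicator_of_notMem hx]
        refine tendsto_const_nhds.congr' (Eventually.of_forall fun n => ?_)
        exact (Set.indicator_of_notMem (fun h => hx (Set.iUnion₂_subset_iUnion _ _ h)) _).symm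

end MonotoneClass

section WeakLimit

variable {H : Type*} [NormedAddCommGroup H] [InnerProductSpace ℂ H]

theorem inner_map_polarization_right (T : H →L[ℂ] H) (x y : H) :
    ⟪x, T y⟫_ℂ = (⟪x + y, T (x + y)⟫_ℂ - ⟪x - y, T (x - y)⟫_ℂ
      - Complex.I * ⟪x + Complex.I • y, T (x + Complex.I • y)⟫_ℂ
      + Complex.I * ⟪x - Complex.I • y, T (x - Complex.I • y)⟫_ℂ) / 4 := by
  simp only [map_add, map_sub, inner_add_left, inner_add_right, map_smul, inner_smul_left,
    inner_smul_right, Complex.conj_I, inner_sub_left, inner_sub_right]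
  ring_nf
  simp only [Complex.I_sq]
  ring

theorem ext_inner_self {S T : H →L[ℂ] H} (h : ∀ u, ⟪u, S u⟫_ℂ = ⟪u, T u⟫_ℂ) : S = T := by
  have : (S : H →ₗ[ℂ] H) = T := by
    rw [← ext_inner_map]
    intro x
    have := congrArg (starRingEnd ℂ) (h x)
    simpa using this
  exact ContinuousLinearMap.coe_injective this

theorem norm_inner_map_le {T : H →L[ℂ] H} {C : ℝ} (hC : ∀ u, ‖⟪u, T u⟫_ℂ‖ ≤ C * ‖u‖ ^ 2)
    (hC0 : 0 ≤ C) (x y : H) : ‖⟪x, T y⟫_ℂ‖ ≤ C * (‖x‖ + ‖y‖) ^ 2 := by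
  have key : ∀ z : H, ‖z‖ ≤ ‖x‖ + ‖y‖ → ‖⟪z, T z⟫_ℂ‖ ≤ C * (‖x‖ + ‖y‖) ^ 2 := fun z hz =>
    (hC z).trans (by gcongr)
  have hI : ‖Complex.I • y‖ = ‖y‖ := by simp [norm_smul]
  have h1 := key _ (norm_add_le x y)
  have h2 := key _ (norm_sub_le x y)
  have h3 := key _ ((norm_add_le x (Complex.I • y)).trans_eq (by rw [hI]))
  have h4 := key _ ((norm_sub_le x (Complex.I • y)).trans_eq (by rw [hI]))
  rw [inner_map_polarization_right, norm_div, Complex.norm_ofNat, div_le_iff₀ (by norm_num)]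
  refine (norm_add_le _ _).trans ?_
  refine (add_le_add_left (norm_sub_le _ _) _).trans ?_
  refine (add_le_add_left (add_le_add_left (norm_sub_le _ _) _) _).trans ?_
  simp only [norm_mul, Complex.norm_I, one_mul]
  linarith

variable [CompleteSpace H]

theorem exists_weak_limit {Tn : ℕ → H →L[ℂ] H} {C : ℝ}
    (hC : ∀ n u, ‖⟪u, Tn n u⟫_ℂ‖ ≤ C * ‖u‖ ^ 2) (hC0 : 0 ≤ C) {q : H → ℂ}
    (h : ∀ u, Tendsto (fun n => ⟪u, Tn n u⟫_ℂ) atTop (𝓝 (q u))) :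
    ∃ T : H →L[ℂ] H, (∀ u, ⟪u, T u⟫_ℂ = q u) ∧
      ∀ u v, Tendsto (fun n => ⟪u, Tn n v⟫_ℂ) atTop (𝓝 ⟪u, T v⟫_ℂ) := by
  have h1 : ∀ v u, ∃ l, Tendsto (fun n => ⟪u, Tn n v⟫_ℂ) atTop (𝓝 l) := fun v u => by
    simp only [inner_map_polarization_right _ u v]
    exact ⟨_, ((((h _).sub (h _)).sub ((h _).const_mul _)).add ((h _).const_mul _)).div_const 4⟩
  choose l hl using h1
  have h2 : ∀ v, Tendsto (fun n (u : H) => innerSL ℂ (Tn n v) u) atTop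
      (𝓝 fun u => (starRingEnd ℂ) (l v u)) := fun v => by
    rw [tendsto_pi_nhds]
    intro u
    have := (Complex.continuous_conj.tendsto _).comp (hl v u)
    simpa [Function.comp_def] using this
  let S : H → H := fun v => (InnerProductSpace.toDual ℂ H).symm
    (continuousLinearMapOfTendsto (fun n => innerSL ℂ (Tn n v)) (h2 v))
  have hS : ∀ u v, ⟪u, S v⟫_ℂ = l v u := fun u v => by
    rw [← inner_conj_symm, InnerProductSpace.toDual_symm_apply]
    exact Complex.conj_conj _
  have hlim : ∀ u v, Tendsto (fun n => ⟪u, Tn n v⟫_ℂ) atTop (𝓝 ⟪u, S v⟫_ℂ) := fun u v => by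
    rw [hS]
    exact hl v u
  let S' : H →ₗ[ℂ] H :=
    { toFun := S
      map_add' := fun v w => ext_inner_left ℂ fun u => by
        refine tendsto_nhds_unique (hlim u (v + w)) ?_
        simp only [map_add, inner_add_right]
        exact (hlim u v).add (hlim u w)
      map_smul' := fun c v => ext_inner_left ℂ fun u => by
        refine tendsto_nhds_unique (hlim u (c • v)) ?_
        simp only [map_smul, inner_smul_right, RingHom.id_apply]
        exact (hlim u v).const_mul c }
  have hb : ∀ v, ‖S' v‖ ≤ 4 * C * ‖v‖ := fun v => by
    have h3 : ∀ u, ‖⟪u, S' v⟫_ℂ‖ ≤ C * (‖u‖ + ‖v‖) ^ 2 := fun u =>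
      le_of_tendsto (hlim u v).norm (Eventually.of_forall fun n => norm_inner_map_le (hC n) hC0 u v)
    rcases eq_or_ne (S' v) 0 with h0 | h0
    · rw [h0, norm_zero]
      positivity
    rcases eq_or_ne v 0 with hv | hv
    · simp [hv]
    have hn := norm_pos_iff.mpr h0
    have hvn := norm_pos_iff.mpr hv
    have h4 := h3 ((‖v‖ / ‖S' v‖ : ℂ) • S' v)
    rw [inner_smul_left, norm_mul, norm_smul, inner_self_eq_norm_sq_to_K] at h4
    simp only [RCLike.norm_conj, norm_div, Complex.norm_real, norm_norm, norm_pow,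
      Complex.coe_algebraMap] at h4
    have h5 : ‖v‖ / ‖S' v‖ * ‖S' v‖ ^ 2 = ‖v‖ * ‖S' v‖ := by field_simp
    have h6 : ‖v‖ / ‖S' v‖ * ‖S' v‖ = ‖v‖ := by field_simp
    rw [h5, h6] at h4
    refine le_of_mul_le_mul_left (h4.trans_eq ?_) hvn
    ring
  exact ⟨S'.mkContinuous _ hb, fun u => tendsto_nhds_unique (hlim u u) (h u), hlim⟩

end WeakLimit

section IsOp

variable {H : Type*} [NormedAddCommGroup H] [InnerProductSpace ℂ H]
  {μ : H → Measure ℝ}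

/-- `T` is the operator with the quadratic form `u ↦ ∫ f dμ_u`. -/
def IsOp (μ : H → Measure ℝ) (f : ℝ → ℂ) (T : H →L[ℂ] H) : Prop :=
  ∀ u, ⟪u, T u⟫_ℂ = ∫ x, f x ∂μ u

theorem isFiniteMeasure_of_univ (hμ : ∀ u, μ u Set.univ = ENNReal.ofReal (‖u‖ ^ 2)) (u : H) :
    IsFiniteMeasure (μ u) := ⟨by rw [hμ]; exact ENNReal.ofReal_lt_top⟩

namespace IsOp

variable {f g : ℝ → ℂ} {S T : H →L[ℂ] H}

theorem unique (hS : IsOp μ f S) (hT : IsOp μ f T) : S = T :=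
  ext_inner_self fun u => (hS u).trans (hT u).symm

theorem smul (c : ℂ) (hT : IsOp μ f T) : IsOp μ (c • f) (c • T) := fun u => by
  simp only [smul_apply, inner_smul_right, hT u, Pi.smul_apply, smul_eq_mul]
  rw [integral_const_mul]

section

variable (hμ : ∀ u, μ u Set.univ = ENNReal.ofReal (‖u‖ ^ 2))
include hμ

theorem add (hf : BoundedBorel f) (hg : BoundedBorel g) (hS : IsOp μ f S) (hT : IsOp μ g T) :
    IsOp μ (f + g) (S + T) := fun u => by
  have := isFiniteMeasure_of_univ hμ u
  simp only [add_apply, inner_add_right, hS u, hT u, Pi.add_apply]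
  rw [integral_add (hf.integrable _) (hg.integrable _)]

theorem norm_le {C : ℝ} (hC : ∀ x, ‖f x‖ ≤ C) (hT : IsOp μ f T) (u : H) :
    ‖⟪u, T u⟫_ℂ‖ ≤ C * ‖u‖ ^ 2 := by
  have := isFiniteMeasure_of_univ hμ u
  rw [hT u]
  refine (norm_integral_le_of_norm_le_const (Eventually.of_forall hC)).trans_eq ?_
  rw [Measure.real, hμ, ENNReal.toReal_ofReal (by positivity)]

end

variable [CompleteSpace H]

theorem adjoint (hT : IsOp μ f T) : IsOp μ (star f) (ContinuousLinearMap.adjoint T) := fun u => by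
  rw [ContinuousLinearMap.adjoint_inner_right, ← inner_conj_symm, hT u, ← integral_conj]
  rfl

end IsOp

variable [CompleteSpace H]

theorem IsOp.exists_limit (hμ : ∀ u, μ u Set.univ = ENNReal.ofReal (‖u‖ ^ 2))
    {fn : ℕ → ℝ → ℂ} {f : ℝ → ℂ} {C : ℝ}
    (hm : ∀ n, Measurable (fn n)) (hC : ∀ n x, ‖fn n x‖ ≤ C) (hf : PtConv fn f)
    {Tn : ℕ → H →L[ℂ] H} (hT : ∀ n, IsOp μ (fn n) (Tn n)) :
    ∃ T, IsOp μ f T ∧ ∀ u v, Tendsto (fun n => ⟪u, Tn n v⟫_ℂ) atTop (𝓝 ⟪u, T v⟫_ℂ) := by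
  refine exists_weak_limit (fun n u => (hT n).norm_le hμ (hC n) u)
    ((norm_nonneg _).trans (hC 0 0)) fun u => ?_
  have := isFiniteMeasure_of_univ hμ u
  simp only [hT _ u]
  exact tendsto_integral_of_bounded hm hC hf (μ u)

/-- Extension of a multiplicative calculus from a generating class `𝒟` of real functions to all
bounded Borel functions. -/
theorem exists_isOp_of_generating (hμ : ∀ u, μ u Set.univ = ENNReal.ofReal (‖u‖ ^ 2))
    (𝒟 : Set (ℝ → ℂ)) (h𝒟b : ∀ f ∈ 𝒟, BoundedBorel f) (h𝒟s : ∀ f ∈ 𝒟, star f = f)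
    (h𝒟 : ∀ 𝒞, IsMonotoneClass 𝒞 → (∀ f ∈ 𝒟, 𝒞 f) → ∀ f, BoundedBorel f → 𝒞 f)
    (hT : ∀ f ∈ 𝒟, ∃ T, IsOp μ f T)
    (hmul : ∀ f ∈ 𝒟, ∀ g ∈ 𝒟, ∀ S T, IsOp μ f S → IsOp μ g T → IsOp μ (f * g) (S * T)) :
    (∀ f, BoundedBorel f → ∃ T, IsOp μ f T) ∧
      ∀ f g, BoundedBorel f → BoundedBorel g → ∀ S T, IsOp μ f S → IsOp μ g T →
        IsOp μ (f * g) (S * T) := by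
  have step : ∀ 𝒢 : Set (ℝ → ℂ), (∀ f ∈ 𝒢, BoundedBorel f) →
      (∀ f ∈ 𝒢, ∀ g ∈ 𝒟, ∀ S T, IsOp μ f S → IsOp μ g T → IsOp μ (f * g) (S * T)) →
      ∀ g, BoundedBorel g → ∃ T, IsOp μ g T ∧ ∀ f ∈ 𝒢, ∀ S, IsOp μ f S →
        IsOp μ (f * g) (S * T) := by
    intro 𝒢 h𝒢b h𝒢
    refine h𝒟 _ ⟨?_, ?_, ?_⟩ ?_
    · rintro f g hf hg ⟨S, hS, hS'⟩ ⟨T, hT, hT'⟩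
      refine ⟨S + T, hS.add hμ hf hg hT, fun k hk R hR => ?_⟩
      rw [mul_add, mul_add]
      exact (hS' k hk R hR).add hμ ((h𝒢b k hk).mul hf) ((h𝒢b k hk).mul hg) (hT' k hk R hR)
    · rintro c f hf ⟨S, hS, hS'⟩
      refine ⟨c • S, hS.smul c, fun k hk R hR => ?_⟩
      rw [mul_smul_comm, mul_smul_comm]
      exact (hS' k hk R hR).smul c
    · intro fn f C hm hC hf h
      choose Tn hTn hTn' using h
      obtain ⟨T, hT1, hT2⟩ := IsOp.exists_limit hμ hm hC hf hTn
      refine ⟨T, hT1, fun k hk R hR u => ?_⟩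
      have := isFiniteMeasure_of_univ hμ u
      obtain ⟨hkm, D, hD⟩ := h𝒢b k hk
      have h1 : Tendsto (fun n => ∫ x, (k * fn n) x ∂μ u) atTop (𝓝 (∫ x, (k * f) x ∂μ u)) :=
        tendsto_integral_of_bounded (C := D * C) (fun n => hkm.mul (hm n))
          (fun n x => by
            rw [Pi.mul_apply, norm_mul]
            exact mul_le_mul (hD x) (hC n x) (norm_nonneg _) ((norm_nonneg _).trans (hD x)))
          (fun x => (hf x).const_mul (k x)) _
      have h2 := hT2 (ContinuousLinearMap.adjoint R u) u
      simp only [ContinuousLinearMap.adjoint_inner_left] at h2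
      refine tendsto_nhds_unique h2 (h1.congr fun n => ?_)
      exact (hTn' n k hk R hR u).symm
    · intro f hf
      obtain ⟨T, hT⟩ := hT f hf
      exact ⟨T, hT, fun k hk R hR => h𝒢 k hk f hf R T hR hT⟩
  have step1 := step 𝒟 h𝒟b hmul
  have step2 := step {f | BoundedBorel f} (fun f hf => hf) fun f hf g hg S T hS hT => by
    obtain ⟨S', hS', h⟩ := step1 _ (BoundedBorel.star hf)
    have hSS : S' = ContinuousLinearMap.adjoint S := hS'.unique hS.adjoint
    have h1 := (h g hg T hT).adjoint
    have h2 : star (g * star f) = f * g := by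
      rw [star_mul, star_star, h𝒟s g hg]
    have h3 : T = ContinuousLinearMap.adjoint T := hT.unique (by
      simpa only [h𝒟s g hg] using hT.adjoint)
    have h4 : ContinuousLinearMap.adjoint (T * S') = S * T := by
      rw [← ContinuousLinearMap.star_eq_adjoint, star_mul, hSS,
        ← ContinuousLinearMap.star_eq_adjoint, star_star, ContinuousLinearMap.star_eq_adjoint, ← h3]
    rwa [h2, h4] at h1
  refine ⟨fun f hf => (step2 f hf).imp fun T hT => hT.1, fun f g hf hg S T hS hT => ?_⟩
  obtain ⟨T', hT', h⟩ := step2 g hg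
  rw [hT.unique hT']
  exact h f hf S hS

end IsOp

section BoundedOperator

variable {H : Type*} [NormedAddCommGroup H] [InnerProductSpace ℂ H] [CompleteSpace H]
  {B : H →L[ℂ] H}

theorem inner_apply_eq_ofReal {T : H →L[ℂ] H} (hT : IsSelfAdjoint T) (u : H) :
    ⟪u, T u⟫_ℂ = ((⟪u, T u⟫_ℂ).re : ℂ) := by
  have h : ContinuousLinearMap.adjoint T = T := hT
  refine (Complex.conj_eq_iff_re.mp ?_).symm
  rw [inner_conj_symm, ← ContinuousLinearMap.adjoint_inner_right, h]

/-- The positive functional `f ↦ (u | f(B)u)` on the continuous functions on the spectrum. -/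
def spectralFunctional (hB : IsSelfAdjoint B) (u : H) :
    CompactlySupportedContinuousMap (spectrum ℝ B) ℝ →ₚ[ℝ] ℝ :=
  PositiveLinearMap.mk₀
    { toFun := fun f => (⟪u, cfcHom hB (f : C(spectrum ℝ B, ℝ)) u⟫_ℂ).re
      map_add' := fun f g => by
        have : ((f + g : CompactlySupportedContinuousMap (spectrum ℝ B) ℝ) : C(spectrum ℝ B, ℝ))
          = (f : C(spectrum ℝ B, ℝ)) + (g : C(spectrum ℝ B, ℝ)) := rfl
        rw [this, map_add, add_apply, inner_add_right, Complex.add_re]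
      map_smul' := fun c f => by
        have : ((c • f : CompactlySupportedContinuousMap (spectrum ℝ B) ℝ) : C(spectrum ℝ B, ℝ))
          = c • (f : C(spectrum ℝ B, ℝ)) := rfl
        rw [this, map_smul, smul_apply, inner_smul_right_eq_smul, Complex.smul_re,
          RingHom.id_apply] }
    (fun f hf => by
      have hpos : 0 ≤ cfcHom hB (f : C(spectrum ℝ B, ℝ)) := by
        let g : C(spectrum ℝ B, ℝ) := ⟨fun x => √(f x), by fun_prop⟩
        have : (f : C(spectrum ℝ B, ℝ)) = star g * g := by
          ext x
          exact (Real.mul_self_sqrt (hf x)).symm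
        rw [this, map_mul, map_star]
        exact star_mul_self_nonneg _
      rw [ContinuousLinearMap.nonneg_iff_isPositive] at hpos
      exact hpos.re_inner_nonneg_right u)

theorem exists_measure_cfc (hB : IsSelfAdjoint B) (u : H) :
    ∃ ν : Measure ℝ, IsFiniteMeasure ν ∧ ν (spectrum ℝ B)ᶜ = 0 ∧
      ∀ g : ℝ → ℝ, Continuous g → ⟪u, cfc g B u⟫_ℂ = ∫ x, (g x : ℂ) ∂ν := by
  have : CompactSpace (spectrum ℝ B) := ContinuousFunctionalCalculus.compactSpace_spectrum B
  have hcl : MeasurableSet (spectrum ℝ B) := (spectrum.isClosed B).measurableSet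
  let ρ := RealRMK.rieszMeasure (spectralFunctional hB u)
  have hρ : IsFiniteMeasure ρ := ⟨isCompact_univ.measure_lt_top⟩
  refine ⟨ρ.map Subtype.val, inferInstance, ?_, fun g hg => ?_⟩
  · rw [Measure.map_apply measurable_subtype_coe hcl.compl]
    simp
  · have hsa : IsSelfAdjoint (cfc g B) := cfc_predicate g B
    rw [inner_apply_eq_ofReal hsa, integral_complex_ofReal, integral_map
      measurable_subtype_coe.aemeasurable hg.aestronglyMeasurable]
    congr 1
    let f : CompactlySupportedContinuousMap (spectrum ℝ B) ℝ :=
      CompactlySupportedContinuousMap.continuousMapEquiv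
        ⟨(spectrum ℝ B).domRestrict g, hg.comp continuous_subtype_val⟩
    have h := RealRMK.integral_rieszMeasure (spectralFunctional hB u) f
    rw [cfc_apply g B hB hg.continuousOn]
    exact h.symm

/-- The spectral measure of the vector `u` with respect to the bounded selfadjoint operator `B`. -/
def scalarMeasure (hB : IsSelfAdjoint B) (u : H) : Measure ℝ := (exists_measure_cfc hB u).choose

section

variable (hB : IsSelfAdjoint B)

theorem scalarMeasure_compl_spectrum (u : H) : scalarMeasure hB u (spectrum ℝ B)ᶜ = 0 :=
  (exists_measure_cfc hB u).choose_spec.2.1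

theorem inner_cfc (u : H) {g : ℝ → ℝ} (hg : Continuous g) :
    ⟪u, cfc g B u⟫_ℂ = ∫ x, (g x : ℂ) ∂scalarMeasure hB u :=
  (exists_measure_cfc hB u).choose_spec.2.2 g hg

theorem scalarMeasure_univ (u : H) :
    scalarMeasure hB u Set.univ = ENNReal.ofReal (‖u‖ ^ 2) := by
  have : IsFiniteMeasure (scalarMeasure hB u) := (exists_measure_cfc hB u).choose_spec.1
  have h := inner_cfc hB u (g := fun _ => 1) continuous_const
  have h1 : (1 : H →L[ℂ] H) u = u := rfl
  rw [cfc_const_one ℝ B, h1, inner_self_eq_norm_sq_to_K] at h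
  simp only [Complex.ofReal_one, integral_const, Complex.real_smul, mul_one] at h
  rw [← ENNReal.ofReal_toReal (measure_ne_top (scalarMeasure hB u) Set.univ)]
  congr 1
  apply Complex.ofReal_injective
  rw [Complex.ofReal_pow]
  exact h.symm

theorem scalarMeasure_calculus :
    (∀ f, BoundedBorel f → ∃ T, IsOp (scalarMeasure hB) f T) ∧
      ∀ f g, BoundedBorel f → BoundedBorel g → ∀ S T, IsOp (scalarMeasure hB) f S →
        IsOp (scalarMeasure hB) g T → IsOp (scalarMeasure hB) (f * g) (S * T) := by
  have hop : ∀ g : ℝ → ℝ, Continuous g →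
      IsOp (scalarMeasure hB) (fun x => (g x : ℂ)) (cfc g B) :=
    fun g hg u => inner_cfc hB u hg
  refine exists_isOp_of_generating (scalarMeasure_univ hB)
    {f | ∃ g : ℝ → ℝ, Continuous g ∧ (∃ C, ∀ x, |g x| ≤ C) ∧ f = fun x => (g x : ℂ)}
    ?_ ?_ ?_ ?_ ?_
  · rintro f ⟨g, hg, ⟨C, hC⟩, rfl⟩
    exact ⟨(Complex.continuous_ofReal.comp hg).measurable, C, fun x => by simpa using hC x⟩
  · rintro f ⟨g, hg, -, rfl⟩
    ext x
    simp
  · intro 𝒞 h𝒞 h f hf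
    exact h𝒞.of_continuous (fun g hg hC => h _ ⟨g, hg, hC, rfl⟩) hf
  · rintro f ⟨g, hg, -, rfl⟩
    exact ⟨_, hop g hg⟩
  · rintro f ⟨g, hg, -, rfl⟩ f' ⟨g', hg', -, rfl⟩ S T hS hT
    rw [hS.unique (hop g hg), hT.unique (hop g' hg'),
      ← cfc_mul g g' B hg.continuousOn hg'.continuousOn]
    convert hop (fun x => g x * g' x) (hg.mul hg') using 1
    ext x
    simp

theorem isOp_of_continuous {g : ℝ → ℝ} (hg : Continuous g) :
    IsOp (scalarMeasure hB) (fun x => (g x : ℂ)) (cfc g B) := fun u => inner_cfc hB u hg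

end

end BoundedOperator

section Calculus

variable {H : Type*} [NormedAddCommGroup H] [InnerProductSpace ℂ H] [CompleteSpace H]

/-- A family of measures with a multiplicative calculus for bounded Borel functions. -/
structure IsCalculus (μ : H → Measure ℝ) : Prop where
  univ : ∀ u, μ u Set.univ = ENNReal.ofReal (‖u‖ ^ 2)
  exists_isOp : ∀ f, BoundedBorel f → ∃ T, IsOp μ f T
  isOp_mul : ∀ f g, BoundedBorel f → BoundedBorel g → ∀ S T, IsOp μ f S → IsOp μ g T →
        IsOp μ (f * g) (S * T)

open Classical in
/-- The operator `∫ f dE` in terms of the measures `μ_u = (u | E u)`. -/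
def opFun (μ : H → Measure ℝ) (f : ℝ → ℂ) : H →L[ℂ] H :=
  if h : ∃ T : H →L[ℂ] H, IsOp μ f T then h.choose else 0

namespace IsCalculus

variable {μ : H → Measure ℝ} (hμ : IsCalculus μ) {f g : ℝ → ℂ}
include hμ

theorem isFiniteMeasure (u : H) : IsFiniteMeasure (μ u) := isFiniteMeasure_of_univ hμ.univ u

theorem isOp (hf : BoundedBorel f) : IsOp μ f (opFun μ f) := by
  have h := hμ.exists_isOp f hf
  rw [opFun, dif_pos h]
  exact h.choose_spec

theorem add (hf : BoundedBorel f) (hg : BoundedBorel g) :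
    opFun μ (f + g) = opFun μ f + opFun μ g :=
  (hμ.isOp (hf.add hg)).unique ((hμ.isOp hf).add hμ.univ hf hg (hμ.isOp hg))

theorem smul (c : ℂ) (hf : BoundedBorel f) : opFun μ (c • f) = c • opFun μ f :=
  (hμ.isOp (hf.smul c)).unique ((hμ.isOp hf).smul c)

theorem mul (hf : BoundedBorel f) (hg : BoundedBorel g) :
    opFun μ (f * g) = opFun μ f * opFun μ g :=
  (hμ.isOp (hf.mul hg)).unique (hμ.isOp_mul _ _ hf hg _ _ (hμ.isOp hf) (hμ.isOp hg))

theorem zero : opFun μ 0 = 0 := by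
  simpa using hμ.smul 0 BoundedBorel.one

theorem sum {ι : Type*} (s : Finset ι) {f : ι → ℝ → ℂ} (hf : ∀ i, BoundedBorel (f i)) :
    BoundedBorel (∑ i ∈ s, f i) ∧ opFun μ (∑ i ∈ s, f i) = ∑ i ∈ s, opFun μ (f i) := by
  classical
  induction s using Finset.induction_on with
  | empty => exact ⟨by simpa using BoundedBorel.one.smul 0, by simpa using hμ.zero⟩
  | insert i s hi ih =>
    rw [Finset.sum_insert hi, Finset.sum_insert hi, hμ.add (hf i) ih.1, ih.2]
    exact ⟨(hf i).add ih.1, rfl⟩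

theorem mul_apply (hf : BoundedBorel f) (hg : BoundedBorel g) (u : H) :
    opFun μ f (opFun μ g u) = opFun μ (f * g) u := by
  rw [hμ.mul hf hg]; rfl

theorem adjoint (hf : BoundedBorel f) :
    opFun μ (star f) = ContinuousLinearMap.adjoint (opFun μ f) :=
  (hμ.isOp hf.star).unique (hμ.isOp hf).adjoint

theorem one : opFun μ 1 = 1 := (hμ.isOp BoundedBorel.one).unique fun u => by
  simp [inner_self_eq_norm_sq_to_K, Measure.real, hμ.univ]

theorem congr (hf : BoundedBorel f) (hg : BoundedBorel g) (h : ∀ u, f =ᵐ[μ u] g) :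
    opFun μ f = opFun μ g :=
  (hμ.isOp hf).unique fun u => by rw [hμ.isOp hg, integral_congr_ae (h u)]

theorem inner_apply (hf : BoundedBorel f) (u v : H) :
    ⟪opFun μ f u, v⟫_ℂ = ⟪u, opFun μ (star f) v⟫_ℂ := by
  rw [hμ.adjoint hf, ContinuousLinearMap.adjoint_inner_right]

theorem norm_sq (hf : BoundedBorel f) (u : H) :
    ‖opFun μ f u‖ ^ 2 = ∫ x, ‖f x‖ ^ 2 ∂μ u := by
  have h : ⟪opFun μ f u, opFun μ f u⟫_ℂ = ∫ x, ((‖f x‖ ^ 2 : ℝ) : ℂ) ∂μ u := by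
    rw [hμ.inner_apply hf, hμ.mul_apply hf.star hf, hμ.isOp (hf.star.mul hf)]
    refine integral_congr_ae (Eventually.of_forall fun x => ?_)
    simp [Complex.conj_mul']
  rw [inner_self_eq_norm_sq_to_K, integral_complex_ofReal] at h
  apply Complex.ofReal_injective
  rw [Complex.ofReal_pow]
  exact h

theorem integrable_norm_sq (hf : BoundedBorel f) (u : H) :
    Integrable (fun x => ‖f x‖ ^ 2) (μ u) := by
  have := hμ.isFiniteMeasure u
  have h := ((hf.star.mul hf).integrable (μ u)).norm
  refine h.congr (Eventually.of_forall fun x => ?_)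
  simp [pow_two]

theorem norm_sq_eq_lintegral (hf : BoundedBorel f) (u : H) :
    ENNReal.ofReal (‖opFun μ f u‖ ^ 2) = ∫⁻ x, ENNReal.ofReal (‖f x‖ ^ 2) ∂μ u := by
  rw [hμ.norm_sq hf, ofReal_integral_eq_lintegral_ofReal (hμ.integrable_norm_sq hf u)
    (Eventually.of_forall fun x => by positivity)]

theorem norm_le {C : ℝ} (hf : BoundedBorel f) (hC0 : 0 ≤ C) (u : H)
    (hC : ∀ᵐ x ∂μ u, ‖f x‖ ≤ C) : ‖opFun μ f u‖ ≤ C * ‖u‖ := by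
  have := hμ.isFiniteMeasure u
  refine le_of_sq_le_sq ?_ (by positivity)
  rw [hμ.norm_sq hf]
  refine (integral_mono_ae (hμ.integrable_norm_sq hf u) (integrable_const (C ^ 2)) ?_).trans_eq ?_
  · filter_upwards [hC] with x hx
    exact pow_le_pow_left₀ (norm_nonneg _) hx 2
  · rw [integral_const, Measure.real, hμ.univ, ENNReal.toReal_ofReal (by positivity), smul_eq_mul]
    ring

theorem opNorm_le {C : ℝ} (hf : BoundedBorel f) (hC : ∀ x, ‖f x‖ ≤ C) : ‖opFun μ f‖ ≤ C :=
  have hC0 := (norm_nonneg _).trans (hC 0)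
  ContinuousLinearMap.opNorm_le_bound _ hC0 fun u =>
    hμ.norm_le hf hC0 u (Eventually.of_forall hC)

theorem tendsto {ι : Type*} {l : Filter ι} [l.IsCountablyGenerated] {fn : ι → ℝ → ℂ} {C : ℝ}
    (hm : ∀ n, Measurable (fn n))
    (hC : ∀ n x, ‖fn n x‖ ≤ C) (hf : BoundedBorel f) (u : H)
    (h : ∀ᵐ x ∂μ u, Tendsto (fun n => fn n x) l (𝓝 (f x))) :
    Tendsto (fun n => opFun μ (fn n) u) l (𝓝 (opFun μ f u)) := by
  have := hμ.isFiniteMeasure u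
  have hfn : ∀ n, BoundedBorel (fn n) := fun n => ⟨hm n, C, hC n⟩
  obtain ⟨hfm, D, hD⟩ := hf
  have hf : BoundedBorel f := ⟨hfm, D, hD⟩
  rw [tendsto_iff_norm_sub_tendsto_zero]
  have h1 : ∀ n, opFun μ (fn n) u - opFun μ f u = opFun μ (fn n + (-1 : ℂ) • f) u := fun n => by
    rw [hμ.add (hfn n) (hf.smul _), hμ.smul _ hf]
    simp [sub_eq_add_neg]
  have h2 : Tendsto (fun n => ‖opFun μ (fn n) u - opFun μ f u‖ ^ 2) l (𝓝 0) := by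
    simp only [h1, hμ.norm_sq ((hfn _).add (hf.smul _))]
    have h3 : Tendsto (fun n => ∫ x, ‖(fn n + (-1 : ℂ) • f) x‖ ^ 2 ∂μ u) l
        (𝓝 (∫ _, (0 : ℝ) ∂μ u)) := by
      refine tendsto_integral_filter_of_dominated_convergence (fun _ => (C + D) ^ 2)
        (Eventually.of_forall fun n =>
          ((((hm n).add (hfm.const_smul _)).norm.pow_const 2)).aestronglyMeasurable)
        (Eventually.of_forall fun n => Eventually.of_forall fun x => ?_) (integrable_const _) ?_
      · rw [Real.norm_of_nonneg (by positivity)]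
        refine pow_le_pow_left₀ (norm_nonneg _) ((norm_add_le _ _).trans ?_) 2
        simpa using add_le_add (hC n x) (hD x)
      · filter_upwards [h] with x hx
        have := (tendsto_iff_norm_sub_tendsto_zero.mp hx).pow 2
        simpa [sub_eq_add_neg] using this
    simpa using h3
  have h4 := h2.sqrt
  simpa using h4

theorem measure_apply (hf : BoundedBorel f) (u : H) :
    μ (opFun μ f u) = (μ u).withDensity fun x => ENNReal.ofReal (‖f x‖ ^ 2) := by
  ext S hS
  have h1 : ∀ v, μ v S = ENNReal.ofReal (‖opFun μ (S.indicator 1) v‖ ^ 2) := fun v => by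
    rw [hμ.norm_sq_eq_lintegral (BoundedBorel.indicator_one hS), ← lintegral_indicator_one hS]
    refine lintegral_congr fun x => ?_
    by_cases hx : x ∈ S <;> simp [hx]
  rw [h1, hμ.mul_apply (BoundedBorel.indicator_one hS) hf,
    hμ.norm_sq_eq_lintegral ((BoundedBorel.indicator_one hS).mul hf), withDensity_apply _ hS,
    ← lintegral_indicator hS]
  refine lintegral_congr fun x => ?_
  by_cases hx : x ∈ S <;> simp [hx]

theorem norm_sq_indicator {S : Set ℝ} (hS : MeasurableSet S) (u : H) :
    ENNReal.ofReal (‖opFun μ (S.indicator 1) u‖ ^ 2) = μ u S := by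
  rw [hμ.norm_sq_eq_lintegral (BoundedBorel.indicator_one hS), ← lintegral_indicator_one hS]
  refine lintegral_congr fun x => ?_
  by_cases hx : x ∈ S <;> simp [hx]

end IsCalculus

theorem isCalculus_scalarMeasure {B : H →L[ℂ] H} (hB : IsSelfAdjoint B) :
    IsCalculus (scalarMeasure hB) :=
  ⟨scalarMeasure_univ hB, (scalarMeasure_calculus hB).1, (scalarMeasure_calculus hB).2⟩

end Calculus

section SpectralTheorem

variable {H : Type*} [NormedAddCommGroup H] [InnerProductSpace ℂ H] [CompleteSpace H]

theorem IsCalculus.hasSum_indicator {μ : H → Measure ℝ} (hμ : IsCalculus μ) {S : ℕ → Set ℝ}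
    (hS : ∀ n, MeasurableSet (S n)) (hd : Pairwise (Function.onFun Disjoint S)) (u : H) :
    HasSum (fun n => opFun μ ((S n).indicator 1) u) (opFun μ ((⋃ n, S n).indicator 1) u) := by
  have hs : ∀ s : Finset ℕ, ∑ n ∈ s, (S n).indicator (1 : ℝ → ℂ) =
      (⋃ n ∈ s, S n).indicator 1 := fun s => by
    rw [Finset.indicator_biUnion s S fun i _ j _ hij => hd hij]
    ext x
    simp
  have hm : ∀ s : Finset ℕ, MeasurableSet (⋃ n ∈ s, S n) := fun s =>
    Finset.measurableSet_biUnion _ fun i _ => hS i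
  have h := hμ.tendsto (l := (atTop : Filter (Finset ℕ)))
    (fn := fun s => (⋃ n ∈ s, S n).indicator 1) (C := 1)
    (fun s => measurable_one.indicator (hm s))
    (fun s x => (norm_indicator_le_norm_self _ _).trans (by simp))
    (BoundedBorel.indicator_one (MeasurableSet.iUnion hS)) u
    (Eventually.of_forall fun x => by
      by_cases hx : x ∈ ⋃ i, S i
      · rw [Set.indicator_of_mem hx]
        obtain ⟨k, hk⟩ := Set.mem_iUnion.mp hx
        refine tendsto_const_nhds.congr' ?_
        filter_upwards [eventually_ge_atTop {k}] with s hs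
        rw [Set.indicator_of_mem]
        exact Set.mem_biUnion (hs (Finset.mem_singleton_self k)) hk
      · rw [Set.indicator_of_notMem hx]
        refine tendsto_const_nhds.congr' (Eventually.of_forall fun n => ?_)
        exact (Set.indicator_of_notMem (fun h => hx (Set.iUnion₂_subset_iUnion _ _ h)) _).symm)
  refine h.congr fun s => ?_
  rw [← hs, (hμ.sum s fun n => BoundedBorel.indicator_one (hS n)).2, sum_apply]

/-- The image under `κ` of the spectral measure with the calculus `μ`. -/
def IsCalculus.spectralMeasureMap {μ : H → Measure ℝ} (hμ : IsCalculus μ) {κ : ℝ → ℝ}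
    (hκ : Measurable κ) : SpectralMeasure H where
  proj S := opFun μ ((κ ⁻¹' S).indicator 1)
  isStarProjection S hS := by
    have h := BoundedBorel.indicator_one (hκ hS)
    constructor
    · rw [IsIdempotentElem, ← hμ.mul h h]
      congr 1
      ext x
      by_cases hx : x ∈ κ ⁻¹' S <;> simp [hx]
    · rw [IsSelfAdjoint, ContinuousLinearMap.star_eq_adjoint, ← hμ.adjoint h]
      congr 1
      ext x
      by_cases hx : x ∈ κ ⁻¹' S <;> simp [hx]
  univ := by simp [hμ.one]
  hasSum_iUnion S hS hd u := by
    rw [Set.preimage_iUnion]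
    exact hμ.hasSum_indicator (fun n => hκ (hS n)) (fun i j hij => (hd hij).preimage κ) u

theorem IsCalculus.spectralMeasureMap_measure {μ : H → Measure ℝ} (hμ : IsCalculus μ)
    {κ : ℝ → ℝ} (hκ : Measurable κ) (u : H) :
    (hμ.spectralMeasureMap hκ).measure u = (μ u).map κ := by
  ext S hS
  rw [SpectralMeasure.measure_apply _ _ hS, Measure.map_apply hκ hS,
    ← hμ.norm_sq_indicator (hκ hS)]
  rfl

variable {ε : H →ₗ.[ℂ] H}

theorem inner_map_comm (hε : IsSelfAdjoint ε) (u v : ε.domain) :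
    ⟪ε u, (v : H)⟫_ℂ = ⟪(u : H), ε v⟫_ℂ := by
  have h := LinearPMap.adjoint_isFormalAdjoint (T := ε) hε.dense_domain
  have h2 : ε† = ε := hε
  rw [h2] at h
  exact h u v

theorem mem_domain_of_forall (hε : IsSelfAdjoint ε) {v w : H}
    (h : ∀ u : ε.domain, ⟪w, (u : H)⟫_ℂ = ⟪v, ε u⟫_ℂ) : ∃ hv : v ∈ ε.domain, ε ⟨v, hv⟩ = w := by
  have hmem := LinearPMap.mem_adjoint_domain_of_exists (T := ε) v ⟨w, h⟩
  have h1 := LinearPMap.adjoint_apply_eq hε.dense_domain ⟨v, hmem⟩ h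
  have h2 : ε† = ε := hε
  have key : ∀ T : H →ₗ.[ℂ] H, T = ε → ∀ hm : v ∈ T.domain, T ⟨v, hm⟩ = w →
      ∃ hv : v ∈ ε.domain, ε ⟨v, hv⟩ = w := by
    rintro T rfl hm h
    exact ⟨hm, h⟩
  exact key _ h2 hmem h1

theorem norm_le_norm_add_map (hpos : ∀ u : ε.domain, 0 ≤ (⟪(u : H), ε u⟫_ℂ).re) (u : ε.domain) :
    ‖(u : H)‖ ≤ ‖(u : H) + ε u‖ := by
  have h1 : ‖(u : H)‖ ^ 2 ≤ (⟪(u : H), (u : H) + ε u⟫_ℂ).re := by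
    rw [inner_add_right, Complex.add_re, inner_self_eq_norm_sq_to_K]
    have : (((‖(u : H)‖ : ℂ)) ^ 2).re = ‖(u : H)‖ ^ 2 := by
      rw [← Complex.ofReal_pow, Complex.ofReal_re]
    have h2 := hpos u
    simp only [Complex.coe_algebraMap] at *
    linarith
  have h2 := (Complex.re_le_norm _).trans (norm_inner_le_norm (𝕜 := ℂ) (u : H) ((u : H) + ε u))
  rcases (norm_nonneg (u : H)).eq_or_lt with h | h
  · rw [← h]; positivity
  · nlinarith

theorem exists_add_map_eq (hε : IsSelfAdjoint ε)
    (hpos : ∀ u : ε.domain, 0 ≤ (⟪(u : H), ε u⟫_ℂ).re) (v : H) :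
    ∃ u : ε.domain, (u : H) + ε u = v := by
  let R : Submodule ℂ H := LinearMap.range (ε.domain.subtype + ε.toFun)
  have hcl : IsClosed (R : Set H) := by
    refine IsSeqClosed.isClosed fun x y hx hy => ?_
    choose w hw using hx
    have hw' : ∀ n, (w n : H) + ε (w n) = x n := hw
    have hC : CauchySeq fun n => (w n : H) := by
      refine Metric.cauchySeq_iff.mpr fun δ hδ => ?_
      obtain ⟨N, hN⟩ := Metric.cauchySeq_iff.mp hy.cauchySeq δ hδ
      refine ⟨N, fun m hm n hn => lt_of_le_of_lt ?_ (hN m hm n hn)⟩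
      rw [dist_eq_norm, dist_eq_norm, ← hw', ← hw']
      have := norm_le_norm_add_map hpos (w m - w n)
      rw [LinearPMap.map_sub] at this
      refine this.trans_eq ?_
      congr 1
      simp only [Submodule.coe_sub]
      abel
    obtain ⟨u, hu⟩ := cauchySeq_tendsto_of_complete hC
    have hg : (u, y - u) ∈ ε.graph := by
      have hcl : IsClosed (ε.graph : Set (H × H)) := hε.isClosed
      refine hcl.mem_of_tendsto (b := atTop) (f := fun n => ((w n : H), ε (w n)))
        (hu.prodMk_nhds ?_) (Eventually.of_forall fun n => LinearPMap.mem_graph ε (w n))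
      refine (hy.sub hu).congr fun n => ?_
      rw [← hw' n]
      abel
    obtain ⟨z, hz1, hz2⟩ := (LinearPMap.mem_graph_iff ε).mp hg
    refine ⟨z, ?_⟩
    change (z : H) + ε z = y
    rw [hz2]
    change (z : H) = u at hz1
    rw [hz1]
    exact add_sub_cancel u y
  have hRc : CompleteSpace R := hcl.completeSpace_coe
  have hbot : Rᗮ = ⊥ := by
    rw [Submodule.eq_bot_iff]
    intro v hv
    have h1 : ∀ u : ε.domain, ⟪-v, (u : H)⟫_ℂ = ⟪v, ε u⟫_ℂ := fun u => by
      have h2 : ⟪v, (u : H) + ε u⟫_ℂ = 0 :=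
        Submodule.inner_left_of_mem_orthogonal (K := R) ⟨u, rfl⟩ hv
      rw [inner_add_right] at h2
      rw [inner_neg_left]
      linear_combination -h2
    obtain ⟨hd, h3⟩ := mem_domain_of_forall hε h1
    have h4 := norm_le_norm_add_map hpos ⟨v, hd⟩
    rw [h3] at h4
    simpa using h4
  have htop : R = ⊤ := (Submodule.orthogonal_eq_bot_iff).mp hbot
  have hv : v ∈ R := htop ▸ Submodule.mem_top
  exact hv

theorem exists_resolvent (hε : IsSelfAdjoint ε)
    (hpos : ∀ u : ε.domain, 0 ≤ (⟪(u : H), ε u⟫_ℂ).re) :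
    ∃ B : H →L[ℂ] H, IsSelfAdjoint B ∧ (∀ v, ∃ h : B v ∈ ε.domain, B v + ε ⟨B v, h⟩ = v) ∧
      ∀ u : ε.domain, B (u + ε u) = u := by
  choose b hb using exists_add_map_eq hε hpos
  have huniq : ∀ u : ε.domain, b (u + ε u) = u := fun u => by
    have h1 := norm_le_norm_add_map hpos (b (u + ε u) - u)
    have h2 := hb (u + ε u)
    rw [LinearPMap.map_sub] at h1
    have h3 : ((b (u + ε u) - u : ε.domain) : H) + (ε (b (u + ε u)) - ε u) = 0 := by
      rw [Submodule.coe_sub]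
      rw [← sub_eq_zero] at h2
      rw [← h2]
      abel
    rw [h3, norm_zero, norm_le_zero_iff] at h1
    exact sub_eq_zero.mp (Subtype.ext h1)
  have hadd : ∀ v w, b (v + w) = b v + b w := fun v w => by
    rw [← huniq (b v + b w), LinearPMap.map_add]
    congr 1
    nth_rw 1 [← hb v, ← hb w]
    rw [Submodule.coe_add]
    abel
  have hsmul : ∀ (c : ℂ) v, b (c • v) = c • b v := fun c v => by
    rw [← huniq (c • b v), LinearPMap.map_smul]
    congr 1
    nth_rw 1 [← hb v]
    rw [Submodule.coe_smul, smul_add]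
  let B : H →L[ℂ] H := LinearMap.mkContinuous
    { toFun := fun v => (b v : H)
      map_add' := fun v w => by rw [hadd]; rfl
      map_smul' := fun c v => by rw [hsmul]; rfl } 1 fun v => by
        rw [one_mul]
        have := norm_le_norm_add_map hpos (b v)
        rwa [hb] at this
  have hB : ∀ v, B v = b v := fun v => rfl
  refine ⟨B, ?_, fun v => ⟨(b v).2, hb v⟩, fun u => by rw [hB, huniq]⟩
  rw [ContinuousLinearMap.isSelfAdjoint_iff_isSymmetric]
  intro v w
  change ⟪(b v : H), w⟫_ℂ = ⟪v, (b w : H)⟫_ℂ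
  conv_lhs => rw [← hb w]
  conv_rhs => rw [← hb v]
  rw [inner_add_left, inner_add_right, inner_map_comm hε]

end SpectralTheorem

section SpectralTheorem

variable {H : Type*} [NormedAddCommGroup H] [InnerProductSpace ℂ H] [CompleteSpace H]

/-- The function `x ↦ x`, cut off at the levels `± N`. -/
def clip (N x : ℝ) : ℝ := max (-N) (min N x)

theorem continuous_clip (N : ℝ) : Continuous (clip N) := by unfold clip; fun_prop

theorem clip_eq {N x : ℝ} (h : |x| ≤ N) : clip N x = x := by
  rw [abs_le] at h
  rw [clip, min_eq_right h.2, max_eq_right h.1]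

theorem abs_clip_le {N : ℝ} (hN : 0 ≤ N) (x : ℝ) : |clip N x| ≤ N := by
  rw [abs_le, clip]
  exact ⟨le_max_left _ _, max_le (by linarith) (min_le_left _ _)⟩

theorem boundedBorel_clip {N : ℝ} (hN : 0 ≤ N) : BoundedBorel fun x => (clip N x : ℂ) :=
  ⟨(Complex.continuous_ofReal.comp (continuous_clip N)).measurable, N, fun x => by
    simpa using abs_clip_le hN x⟩

/-- For a bounded selfadjoint operator the calculus turns `x ↦ x` into the operator. -/
theorem exists_clip {B : H →L[ℂ] H} (hB : IsSelfAdjoint B) :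
    ∃ N : ℝ, 0 ≤ N ∧ opFun (scalarMeasure hB) (fun x => (clip N x : ℂ)) = B ∧
      ∀ u, ∀ᵐ x ∂scalarMeasure hB u, clip N x = x := by
  have hspec : ∀ x ∈ spectrum ℝ B, |x| ≤ ‖B‖ * ‖(1 : H →L[ℂ] H)‖ := fun x hx =>
    spectrum.norm_le_norm_mul_of_mem hx
  refine ⟨‖B‖ * ‖(1 : H →L[ℂ] H)‖, by positivity, ?_, fun u => ?_⟩
  · refine ((isCalculus_scalarMeasure hB).isOp (boundedBorel_clip (by positivity))).unique ?_
    have h := isOp_of_continuous hB (continuous_clip (‖B‖ * ‖(1 : H →L[ℂ] H)‖))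
    have h2 : cfc (clip (‖B‖ * ‖(1 : H →L[ℂ] H)‖)) B = B := by
      rw [cfc_congr (f := clip _) (g := id) fun x hx => clip_eq (hspec x hx), cfc_id ℝ B]
    rwa [h2] at h
  · have h := scalarMeasure_compl_spectrum hB u
    rw [← mem_ae_iff] at h
    filter_upwards [h] with x hx using clip_eq (hspec x hx)

variable {ε : H →ₗ.[ℂ] H}

theorem exists_isSpectralMeasureOf (hε : IsSelfAdjoint ε)
    (hpos : ∀ u : ε.domain, 0 ≤ (⟪(u : H), ε u⟫_ℂ).re) :
    ∃ E : SpectralMeasure H, E.IsSpectralMeasureOf ε := by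
  obtain ⟨B, hB, hB1, hB2⟩ := exists_resolvent hε hpos
  obtain ⟨N, hN, hNB, hae⟩ := exists_clip hB
  set μ := scalarMeasure hB with hμdef
  have hμ : IsCalculus μ := isCalculus_scalarMeasure hB
  have hb := boundedBorel_clip hN
  set b : ℝ → ℂ := fun x => (clip N x : ℂ) with hbdef
  have hmeas : ∀ v, μ (B v) = (μ v).withDensity fun x => ENNReal.ofReal (‖b x‖ ^ 2) := fun v => by
    rw [← hμ.measure_apply hb, hNB]
  have hinj : ∀ v, B v = 0 → v = 0 := fun v hv => by
    obtain ⟨h1, h2⟩ := hB1 v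
    have : (⟨B v, h1⟩ : ε.domain) = 0 := Subtype.ext hv
    rw [this, LinearPMap.map_zero, hv, add_zero] at h2
    exact h2.symm
  have hzero : ∀ u, μ u {0} = 0 := fun u => by
    have h0 : BoundedBorel ((Set.indicator {0} 1 : ℝ → ℂ)) :=
      BoundedBorel.indicator_one (measurableSet_singleton 0)
    have h1 : B (opFun μ (Set.indicator {0} 1) u) = 0 := by
      have h2 : b * Set.indicator {0} 1 = 0 := by
        ext x
        by_cases hx : x = 0
        · simp [hbdef, hx, clip_eq (x := 0) (N := N) (by simpa using hN)]
        · simp [hx]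
      nth_rw 1 [← hNB]
      rw [hμ.mul_apply hb h0, h2, hμ.zero, zero_apply]
    rw [← hμ.norm_sq_indicator (measurableSet_singleton 0), hinj _ h1]
    simp
  have hκ : Measurable fun x : ℝ => x⁻¹ - 1 := measurable_inv.sub_const 1
  refine ⟨hμ.spectralMeasureMap hκ, fun u => ?_, fun u => ?_⟩
  · rw [hμ.spectralMeasureMap_measure, lintegral_map (by fun_prop) hκ]
    constructor
    · intro hu
      have hfin := hμ.isFiniteMeasure ((u : H) + ε ⟨u, hu⟩)
      have h1 := hB2 ⟨u, hu⟩
      simp only at h1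
      nth_rw 1 [← h1]
      rw [hmeas, lintegral_withDensity_eq_lintegral_mul _
        (hb.measurable.norm.pow_const 2).ennreal_ofReal (by fun_prop)]
      refine (lintegral_mono_ae (g := fun _ => ENNReal.ofReal ((1 + N) ^ 2)) ?_).trans_lt ?_
      · filter_upwards [hae _] with x hx
        rw [Pi.mul_apply, ← ENNReal.ofReal_mul (by positivity)]
        refine ENNReal.ofReal_le_ofReal ?_
        have hxN := abs_clip_le hN x
        rw [hx] at hxN
        simp only [hbdef, hx, Complex.norm_real, Real.norm_eq_abs, sq_abs]
        rw [← mul_pow]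
        by_cases hx0 : x = 0
        · simp [hx0]; positivity
        · rw [mul_sub, mul_inv_cancel₀ hx0, ← sq_abs]
          refine pow_le_pow_left₀ (abs_nonneg _) ((abs_sub _ _).trans ?_) 2
          simpa using hxN
      · rw [lintegral_const]
        exact ENNReal.mul_lt_top ENNReal.ofReal_lt_top (measure_lt_top _ _)
    · intro hu
      have hfin := hμ.isFiniteMeasure u
      let S : ℕ → Set ℝ := fun n => {x | 1 ≤ (n : ℝ) * |x|}
      have hS : ∀ n, MeasurableSet (S n) := fun n => by
        exact measurableSet_le measurable_const (by fun_prop)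
      let g : ℕ → ℝ → ℂ := fun n => (S n).indicator fun x => ((x⁻¹ : ℝ) : ℂ)
      have hg : ∀ n, BoundedBorel (g n) := fun n => by
        refine ⟨Measurable.indicator (by fun_prop) (hS n), n, fun x => ?_⟩
        by_cases hx : x ∈ S n
        · have hx' : 1 ≤ (n : ℝ) * |x| := hx
          have h0 : 0 < |x| := by
            by_contra h
            have : |x| = 0 := le_antisymm (not_lt.mp h) (abs_nonneg x)
            rw [this] at hx'
            norm_num at hx'
          simp only [g, Set.indicator_of_mem hx, Complex.norm_real, norm_inv, Real.norm_eq_abs]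
          rw [inv_le_iff_one_le_mul₀ h0]
          exact hx'
        · simp [g, hx]
      obtain ⟨M, hM0, hM⟩ : ∃ M : ℝ, 0 ≤ M ∧ ∀ n, ‖opFun μ (g n) u‖ ≤ M := by
        let I : ℝ≥0∞ := ∫⁻ x : ℝ, (2 * ENNReal.ofReal ((x⁻¹ - 1) ^ 2) + 2) ∂μ u
        have hI : I < ⊤ := by
          simp only [I]
          rw [lintegral_add_right _ measurable_const, lintegral_const_mul _ (by fun_prop),
            lintegral_const]
          exact ENNReal.add_lt_top.mpr ⟨ENNReal.mul_lt_top (by simp) hu,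
            ENNReal.mul_lt_top (by simp) (measure_lt_top _ _)⟩
        refine ⟨√I.toReal, Real.sqrt_nonneg _, fun n => Real.le_sqrt_of_sq_le ?_⟩
        rw [← ENNReal.ofReal_le_iff_le_toReal hI.ne, hμ.norm_sq_eq_lintegral (hg n)]
        refine lintegral_mono fun x => ?_
        have h2 : (2 * ENNReal.ofReal ((x⁻¹ - 1) ^ 2) + 2) =
            ENNReal.ofReal (2 * (x⁻¹ - 1) ^ 2 + 2) := by
          rw [ENNReal.ofReal_add (by positivity) (by norm_num), ENNReal.ofReal_mul (by norm_num)]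
          simp
        rw [h2]
        refine ENNReal.ofReal_le_ofReal ?_
        have h3 : ‖g n x‖ ≤ |x⁻¹| := (norm_indicator_le_norm_self _ _).trans (by simp)
        have h4 := pow_le_pow_left₀ (norm_nonneg _) h3 2
        rw [sq_abs] at h4
        nlinarith [sq_nonneg (x⁻¹ - 2)]
      have hlim : Tendsto (fun n => B (opFun μ (g n) u)) atTop (𝓝 u) := by
        have h1 := hμ.tendsto (l := atTop) (fn := fun n : ℕ => (S n).indicator 1) (C := 1)
          (fun n => measurable_one.indicator (hS n))
          (fun n x => (norm_indicator_le_norm_self _ _).trans (by simp)) BoundedBorel.one u (by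
            have h0 : ∀ᵐ x ∂μ u, x ≠ 0 := by
              rw [ae_iff]; simpa using hzero u
            filter_upwards [h0] with x hx
            refine tendsto_const_nhds.congr' ?_
            have h2 : ∀ᶠ n : ℕ in atTop, 1 ≤ n * |x| :=
              (tendsto_natCast_atTop_atTop.atTop_mul_const
                (abs_pos.mpr hx)).eventually_ge_atTop 1
            filter_upwards [h2] with n hn
            exact (Set.indicator_of_mem (s := S n) hn _).symm)
        rw [hμ.one] at h1
        refine h1.congr fun n => ?_
        have hNB' : ∀ w, B w = opFun μ b w := fun w => by rw [hNB]
        rw [hNB', hμ.mul_apply hb (hg n)]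
        have : opFun μ ((S n).indicator 1) = opFun μ (b * g n) := by
          refine hμ.congr (BoundedBorel.indicator_one (hS n)) (hb.mul (hg n)) fun v => ?_
          filter_upwards [hae v] with x hx
          by_cases hxS : x ∈ S n
          · have hx0 : (x : ℂ) ≠ 0 := by
              rintro h0
              have h0' : x = 0 := by exact_mod_cast h0
              have hx' : 1 ≤ (n : ℝ) * |x| := hxS
              rw [h0'] at hx'
              norm_num at hx'
            simp [g, hxS, hbdef, hx, hx0]
          · simp [g, hxS]
        rw [this]
      have hbd : ∀ z : ε.domain, ‖⟪u, ε z⟫_ℂ‖ ≤ M * (1 + ‖B‖) * ‖(z : H)‖ := fun z => by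
        refine le_of_tendsto (x := atTop) (hlim.inner tendsto_const_nhds).norm
          (Eventually.of_forall fun n => ?_)
        have h1 : (B : H →ₗ[ℂ] H).IsSymmetric :=
          (ContinuousLinearMap.isSelfAdjoint_iff_isSymmetric).mp hB
        have h2 := hB2 z
        rw [map_add] at h2
        have h3 : ⟪B (opFun μ (g n) u), ε z⟫_ℂ = ⟪opFun μ (g n) u, B (ε z)⟫_ℂ := h1 _ _
        rw [h3, eq_sub_of_add_eq' h2]
        refine (norm_inner_le_norm _ _).trans ?_
        rw [mul_assoc]
        refine mul_le_mul (hM n) ((norm_sub_le _ _).trans ?_) (norm_nonneg _) hM0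
        have := B.le_opNorm (z : H)
        linarith
      have hmem : u ∈ ε†.domain := by
        rw [LinearPMap.mem_adjoint_domain_iff]
        exact (((innerₛₗ ℂ u).comp ε.toFun).mkContinuous _ hbd).continuous
      have h2 : ε† = ε := hε
      rwa [h2] at hmem
  · rw [hμ.spectralMeasureMap_measure, integral_map hκ.aemeasurable
      (Complex.measurable_ofReal.aestronglyMeasurable)]
    set v := (u : H) + ε u with hv
    have hu : (u : H) = B v := (hB2 u).symm
    have hεu : ε u = v - B v := by rw [hv, hB2 u]; abel
    rw [hεu, hu, hmeas, integral_withDensity_eq_integral_toReal_smul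
      (hb.measurable.norm.pow_const 2).ennreal_ofReal
      (Eventually.of_forall fun _ => ENNReal.ofReal_lt_top)]
    have h1 : ⟪B v, v - B v⟫_ℂ = ∫ x, (b * (1 + (-1 : ℂ) • b)) x ∂μ v := by
      have h2 := BoundedBorel.one.add (hb.smul (-1))
      have h3 : star b = b := by ext x; simp [hbdef]
      have h4 : v - B v = opFun μ (1 + (-1 : ℂ) • b) v := by
        rw [hμ.add BoundedBorel.one (hb.smul _), hμ.smul _ hb, hμ.one, hNB]
        simp [sub_eq_add_neg]
      rw [h4]
      nth_rw 1 [← hNB]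
      rw [hμ.inner_apply hb, h3, hμ.mul_apply hb h2, hμ.isOp (hb.mul h2)]
    rw [h1]
    refine integral_congr_ae ?_
    have h0 : ∀ᵐ x ∂μ v, x ≠ 0 := by
      rw [ae_iff]; simpa using hzero v
    filter_upwards [hae v, h0] with x hx hx0
    have hx0' : (x : ℂ) ≠ 0 := by exact_mod_cast hx0
    simp only [hbdef, hx, Pi.mul_apply, Pi.add_apply, Pi.one_apply, Pi.smul_apply, smul_eq_mul,
      Complex.norm_real, Real.norm_eq_abs, sq_abs, Complex.real_smul]
    rw [ENNReal.toReal_ofReal (by positivity)]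
    push_cast
    field_simp
    ring

end SpectralTheorem

section SpectralCalculus

variable {H : Type*} [NormedAddCommGroup H] [InnerProductSpace ℂ H] [CompleteSpace H]

namespace SpectralMeasure

variable (E : SpectralMeasure H)

theorem isOp_proj {S : Set ℝ} (hS : MeasurableSet S) :
    IsOp E.measure (S.indicator 1) (E.proj S) := fun u => by
  rw [inner_proj_self (E.isStarProjection S hS), integral_indicator hS]
  simp only [Pi.one_apply, integral_const, measureReal_restrict_apply_univ, Complex.real_smul,
    mul_one]
  rw [Measure.real, E.measure_apply u hS, ENNReal.toReal_ofReal (by positivity)]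

theorem proj_union {S T : Set ℝ} (hS : MeasurableSet S) (hT : MeasurableSet T)
    (h : Disjoint S T) : E.proj (S ∪ T) = E.proj S + E.proj T := by
  refine (E.isOp_proj (hS.union hT)).unique ?_
  have h1 : (S ∪ T).indicator (1 : ℝ → ℂ) = S.indicator 1 + T.indicator 1 :=
    Set.indicator_union_of_disjoint h _
  rw [h1]
  exact (E.isOp_proj hS).add E.measure_univ (BoundedBorel.indicator_one hS)
    (BoundedBorel.indicator_one hT) (E.isOp_proj hT)

theorem proj_mul_of_disjoint {S T : Set ℝ} (hS : MeasurableSet S) (hT : MeasurableSet T)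
    (h : Disjoint S T) : E.proj S * E.proj T = 0 := by
  have h1 := (E.isStarProjection _ (hS.union hT)).isIdempotentElem.eq
  have hP := (E.isStarProjection _ hS).isIdempotentElem.eq
  have hQ := (E.isStarProjection _ hT).isIdempotentElem.eq
  rw [E.proj_union hS hT h] at h1
  set P := E.proj S
  set Q := E.proj T
  have h2 : P * Q + Q * P = 0 := by
    have : (P + Q) * (P + Q) = P * P + Q * Q + (P * Q + Q * P) := by noncomm_ring
    rw [this, hP, hQ] at h1
    simpa using h1
  have h3 : P * Q + P * Q * P = 0 := by
    have : P * (P * Q + Q * P) = P * P * Q + P * Q * P := by noncomm_ring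
    rw [h2, hP, mul_zero] at this
    exact this.symm
  have h4 : P * Q * P + Q * P = 0 := by
    have : (P * Q + Q * P) * P = P * Q * P + Q * (P * P) := by noncomm_ring
    rw [h2, hP, zero_mul] at this
    exact this.symm
  have h5 : P * Q = Q * P := by
    have : P * Q = Q * P + ((P * Q + P * Q * P) - (P * Q * P + Q * P)) := by abel
    rw [h3, h4] at this
    simpa using this
  rw [← h5, ← two_smul ℂ, smul_eq_zero] at h2
  exact h2.resolve_left two_ne_zero

theorem proj_mul {S T : Set ℝ} (hS : MeasurableSet S) (hT : MeasurableSet T) :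
    E.proj S * E.proj T = E.proj (S ∩ T) := by
  have hST := hS.inter hT
  have h1 : E.proj S = E.proj (S ∩ T) + E.proj (S \ T) := by
    rw [← E.proj_union hST (hS.diff hT) Set.disjoint_sdiff_inter.symm, Set.inter_union_sdiff]
  have h2 : E.proj T = E.proj (S ∩ T) + E.proj (T \ S) := by
    rw [← E.proj_union hST (hT.diff hS), Set.inter_comm, Set.inter_union_sdiff]
    rw [Set.inter_comm]
    exact Set.disjoint_sdiff_inter.symm
  rw [h1, h2, add_mul, mul_add, mul_add, (E.isStarProjection _ hST).isIdempotentElem.eq,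
    E.proj_mul_of_disjoint hST (hT.diff hS), E.proj_mul_of_disjoint (hS.diff hT) hST,
    E.proj_mul_of_disjoint (hS.diff hT) (hT.diff hS), add_zero, add_zero, add_zero]
  · exact disjoint_sdiff_sdiff
  · exact Set.disjoint_sdiff_inter
  · exact Set.disjoint_left.mpr fun x hx hx' => hx'.2 hx.1

theorem isCalculus : IsCalculus E.measure := by
  have h := exists_isOp_of_generating (μ := E.measure) E.measure_univ
    {f | ∃ S, MeasurableSet S ∧ f = S.indicator 1}
    (by rintro f ⟨S, hS, rfl⟩; exact BoundedBorel.indicator_one hS)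
    (by
      rintro f ⟨S, hS, rfl⟩
      ext x
      by_cases hx : x ∈ S <;> simp [hx])
    (fun 𝒞 h𝒞 h f hf => h𝒞.of_indicator (fun S hS => h _ ⟨S, hS, rfl⟩) hf)
    (by rintro f ⟨S, hS, rfl⟩; exact ⟨_, E.isOp_proj hS⟩)
    (by
      rintro f ⟨S, hS, rfl⟩ g ⟨T, hT, rfl⟩ A B hA hB
      rw [hA.unique (E.isOp_proj hS), hB.unique (E.isOp_proj hT), E.proj_mul hS hT]
      have : S.indicator (1 : ℝ → ℂ) * T.indicator 1 = (S ∩ T).indicator 1 := by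
        ext x
        by_cases hx : x ∈ S <;> by_cases hx' : x ∈ T <;> simp [hx, hx']
      rw [this]
      exact E.isOp_proj (hS.inter hT))
  exact ⟨E.measure_univ, h.1, h.2⟩

end SpectralMeasure

theorem borelFun_eq_opFun (ε : H →ₗ.[ℂ] H) (f : ℝ → ℂ) :
    borelFun ε f = opFun (spectralMeasure ε).measure f := rfl

/-- The identity function of the real line, as a complex valued function. -/
def idFun : ℝ → ℂ := fun x => x

theorem continuous_idFun : Continuous idFun := Complex.continuous_ofReal

/-- The indicator function of the interval `[-n, n]`. -/
def cutoff (n : ℕ) : ℝ → ℂ := (Set.Icc (-n : ℝ) n).indicator 1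

theorem boundedBorel_cutoff (n : ℕ) : BoundedBorel (cutoff n) :=
  BoundedBorel.indicator_one measurableSet_Icc

theorem norm_cutoff_le (n : ℕ) (x : ℝ) : ‖cutoff n x‖ ≤ 1 :=
  (norm_indicator_le_norm_self _ _).trans (by simp)

theorem tendsto_cutoff (x : ℝ) : Tendsto (fun n => cutoff n x) atTop (𝓝 1) := by
  refine tendsto_const_nhds.congr' ?_
  filter_upwards [eventually_ge_atTop ⌈|x|⌉₊] with n hn
  have : |x| ≤ n := (Nat.le_ceil _).trans (by exact_mod_cast hn)
  rw [cutoff, Set.indicator_of_mem (Set.mem_Icc.mpr (abs_le.mp this))]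
  rfl

/-- A continuous function, cut off to `[-n, n]`, is bounded. -/
theorem boundedBorel_cutoff_mul {f : ℝ → ℂ} (hf : Continuous f) (n : ℕ) :
    BoundedBorel (cutoff n * f) := by
  obtain ⟨C, hC⟩ := (isCompact_Icc (a := (-n : ℝ)) (b := n)).exists_bound_of_continuousOn
    hf.continuousOn
  refine ⟨(boundedBorel_cutoff n).1.mul hf.measurable, max C 0, fun x => ?_⟩
  by_cases hx : x ∈ Set.Icc (-n : ℝ) n
  · simpa [cutoff, hx] using Or.inl (hC x hx)
  · simp [cutoff, hx]

theorem IsCalculus.tendsto_cutoff {μ : H → Measure ℝ} (hμ : IsCalculus μ) (u : H) :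
    Tendsto (fun n => opFun μ (cutoff n) u) atTop (𝓝 u) := by
  have h := hμ.tendsto (l := atTop) (fun n => (boundedBorel_cutoff n).1) norm_cutoff_le
    BoundedBorel.one u (Eventually.of_forall fun x => KleinGordon.tendsto_cutoff x)
  simpa [hμ.one] using h

theorem IsCalculus.eq_of_cutoff {μ : H → Measure ℝ} (hμ : IsCalculus μ) {u v : H}
    (h : ∀ n, opFun μ (cutoff n) u = opFun μ (cutoff n) v) : u = v :=
  tendsto_nhds_unique (hμ.tendsto_cutoff u) ((hμ.tendsto_cutoff v).congr fun n => (h n).symm)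

theorem inner_polarization {V : Type*} [AddCommGroup V] [Module ℂ V] (j T : V →ₗ[ℂ] H) (x y : V) :
    ⟪j x, T y⟫_ℂ = (⟪j (x + y), T (x + y)⟫_ℂ - ⟪j (x - y), T (x - y)⟫_ℂ
      - Complex.I * ⟪j (x + Complex.I • y), T (x + Complex.I • y)⟫_ℂ
      + Complex.I * ⟪j (x - Complex.I • y), T (x - Complex.I • y)⟫_ℂ) / 4 := by
  simp only [map_add, map_sub, inner_add_left, inner_add_right, map_smul, inner_smul_left,
    inner_smul_right, Complex.conj_I, inner_sub_left, inner_sub_right]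
  ring_nf
  simp only [Complex.I_sq]
  ring

namespace SpectralMeasure.IsSpectralMeasureOf

variable {E : SpectralMeasure H} {ε : H →ₗ.[ℂ] H} (hE : E.IsSpectralMeasureOf ε) {f : ℝ → ℂ}
include hE

theorem mem_domain (hf : BoundedBorel f) (hxf : BoundedBorel (idFun * f)) (u : H) :
    opFun E.measure f u ∈ ε.domain := by
  have := E.isCalculus.isFiniteMeasure u
  rw [hE.1, E.isCalculus.measure_apply hf, lintegral_withDensity_eq_lintegral_mul _
        (hf.measurable.norm.pow_const 2).ennreal_ofReal (by fun_prop)]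
  obtain ⟨-, C, hC⟩ := hxf
  refine (lintegral_mono (g := fun _ => ENNReal.ofReal (C ^ 2)) fun x => ?_).trans_lt ?_
  · simp only [Pi.mul_apply]
    rw [← ENNReal.ofReal_mul (by positivity)]
    refine ENNReal.ofReal_le_ofReal ?_
    have h := pow_le_pow_left₀ (norm_nonneg _) (hC x) 2
    simp only [Pi.mul_apply, idFun, norm_mul, Complex.norm_real, mul_pow, Real.norm_eq_abs,
      sq_abs] at h
    linarith
  · rw [lintegral_const]
    exact ENNReal.mul_lt_top ENNReal.ofReal_lt_top (measure_lt_top _ _)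

theorem tendsto_inner (u v : ε.domain) :
    Tendsto (fun n => ⟪(u : H), opFun E.measure (cutoff n * idFun) v⟫_ℂ) atTop
      (𝓝 ⟪(u : H), ε v⟫_ℂ) := by
  have hb := fun n => boundedBorel_cutoff_mul continuous_idFun n
  have hdiag : ∀ w : ε.domain, Tendsto (fun n => ⟪(w : H),
      opFun E.measure (cutoff n * idFun) w⟫_ℂ) atTop (𝓝 ⟪(w : H), ε w⟫_ℂ) := fun w => by
    have := E.isCalculus.isFiniteMeasure w
    rw [hE.2]
    have h2 : Integrable (fun x : ℝ => x ^ 2) (E.measure w) := by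
      refine ⟨by fun_prop, ?_⟩
      rw [hasFiniteIntegral_iff_ofReal (Eventually.of_forall fun x => sq_nonneg x)]
      exact (hE.1 w).mp w.2
    have h3 : Integrable (fun x : ℝ => 1 + x ^ 2) (E.measure w) := (integrable_const 1).add h2
    refine (tendsto_integral_of_dominated_convergence (F := fun n => cutoff n * idFun)
      (fun x => 1 + x ^ 2) (fun n => (hb n).1.aestronglyMeasurable) h3
      (fun n => Eventually.of_forall fun x => ?_) (Eventually.of_forall fun x => ?_)).congr
      fun n => (E.isCalculus.isOp (hb n) w).symm
    · rw [Pi.mul_apply, norm_mul]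
      refine (mul_le_of_le_one_left (norm_nonneg _) (norm_cutoff_le n x)).trans ?_
      rw [idFun, Complex.norm_real, Real.norm_eq_abs]
      nlinarith [sq_abs x, sq_nonneg (|x| - 1), abs_nonneg x]
    · simpa [idFun] using (KleinGordon.tendsto_cutoff x).mul_const (x : ℂ)
  have h1 := inner_polarization ε.domain.subtype ε.toFun u v
  have h2 := fun n => inner_polarization ε.domain.subtype
    ((opFun E.measure (cutoff n * idFun) : H →ₗ[ℂ] H) ∘ₗ ε.domain.subtype) u v
  simp only [Submodule.subtype_apply, LinearMap.comp_apply, ContinuousLinearMap.coe_coe] at h1 h2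
  simp only [h2]
  change Tendsto _ _ (𝓝 ⟪(u : H), ε.toFun v⟫_ℂ)
  rw [h1]
  exact ((((hdiag _).sub (hdiag _)).sub ((hdiag _).const_mul _)).add
    ((hdiag _).const_mul _)).div_const 4

theorem apply_map (hf : BoundedBorel f) (hxf : BoundedBorel (idFun * f)) (u : ε.domain) :
    opFun E.measure f (ε u) = opFun E.measure (idFun * f) u := by
  have hμ := E.isCalculus
  have hb := fun n => boundedBorel_cutoff_mul continuous_idFun n
  have hxf' : BoundedBorel (idFun * star f) := by
    have : idFun * star f = star (idFun * f) := by
      ext x; simp [idFun, mul_comm]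
    rw [this]
    exact hxf.star
  refine ext_inner_left ℂ fun w => ?_
  have h1 := hE.tendsto_inner ⟨_, hE.mem_domain hf.star hxf' w⟩ u
  simp only [hμ.inner_apply hf.star, star_star] at h1
  refine tendsto_nhds_unique h1 ?_
  have h2 : ∀ n, opFun E.measure f (opFun E.measure (cutoff n * idFun) u) =
      opFun E.measure (cutoff n) (opFun E.measure (idFun * f) u) := fun n => by
    rw [hμ.mul_apply hf (hb n), hμ.mul_apply (boundedBorel_cutoff n) hxf]
    congr 2
    ring
  simp only [h2]
  exact tendsto_const_nhds.inner (hμ.tendsto_cutoff _)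

theorem map_apply (hf : BoundedBorel f) (hxf : BoundedBorel (idFun * f)) (u : H) :
    ε ⟨opFun E.measure f u, hE.mem_domain hf hxf u⟩ = opFun E.measure (idFun * f) u := by
  have hμ := E.isCalculus
  have hb : ∀ n, BoundedBorel (idFun * cutoff n) := fun n => by
    rw [mul_comm]
    exact boundedBorel_cutoff_mul continuous_idFun n
  refine hμ.eq_of_cutoff fun n => ?_
  rw [hE.apply_map (boundedBorel_cutoff n) (hb n), hμ.mul_apply (hb n) hf,
    hμ.mul_apply (boundedBorel_cutoff n) hxf]
  congr 2
  ring

theorem measure_zero (hinj : ∀ u : ε.domain, ε u = 0 → (u : H) = 0) (u : H) :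
    E.measure u {0} = 0 := by
  have hμ := E.isCalculus
  have h0 := BoundedBorel.indicator_one (measurableSet_singleton (0 : ℝ))
  have h1 : idFun * Set.indicator {0} (1 : ℝ → ℂ) = 0 := by
    ext x
    by_cases hx : x = 0 <;> simp [hx, idFun]
  have h2 : BoundedBorel (idFun * Set.indicator {0} (1 : ℝ → ℂ)) := by
    rw [h1]
    exact ⟨measurable_zero, 0, by simp⟩
  have h3 := hinj ⟨_, hE.mem_domain h0 h2 u⟩ (by
    rw [hE.map_apply h0 h2, h1, hμ.zero]
    rfl)
  rw [← hμ.norm_sq_indicator (measurableSet_singleton 0)]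
  simp only at h3
  rw [h3]
  simp

end SpectralMeasure.IsSpectralMeasureOf

theorem spectralMeasure_spec {ε : H →ₗ.[ℂ] H} (hε : IsSelfAdjoint ε)
    (hpos : ∀ u : ε.domain, 0 ≤ (⟪(u : H), ε u⟫_ℂ).re) :
    (spectralMeasure ε).IsSpectralMeasureOf ε :=
  Classical.epsilon_spec (exists_isSpectralMeasureOf hε hpos)

end SpectralCalculus

section Coordinates

variable {H : Type*} [NormedAddCommGroup H] [InnerProductSpace ℂ H] [CompleteSpace H]

theorem continuous_weight (s : ℝ) : Continuous (weight s) := by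
  unfold weight
  exact Continuous.rpow_const (by fun_prop) fun x => Or.inl (by positivity)

theorem weight_add (s t x : ℝ) : weight (s + t) x = weight s x * weight t x :=
  Real.rpow_add (by positivity) s t

theorem weight_le_one {s : ℝ} (hs : s ≤ 0) (x : ℝ) : weight s x ≤ 1 :=
  Real.rpow_le_one_of_one_le_of_nonpos (by nlinarith [sq_nonneg (x ^ 2)]) hs

/-- The weight function with values in the complex numbers. -/
def cweight (s : ℝ) : ℝ → ℂ := fun x => (weight s x : ℂ)

theorem continuous_cweight (s : ℝ) : Continuous (cweight s) :=
  Complex.continuous_ofReal.comp (continuous_weight s)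

theorem cweight_mul (s t : ℝ) : cweight s * cweight t = cweight (s + t) := by
  ext x
  simp [cweight, weight_add]

theorem cweight_zero : cweight 0 = 1 := by
  ext x
  simp [cweight, weight]

theorem star_cweight (s : ℝ) : star (cweight s) = cweight s := by
  ext x
  simp [cweight]

theorem norm_cweight (s x : ℝ) : ‖cweight s x‖ = weight s x := by
  rw [cweight, Complex.norm_real, Real.norm_of_nonneg (weight_pos s x).le]

theorem boundedBorel_cweight {s : ℝ} (hs : s ≤ 0) : BoundedBorel (cweight s) :=
  ⟨(continuous_cweight s).measurable, 1, fun x => by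
    rw [norm_cweight]
    exact weight_le_one hs x⟩

theorem IsCalculus.exists_limit_cutoff {μ : H → Measure ℝ} (hμ : IsCalculus μ) {g : ℝ → ℂ}
    (hg : Continuous g) {u : H} (hu : ∫⁻ x, ENNReal.ofReal (‖g x‖ ^ 2) ∂μ u < ⊤) :
    ∃ v, Tendsto (fun n => opFun μ (cutoff n * g) u) atTop (𝓝 v) := by
  have hb := boundedBorel_cutoff_mul hg
  let c : ℕ → ℝ≥0∞ := fun n => ∫⁻ x, ENNReal.ofReal (‖(1 - cutoff n x) * g x‖ ^ 2) ∂μ u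
  have hnorm : ∀ n x, ‖1 - cutoff n x‖ ≤ 1 := fun n x => by
    by_cases hx : x ∈ Set.Icc (-n : ℝ) n <;> simp [cutoff, hx]
  have hle : ∀ n x, ‖(1 - cutoff n x) * g x‖ ≤ ‖g x‖ := fun n x => by
    rw [norm_mul]
    exact mul_le_of_le_one_left (norm_nonneg _) (hnorm n x)
  have hm : ∀ n, Measurable fun x => (1 - cutoff n x) * g x := fun n =>
    (measurable_const.sub (boundedBorel_cutoff n).1).mul hg.measurable
  have hlt : ∀ n, c n < ⊤ := fun n => (lintegral_mono fun x =>
    ENNReal.ofReal_le_ofReal (pow_le_pow_left₀ (norm_nonneg _) (hle n x) 2)).trans_lt hu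
  have hc : Tendsto c atTop (𝓝 0) := by
    have h := tendsto_lintegral_of_dominated_convergence (μ := μ u)
      (F := fun n x => ENNReal.ofReal (‖(1 - cutoff n x) * g x‖ ^ 2)) (f := fun _ => 0)
      (fun x => ENNReal.ofReal (‖g x‖ ^ 2)) (fun n => ((hm n).norm.pow_const 2).ennreal_ofReal)
      (fun n => Eventually.of_forall fun x =>
        ENNReal.ofReal_le_ofReal (pow_le_pow_left₀ (norm_nonneg _) (hle n x) 2)) hu.ne
      (Eventually.of_forall fun x => by
        have h1 := ((tendsto_const_nhds (x := (1 : ℂ))).sub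
          (KleinGordon.tendsto_cutoff x)).mul_const (g x)
        have h2 := ENNReal.tendsto_ofReal (h1.norm.pow 2)
        simpa using h2)
    rwa [lintegral_zero] at h
  have hcauchy : CauchySeq fun n => opFun μ (cutoff n * g) u := by
    refine cauchySeq_of_le_tendsto_0' (fun n => √(c n).toReal) (fun n m hnm => ?_) ?_
    · rw [dist_eq_norm]
      refine Real.le_sqrt_of_sq_le ?_
      have h1 : opFun μ (cutoff n * g) u - opFun μ (cutoff m * g) u =
          opFun μ (cutoff n * g + (-1 : ℂ) • (cutoff m * g)) u := by
        rw [hμ.add (hb n) ((hb m).smul _), hμ.smul _ (hb m)]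
        simp [sub_eq_add_neg]
      rw [h1, ← ENNReal.ofReal_le_iff_le_toReal (hlt n).ne,
        hμ.norm_sq_eq_lintegral ((hb n).add ((hb m).smul _))]
      refine lintegral_mono fun x =>
        ENNReal.ofReal_le_ofReal (pow_le_pow_left₀ (norm_nonneg _) ?_ 2)
      have h2 : (cutoff n * g + (-1 : ℂ) • (cutoff m * g)) x = (cutoff n x - cutoff m x) * g x := by
        simp only [Pi.add_apply, Pi.smul_apply, Pi.mul_apply, smul_eq_mul]
        ring
      rw [h2, norm_mul, norm_mul]
      refine mul_le_mul_of_nonneg_right ?_ (norm_nonneg _)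
      by_cases hx : x ∈ Set.Icc (-n : ℝ) n
      · have hx' : x ∈ Set.Icc (-m : ℝ) m := by
          have : (n : ℝ) ≤ m := by exact_mod_cast hnm
          exact ⟨by linarith [hx.1], by linarith [hx.2]⟩
        simp [cutoff, hx, hx']
      · simpa [cutoff, hx] using norm_cutoff_le m x
    · have h := ((ENNReal.tendsto_toReal ENNReal.zero_ne_top).comp hc).sqrt
      simpa [Function.comp_def] using h
  exact cauchySeq_tendsto_of_complete hcauchy

variable (ε : H →ₗ.[ℂ] H) {θ : ℝ}

/-- The operators of the calculus of `ε` come from a family of measures with a calculus. -/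
theorem isCalculus_spectralMeasure : IsCalculus (spectralMeasure ε).measure :=
  (spectralMeasure ε).isCalculus

theorem sobolevForm_cweight (hθ : 0 ≤ θ) (a : H) :
    sobolevForm ε θ (borelFun ε (cweight (-θ / 2)) a) = ENNReal.ofReal (‖a‖ ^ 2) := by
  have hw := boundedBorel_cweight (s := -θ / 2) (by linarith)
  rw [sobolevForm, borelFun_eq_opFun, (isCalculus_spectralMeasure ε).measure_apply hw,
    lintegral_withDensity_eq_lintegral_mul _ (hw.measurable.norm.pow_const 2).ennreal_ofReal
      (measurable_weight θ).ennreal_ofReal, ← SpectralMeasure.measure_univ, ← lintegral_one]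
  refine lintegral_congr fun x => ?_
  rw [Pi.mul_apply, norm_cweight, ← ENNReal.ofReal_mul (by positivity), pow_two, ← weight_add,
    ← weight_add]
  simp [weight]

/-- The unitary operator `⟨h₀⟩^{-θ}` of `H` onto `⟨h₀⟩^{-θ}H`. -/
def sobolevEquiv (hθ : 0 ≤ θ) : H ≃ₗᵢ[ℂ] Sobolev ε θ :=
  LinearIsometryEquiv.ofSurjective
    { toFun := fun a => ⟨borelFun ε (cweight (-θ / 2)) a, by
        change sobolevForm ε θ _ < ⊤
        rw [sobolevForm_cweight ε hθ]
        exact ENNReal.ofReal_lt_top⟩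
      map_add' := fun a b => Subtype.ext (map_add _ a b)
      map_smul' := fun c a => Subtype.ext (map_smul _ c a)
      norm_map' := fun a => by
        rw [Sobolev.norm_def]
        change √(sobolevForm ε θ (borelFun ε (cweight (-θ / 2)) a)).toReal = ‖a‖
        rw [sobolevForm_cweight ε hθ, ENNReal.toReal_ofReal (by positivity),
          Real.sqrt_sq (norm_nonneg a)] } (by
    intro u
    have hμ := isCalculus_spectralMeasure ε
    have hw := boundedBorel_cweight (s := -θ / 2) (by linarith)
    obtain ⟨v, hv⟩ := hμ.exists_limit_cutoff (continuous_cweight (θ / 2)) (u := Sobolev.toH ε θ u)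
      (by
        refine (lintegral_congr fun x => ?_).trans_lt (Sobolev.form_lt_top ε θ u)
        rw [norm_cweight, pow_two, ← weight_add, add_halves])
    refine ⟨v, Sobolev.toH_injective ε θ ?_⟩
    change opFun (spectralMeasure ε).measure (cweight (-θ / 2)) v = Sobolev.toH ε θ u
    refine tendsto_nhds_unique (((ContinuousLinearMap.continuous _).tendsto v).comp hv)
      ((hμ.tendsto_cutoff _).congr fun n => ?_)
    rw [Function.comp_apply, hμ.mul_apply hw
      (boundedBorel_cutoff_mul (continuous_cweight (θ / 2)) n), mul_left_comm, cweight_mul]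
    have : -θ / 2 + θ / 2 = 0 := by ring
    rw [this, cweight_zero, mul_one])

theorem coe_sobolevEquiv (hθ : 0 ≤ θ) (a : H) :
    Sobolev.toH ε θ (sobolevEquiv ε hθ a) = borelFun ε (cweight (-θ / 2)) a := rfl

/-- The antilinear form `⟨h₀⟩^{θ}b` on `⟨h₀⟩^{-θ}H`. -/
def antidualVector (hθ : 0 ≤ θ) (b : H) : Sobolev ε θ →L⋆[ℂ] ℂ :=
  LinearMap.mkContinuous
    { toFun := fun w => ⟪(sobolevEquiv ε hθ).symm w, b⟫_ℂ
      map_add' := fun w w' => by rw [map_add, inner_add_left]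
      map_smul' := fun c w => by
        rw [map_smul, inner_smul_left, smul_eq_mul] } ‖b‖ fun w => by
    refine (norm_inner_le_norm _ _).trans ?_
    rw [LinearIsometryEquiv.norm_map, mul_comm]

theorem antidualVector_apply (hθ : 0 ≤ θ) (b c : H) :
    antidualVector ε hθ b (sobolevEquiv ε hθ c) = ⟪c, b⟫_ℂ := by
  change ⟪(sobolevEquiv ε hθ).symm (sobolevEquiv ε hθ c), b⟫_ℂ = _
  rw [LinearIsometryEquiv.symm_apply_apply]

theorem norm_antidualVector (hθ : 0 ≤ θ) (b : H) : ‖antidualVector ε hθ b‖ = ‖b‖ := by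
  refine le_antisymm (LinearMap.mkContinuous_norm_le _ (norm_nonneg b) _) ?_
  have h := (antidualVector ε hθ b).le_opNorm (sobolevEquiv ε hθ b)
  rw [antidualVector_apply, LinearIsometryEquiv.norm_map,
    inner_self_eq_norm_sq_to_K, norm_pow, RCLike.norm_ofReal, abs_norm, pow_two] at h
  rcases (norm_nonneg b).eq_or_lt with h0 | h0
  · rw [← h0]
    exact norm_nonneg _
  · exact le_of_mul_le_mul_right h h0

/-- The unitary operator `⟨h₀⟩^{θ}` of `H` onto `⟨h₀⟩^{θ}H`. -/
def antidualEquiv (hθ : 0 ≤ θ) : H ≃ₗᵢ[ℂ] (Sobolev ε θ →L⋆[ℂ] ℂ) :=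
  LinearIsometryEquiv.ofSurjective
    { toFun := antidualVector ε hθ
      map_add' := fun b b' => by
        ext w
        exact inner_add_right _ _ _
      map_smul' := fun c b => by
        ext w
        exact inner_smul_right _ _ _
      norm_map' := norm_antidualVector ε hθ } (by
    intro ℓ
    let f : StrongDual ℂ H := LinearMap.mkContinuous
      { toFun := fun c => (starRingEnd ℂ) (ℓ (sobolevEquiv ε hθ c))
        map_add' := fun c d => by rw [map_add, map_add, map_add]
        map_smul' := fun k c => by
          rw [map_smul, map_smulₛₗ, smul_eq_mul, map_mul, Complex.conj_conj]
          rfl } ‖ℓ‖ fun c => by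
        have := ℓ.le_opNorm (sobolevEquiv ε hθ c)
        rw [LinearIsometryEquiv.norm_map] at this
        simpa using this
    refine ⟨(InnerProductSpace.toDual ℂ H).symm f, ?_⟩
    ext w
    change ⟪(sobolevEquiv ε hθ).symm w, (InnerProductSpace.toDual ℂ H).symm f⟫_ℂ = ℓ w
    rw [← inner_conj_symm, InnerProductSpace.toDual_symm_apply]
    change (starRingEnd ℂ) ((starRingEnd ℂ) (ℓ (sobolevEquiv ε hθ _))) = ℓ w
    rw [Complex.conj_conj, LinearIsometryEquiv.apply_symm_apply])

/-- The isomorphism `(a, b) ↦ (⟨h₀⟩^{-θ}a, ⟨h₀⟩^{θ}b)` of `H ⊕ H` onto `K_θ`. -/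
def chargeEquiv (hθ : 0 ≤ θ) : (H × H) ≃L[ℂ] ChargeSpace ε θ :=
  ((sobolevEquiv ε hθ).toContinuousLinearEquiv).prodCongr
    (antidualEquiv ε hθ).toContinuousLinearEquiv

theorem chargeEquiv_fst (hθ : 0 ≤ θ) (p : H × H) :
    Sobolev.toH ε θ (chargeEquiv ε hθ p).1 = borelFun ε (cweight (-θ / 2)) p.1 := rfl

theorem chargeEquiv_snd (hθ : 0 ≤ θ) (p : H × H) (c : H) :
    (chargeEquiv ε hθ p).2 (sobolevEquiv ε hθ c) = ⟪c, p.2⟫_ℂ := antidualVector_apply ε hθ p.2 c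

/-- A vector `v` of `H` as an element of `⟨h₀⟩^{θ}H`. -/
theorem chargeEquiv_snd_eq_inner_iff (hθ : 0 ≤ θ) (p : H × H) (v : H) :
    (∀ w : Sobolev ε θ, (chargeEquiv ε hθ p).2 w = ⟪(w : H), v⟫_ℂ) ↔
      p.2 = borelFun ε (cweight (-θ / 2)) v := by
  have hw := boundedBorel_cweight (s := -θ / 2) (by linarith)
  have key : ∀ c : H, ⟪Sobolev.toH ε θ (sobolevEquiv ε hθ c), v⟫_ℂ =
      ⟪c, borelFun ε (cweight (-θ / 2)) v⟫_ℂ := fun c => by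
    rw [coe_sobolevEquiv, borelFun_eq_opFun, (isCalculus_spectralMeasure ε).inner_apply hw,
      star_cweight]
  constructor
  · intro h
    refine ext_inner_left ℂ fun c => ?_
    rw [← chargeEquiv_snd ε hθ p c, h, key]
  · intro h w
    obtain ⟨c, rfl⟩ := (sobolevEquiv ε hθ).surjective w
    rw [chargeEquiv_snd, h, key]

end Coordinates

section FunctionEstimates

variable {θ : ℝ} {φ χ : ℝ → ℂ}

theorem bounds_of_normLambdaTheta_le {M : ℝ≥0} (h : normLambdaTheta θ φ ≤ M) (x : ℝ) :
    ‖φ x‖ ≤ M ∧ ‖oddPart φ x / (x : ℂ)‖ ≤ M ∧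
      ‖oddPart φ x‖ * √(1 + x ^ 2) ^ |4 * θ - 1| ≤ M := by
  have key : ∀ y : ℂ, ‖y‖ₑ ≤ M → ‖y‖ ≤ M := fun y hy => by
    rw [← ofReal_norm] at hy
    simpa using (ENNReal.ofReal_le_iff_le_toReal ENNReal.coe_ne_top).mp hy
  unfold normLambdaTheta normLambda at h
  have h2 : ∀ x : ℝ, 0 ≤ x → ‖oddPart φ x / (x : ℂ)‖ ≤ M := fun x hx => key _
    ((le_iSup₂ (f := fun (x : ℝ) (_ : 0 ≤ x) => ‖oddPart φ x / (x : ℂ)‖ₑ) x hx).trans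
      ((le_add_self.trans le_self_add).trans h))
  refine ⟨key _ ((le_iSup (fun x : ℝ => ‖φ x‖ₑ) x).trans
    ((le_self_add.trans (le_self_add.trans le_self_add)).trans h)), ?_, ?_⟩
  · rcases le_total 0 x with hx | hx
    · exact h2 x hx
    · have h3 := h2 (-x) (by linarith)
      have h4 : oddPart φ (-x) = -oddPart φ x := by
        simp only [oddPart, neg_neg]; ring
      rwa [h4, Complex.ofReal_neg, neg_div_neg_eq] at h3
  · have h4 := (le_iSup (fun x : ℝ => ‖oddPart φ x‖ₑ *
      ENNReal.ofReal (√(1 + x ^ 2) ^ |4 * θ - 1|)) x).trans (le_add_self.trans h)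
    simp only [← ofReal_norm] at h4
    rw [← ENNReal.ofReal_mul (norm_nonneg _)] at h4
    simpa using (ENNReal.ofReal_le_iff_le_toReal ENNReal.coe_ne_top).mp h4

theorem oddPart_zero (φ : ℝ → ℂ) : oddPart φ 0 = 0 := by simp [oddPart]

theorem oddQuot_of_ne {x : ℝ} (hx : x ≠ 0) : oddQuot φ x = oddPart φ x / x := if_neg hx

theorem oddQuot_zero : oddQuot φ 0 = deriv φ 0 := if_pos rfl

theorem tendsto_oddPart_div (h : DifferentiableAt ℝ φ 0) :
    Tendsto (fun x : ℝ => oddPart φ x / x) (𝓝[≠] 0) (𝓝 (deriv φ 0)) := by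
  have h1 : HasDerivAt φ (deriv φ 0) 0 := h.hasDerivAt
  have h2 : HasDerivAt (fun x => φ (-x)) (-deriv φ 0) 0 := by
    have h1' : HasDerivAt φ (deriv φ 0) (-(0 : ℝ)) := by rwa [neg_zero]
    have := h1'.scomp (0 : ℝ) (hasDerivAt_neg 0)
    simpa [Function.comp_def] using this
  have h3 : HasDerivAt (oddPart φ) (deriv φ 0) 0 := by
    have := (h1.sub h2).div_const 2
    rwa [sub_neg_eq_add, add_self_div_two] at this
  refine (hasDerivAt_iff_tendsto_slope.mp h3).congr fun x => ?_
  rw [slope_def_module, oddPart_zero, sub_zero, sub_zero, Complex.real_smul, Complex.ofReal_inv,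
    div_eq_inv_mul]

theorem norm_oddQuot_le {M : ℝ≥0} (h : normLambdaTheta θ φ ≤ M) (x : ℝ) : ‖oddQuot φ x‖ ≤ M := by
  rcases eq_or_ne x 0 with rfl | hx
  · rw [oddQuot_zero]
    by_cases hd : DifferentiableAt ℝ φ 0
    · exact le_of_tendsto (tendsto_oddPart_div hd).norm
        (Eventually.of_forall fun x => (bounds_of_normLambdaTheta_le h x).2.1)
    · rw [deriv_zero_of_not_differentiableAt hd, norm_zero]
      exact M.2
  · rw [oddQuot_of_ne hx]
    exact (bounds_of_normLambdaTheta_le h x).2.1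

theorem weight_eq (s x : ℝ) : weight s x = (1 + |x| ^ 4) ^ s := by
  rw [weight, ← pow_mul, ← abs_pow, abs_of_nonneg (by positivity : (0 : ℝ) ≤ x ^ 4)]

theorem rpow_le_japanese {x : ℝ} (hx : 1 ≤ |x|) {s t : ℝ} (h : s ≤ |t|) :
    |x| ^ s ≤ √(1 + x ^ 2) ^ |t| := by
  refine (Real.rpow_le_rpow_of_exponent_le hx h).trans
    (Real.rpow_le_rpow (abs_nonneg _) ?_ (abs_nonneg _))
  exact Real.le_sqrt_of_sq_le (by rw [sq_abs]; linarith)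

theorem norm_cweight_mul_oddQuot_le (hθ0 : 0 ≤ θ) (hθ1 : θ ≤ 1 / 2) {M : ℝ≥0}
    (h : normLambdaTheta θ φ ≤ M) (x : ℝ) : ‖(cweight θ * oddQuot φ) x‖ ≤ 2 * M := by
  rw [Pi.mul_apply, norm_mul, norm_cweight, weight_eq]
  have h2θ : (2 : ℝ) ^ θ ≤ 2 := by
    simpa using Real.rpow_le_rpow_of_exponent_le one_le_two (by linarith : θ ≤ 1)
  rcases le_total |x| 1 with hx | hx
  · refine mul_le_mul ?_ (norm_oddQuot_le h x) (norm_nonneg _) (by norm_num)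
    refine (Real.rpow_le_rpow (by positivity) ?_ hθ0).trans h2θ
    have := pow_le_one₀ (n := 4) (abs_nonneg x) hx
    linarith
  · have hx0 : 0 < |x| := by linarith
    have h1 : (1 + |x| ^ 4) ^ θ ≤ 2 * (|x| * √(1 + x ^ 2) ^ |4 * θ - 1|) := by
      calc (1 + |x| ^ 4) ^ θ ≤ (2 * |x| ^ 4) ^ θ := by
            refine Real.rpow_le_rpow (by positivity) ?_ hθ0
            have := one_le_pow₀ (n := 4) hx
            linarith
        _ = 2 ^ θ * |x| ^ (4 * θ) := by
            rw [Real.mul_rpow (by norm_num) (by positivity), ← Real.rpow_natCast,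
              ← Real.rpow_mul (abs_nonneg x)]
            norm_num
        _ ≤ 2 * (|x| * √(1 + x ^ 2) ^ |4 * θ - 1|) := by
            refine mul_le_mul h2θ ?_ (by positivity) (by norm_num)
            have h3 : |x| ^ (4 * θ) = |x| * |x| ^ (4 * θ - 1) := by
              nth_rw 2 [← Real.rpow_one |x|]
              rw [← Real.rpow_add hx0]
              congr 1
              ring
            rw [h3]
            exact mul_le_mul_of_nonneg_left (rpow_le_japanese hx (le_abs_self _)) hx0.le
    have hxne : x ≠ 0 := abs_pos.mp hx0
    rw [oddQuot_of_ne hxne, norm_div, Complex.norm_real, Real.norm_eq_abs]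
    refine (mul_le_mul_of_nonneg_right h1 (by positivity)).trans ?_
    have h4 := (bounds_of_normLambdaTheta_le h x).2.2
    have h5 : 2 * (|x| * √(1 + x ^ 2) ^ |4 * θ - 1|) * (‖oddPart φ x‖ / |x|) =
        2 * (‖oddPart φ x‖ * √(1 + x ^ 2) ^ |4 * θ - 1|) := by
      field_simp
    rw [h5]
    linarith

theorem norm_oddPart_le {M : ℝ≥0} (h : normLambdaTheta θ φ ≤ M) (x : ℝ) : ‖oddPart φ x‖ ≤ M := by
  refine le_trans ?_ (bounds_of_normLambdaTheta_le h x).2.2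
  refine le_mul_of_one_le_right (norm_nonneg _) (Real.one_le_rpow ?_ (abs_nonneg _))
  exact Real.one_le_sqrt.mpr (by nlinarith [sq_nonneg x])

theorem norm_cweight_mul_oddPart_le (hθ0 : 0 ≤ θ) {M : ℝ≥0}
    (h : normLambdaTheta θ φ ≤ M) (x : ℝ) : ‖(cweight (-θ) * (idFun * oddPart φ)) x‖ ≤ M := by
  rw [Pi.mul_apply, norm_mul, norm_cweight, Pi.mul_apply, norm_mul, idFun, Complex.norm_real,
    Real.norm_eq_abs]
  rcases le_total |x| 1 with hx | hx
  · refine (mul_le_of_le_one_left (by positivity) (weight_le_one (by linarith) x)).trans ?_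
    exact (mul_le_of_le_one_left (norm_nonneg _) hx).trans (norm_oddPart_le h x)
  · have hx0 : 0 < |x| := by linarith
    have h1 : weight (-θ) x * |x| ≤ √(1 + x ^ 2) ^ |4 * θ - 1| := by
      calc weight (-θ) x * |x| ≤ |x| ^ (-(4 * θ)) * |x| := by
            refine mul_le_mul_of_nonneg_right ?_ hx0.le
            rw [weight_eq]
            have h2 : |x| ^ (-(4 * θ)) = (|x| ^ 4) ^ (-θ) := by
              rw [← Real.rpow_natCast, ← Real.rpow_mul (abs_nonneg x)]
              congr 1
              push_cast
              ring
            rw [h2]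
            exact Real.rpow_le_rpow_of_nonpos (by positivity) (by linarith) (by linarith)
        _ = |x| ^ (1 - 4 * θ) := by
            nth_rw 2 [← Real.rpow_one |x|]
            rw [← Real.rpow_add hx0]
            congr 1
            ring
        _ ≤ √(1 + x ^ 2) ^ |4 * θ - 1| :=
            rpow_le_japanese hx (by rw [abs_sub_comm]; exact le_abs_self _)
    rw [← mul_assoc]
    refine (mul_le_mul_of_nonneg_right h1 (norm_nonneg _)).trans ?_
    rw [mul_comm]
    exact (bounds_of_normLambdaTheta_le h x).2.2

theorem measurable_evenPart (h : Measurable φ) : Measurable (evenPart φ) :=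
  (h.add (h.comp measurable_neg)).div_const 2

theorem measurable_oddPart (h : Measurable φ) : Measurable (oddPart φ) :=
  (h.sub (h.comp measurable_neg)).div_const 2

theorem measurable_oddQuot (h : Measurable φ) : Measurable (oddQuot φ) :=
  Measurable.ite (measurableSet_singleton 0) measurable_const
    ((measurable_oddPart h).div Complex.measurable_ofReal)

theorem exists_bound_of_mem_Lambda (h : φ ∈ Lambda θ) :
    ∃ M : ℝ≥0, normLambdaTheta θ φ ≤ M :=
  ⟨(normLambdaTheta θ φ).toNNReal, (ENNReal.coe_toNNReal h.2.ne).ge⟩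

theorem boundedBorel_evenPart (h : φ ∈ Lambda θ) : BoundedBorel (evenPart φ) := by
  obtain ⟨M, hM⟩ := exists_bound_of_mem_Lambda h
  exact ⟨measurable_evenPart h.1, M,
    norm_evenPart_le fun x => (bounds_of_normLambdaTheta_le hM x).1⟩

theorem boundedBorel_oddPart (h : φ ∈ Lambda θ) : BoundedBorel (oddPart φ) := by
  obtain ⟨M, hM⟩ := exists_bound_of_mem_Lambda h
  exact ⟨measurable_oddPart h.1, M, norm_oddPart_le hM⟩

theorem boundedBorel_cweight_oddQuot (hθ0 : 0 ≤ θ) (hθ1 : θ ≤ 1 / 2) (h : φ ∈ Lambda θ) :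
    BoundedBorel (cweight θ * oddQuot φ) := by
  obtain ⟨M, hM⟩ := exists_bound_of_mem_Lambda h
  exact ⟨(continuous_cweight θ).measurable.mul (measurable_oddQuot h.1), _,
    norm_cweight_mul_oddQuot_le hθ0 hθ1 hM⟩

theorem boundedBorel_cweight_oddPart (hθ0 : 0 ≤ θ) (h : φ ∈ Lambda θ) :
    BoundedBorel (cweight (-θ) * (idFun * oddPart φ)) := by
  obtain ⟨M, hM⟩ := exists_bound_of_mem_Lambda h
  exact ⟨(continuous_cweight _).measurable.mul
    (continuous_idFun.measurable.mul (measurable_oddPart h.1)), _,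
    norm_cweight_mul_oddPart_le hθ0 hM⟩

end FunctionEstimates

section ChargeCalculus

variable {H : Type*} [NormedAddCommGroup H] [InnerProductSpace ℂ H] [CompleteSpace H]
  (ε : H →ₗ.[ℂ] H) {θ : ℝ} {φ χ : ℝ → ℂ}

/-- Either `φ` is differentiable at `0`, or the kernel of `ε` is trivial. -/
def RegularAtZero (φ : ℝ → ℂ) : Prop :=
  DifferentiableAt ℝ φ 0 ∨ ∀ u, (spectralMeasure ε).measure u {0} = 0

variable {ε} in
theorem borelFun_congr {P : Prop} (h : P ∨ ∀ u, (spectralMeasure ε).measure u {0} = 0)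
    {f g : ℝ → ℂ} (hf : BoundedBorel f) (hg : BoundedBorel g) (hne : ∀ x ≠ 0, f x = g x)
    (h0 : P → f 0 = g 0) : borelFun ε f = borelFun ε g := by
  refine (isCalculus_spectralMeasure ε).congr hf hg fun u => ?_
  rcases h with h | h
  · refine Eventually.of_forall fun x => ?_
    rcases eq_or_ne x 0 with rfl | hx
    · exact h0 h
    · exact hne x hx
  · have hae : ∀ᵐ x ∂(spectralMeasure ε).measure u, x ≠ 0 := by
      rw [ae_iff]; simpa using h u
    filter_upwards [hae] with x hx using hne x hx

variable (θ) in
/-- The matrix of `φ(K_{0,θ})` in the coordinates of `chargeEquiv`. -/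
def calculusMatrix (φ : ℝ → ℂ) : (H × H) →L[ℂ] (H × H) :=
  ((borelFun ε (evenPart φ)).coprod (borelFun ε (cweight θ * oddQuot φ))).prod
    ((borelFun ε (cweight (-θ) * (idFun * oddPart φ))).coprod (borelFun ε (evenPart φ)))

theorem calculusMatrix_apply (p : H × H) : calculusMatrix ε θ φ p =
    (borelFun ε (evenPart φ) p.1 + borelFun ε (cweight θ * oddQuot φ) p.2,
      borelFun ε (cweight (-θ) * (idFun * oddPart φ)) p.1 + borelFun ε (evenPart φ) p.2) := rfl

theorem calculusMatrix_smul (hθ0 : 0 ≤ θ) (hθ1 : θ ≤ 1 / 2) (hφ : φ ∈ Lambda θ) (c : ℂ) :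
    calculusMatrix ε θ (c • φ) = c • calculusMatrix ε θ φ := by
  have hμ := isCalculus_spectralMeasure ε
  have h1 : evenPart (c • φ) = c • evenPart φ := by
    ext x; simp only [evenPart, Pi.smul_apply, smul_eq_mul]; ring
  have h2 : cweight θ * oddQuot (c • φ) = c • (cweight θ * oddQuot φ) := by
    ext x
    rcases eq_or_ne x 0 with rfl | hx
    · have : deriv (c • φ) 0 = c • deriv φ 0 := deriv_const_smul_field c φ
      simp only [Pi.mul_apply, oddQuot_zero, Pi.smul_apply, this, smul_eq_mul]
      ring
    · simp only [Pi.mul_apply, oddQuot_of_ne hx, Pi.smul_apply, oddPart, smul_eq_mul]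
      ring
  have h3 : cweight (-θ) * (idFun * oddPart (c • φ)) =
      c • (cweight (-θ) * (idFun * oddPart φ)) := by
    ext x; simp only [oddPart, Pi.smul_apply, Pi.mul_apply, smul_eq_mul]; ring
  ext p <;>
    simp [calculusMatrix_apply, h1, h2, h3, borelFun_eq_opFun,
      hμ.smul c (boundedBorel_evenPart hφ),
      hμ.smul c (boundedBorel_cweight_oddQuot hθ0 hθ1 hφ),
      hμ.smul c (boundedBorel_cweight_oddPart hθ0 hφ)]

theorem evenPart_add (φ χ : ℝ → ℂ) : evenPart (φ + χ) = evenPart φ + evenPart χ := by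
  ext x; simp only [evenPart, Pi.add_apply]; ring

theorem calculusMatrix_add (hθ0 : 0 ≤ θ) (hθ1 : θ ≤ 1 / 2) (hφ : φ ∈ Lambda θ) (hχ : χ ∈ Lambda θ)
    (hφ' : RegularAtZero ε φ) (hχ' : RegularAtZero ε χ) :
    calculusMatrix ε θ (φ + χ) = calculusMatrix ε θ φ + calculusMatrix ε θ χ := by
  have hμ := isCalculus_spectralMeasure ε
  have h2 : borelFun ε (cweight θ * oddQuot (φ + χ)) =
      borelFun ε (cweight θ * oddQuot φ + cweight θ * oddQuot χ) := by
    refine borelFun_congr (P := DifferentiableAt ℝ φ 0 ∧ DifferentiableAt ℝ χ 0) ?_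
      (boundedBorel_cweight_oddQuot hθ0 hθ1 (add_mem hφ hχ))
      ((boundedBorel_cweight_oddQuot hθ0 hθ1 hφ).add (boundedBorel_cweight_oddQuot hθ0 hθ1 hχ))
      (fun x hx => ?_) fun h => ?_
    · rcases hφ' with h | h
      · exact hχ'.imp_left fun h' => ⟨h, h'⟩
      · exact Or.inr h
    · simp only [Pi.mul_apply, oddQuot_of_ne hx, Pi.add_apply, oddPart_add]
      ring
    · simp only [Pi.mul_apply, oddQuot_zero, Pi.add_apply, deriv_add h.1 h.2]
      ring
  have h3 : cweight (-θ) * (idFun * oddPart (φ + χ)) =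
      cweight (-θ) * (idFun * oddPart φ) + cweight (-θ) * (idFun * oddPart χ) := by
    ext x
    simp only [oddPart_add, Pi.add_apply, Pi.mul_apply]
    ring
  have e1 : borelFun ε (evenPart φ + evenPart χ) = _ :=
    hμ.add (boundedBorel_evenPart hφ) (boundedBorel_evenPart hχ)
  have e2 : borelFun ε (cweight θ * oddQuot φ + cweight θ * oddQuot χ) = _ :=
    hμ.add (boundedBorel_cweight_oddQuot hθ0 hθ1 hφ) (boundedBorel_cweight_oddQuot hθ0 hθ1 hχ)
  have e3 : borelFun ε (cweight (-θ) * (idFun * oddPart φ) +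
      cweight (-θ) * (idFun * oddPart χ)) = _ :=
    hμ.add (boundedBorel_cweight_oddPart hθ0 hφ) (boundedBorel_cweight_oddPart hθ0 hχ)
  refine ContinuousLinearMap.ext fun p => Prod.ext ?_ ?_
  · simp only [calculusMatrix_apply, evenPart_add, h2, e1, e2, add_apply, Prod.fst_add,
      borelFun_eq_opFun]
    abel
  · simp only [calculusMatrix_apply, evenPart_add, h3, e1, e3, add_apply, Prod.snd_add,
      borelFun_eq_opFun]
    abel

theorem evenPart_mul (φ χ : ℝ → ℂ) :
    evenPart (φ * χ) = evenPart φ * evenPart χ + oddPart φ * oddPart χ := by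
  ext x; simp only [evenPart, oddPart, Pi.mul_apply, Pi.add_apply]; ring

theorem evenPart_zero (φ : ℝ → ℂ) : evenPart φ 0 = φ 0 := by simp [evenPart]

theorem idFun_mul_oddQuot (φ : ℝ → ℂ) : idFun * oddQuot φ = oddPart φ := by
  ext x
  rcases eq_or_ne x 0 with rfl | hx
  · simp [idFun, oddPart_zero]
  · have : (x : ℂ) ≠ 0 := by exact_mod_cast hx
    rw [Pi.mul_apply, oddQuot_of_ne hx, idFun]
    field_simp

theorem cweight_mul_cweight_neg (θ : ℝ) : cweight θ * cweight (-θ) = 1 := by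
  rw [cweight_mul, add_neg_cancel, cweight_zero]

theorem calculusMatrix_mul (hθ0 : 0 ≤ θ) (hθ1 : θ ≤ 1 / 2) (hφ : φ ∈ Lambda θ) (hχ : χ ∈ Lambda θ)
    (hφ' : RegularAtZero ε φ) (hχ' : RegularAtZero ε χ) :
    calculusMatrix ε θ (φ * χ) = calculusMatrix ε θ φ * calculusMatrix ε θ χ := by
  have hμ := isCalculus_spectralMeasure ε
  have bφ := boundedBorel_evenPart hφ
  have bχ := boundedBorel_evenPart hχ
  have qφ := boundedBorel_cweight_oddQuot hθ0 hθ1 hφ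
  have qχ := boundedBorel_cweight_oddQuot hθ0 hθ1 hχ
  have oφ := boundedBorel_cweight_oddPart hθ0 hφ
  have oχ := boundedBorel_cweight_oddPart hθ0 hχ
  have hw := cweight_mul_cweight_neg θ
  have iφ := idFun_mul_oddQuot φ
  have iχ := idFun_mul_oddQuot χ
  have h1 : evenPart (φ * χ) = evenPart φ * evenPart χ +
      (cweight θ * oddQuot φ) * (cweight (-θ) * (idFun * oddPart χ)) := by
    rw [evenPart_mul, ← iφ]
    linear_combination (-(idFun * oddQuot φ * oddPart χ)) * hw
  have h1' : evenPart (φ * χ) =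
      (cweight (-θ) * (idFun * oddPart φ)) * (cweight θ * oddQuot χ) +
      evenPart φ * evenPart χ := by
    rw [evenPart_mul, ← iχ]
    linear_combination (-(idFun * oddQuot χ * oddPart φ)) * hw
  have h2 : borelFun ε (cweight θ * oddQuot (φ * χ)) =
      borelFun ε (evenPart φ * (cweight θ * oddQuot χ) +
        (cweight θ * oddQuot φ) * evenPart χ) := by
    refine borelFun_congr (P := DifferentiableAt ℝ φ 0 ∧ DifferentiableAt ℝ χ 0) ?_
      (boundedBorel_cweight_oddQuot hθ0 hθ1 (mul_mem hφ hχ))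
      ((bφ.mul qχ).add (qφ.mul bχ)) (fun x hx => ?_) fun h => ?_
    · rcases hφ' with h | h
      · exact hχ'.imp_left fun h' => ⟨h, h'⟩
      · exact Or.inr h
    · simp only [Pi.mul_apply, oddQuot_of_ne hx, Pi.add_apply, oddPart_mul]
      ring
    · simp only [Pi.mul_apply, oddQuot_zero, Pi.add_apply, deriv_mul h.1 h.2, evenPart_zero]
      ring
  have h3 : cweight (-θ) * (idFun * oddPart (φ * χ)) =
      (cweight (-θ) * (idFun * oddPart φ)) * evenPart χ +
        evenPart φ * (cweight (-θ) * (idFun * oddPart χ)) := by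
    ext x
    simp only [oddPart_mul, Pi.add_apply, Pi.mul_apply]
    ring
  have e1 := (congrArg (borelFun ε) h1).trans (hμ.add (bφ.mul bχ) (qφ.mul oχ))
  have e1' := (congrArg (borelFun ε) h1').trans (hμ.add (oφ.mul qχ) (bφ.mul bχ))
  have e2 := h2.trans (hμ.add (bφ.mul qχ) (qφ.mul bχ))
  have e3 := (congrArg (borelFun ε) h3).trans (hμ.add (oφ.mul bχ) (bφ.mul oχ))
  refine ContinuousLinearMap.ext fun p => Prod.ext ?_ ?_
  · change (calculusMatrix ε θ (φ * χ) p).1 = (calculusMatrix ε θ φ (calculusMatrix ε θ χ p)).1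
    simp only [calculusMatrix_apply, e1, e2, hμ.mul bφ bχ, hμ.mul qφ oχ, hμ.mul bφ qχ,
      hμ.mul qφ bχ, add_apply, mul_apply_eq_comp, map_add, borelFun_eq_opFun]
    abel
  · change (calculusMatrix ε θ (φ * χ) p).2 = (calculusMatrix ε θ φ (calculusMatrix ε θ χ p)).2
    simp only [calculusMatrix_apply, e1', e3, hμ.mul oφ qχ, hμ.mul bφ bχ, hμ.mul oφ bχ,
      hμ.mul bφ oχ, add_apply, mul_apply_eq_comp, map_add, borelFun_eq_opFun]
    abel

theorem calculusMatrix_one : calculusMatrix ε θ 1 = 1 := by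
  have hμ := isCalculus_spectralMeasure ε
  have h1 : evenPart 1 = 1 := by ext x; simp [evenPart]
  have h2 : oddPart 1 = 0 := by ext x; simp [oddPart]
  have h3 : oddQuot 1 = 0 := by
    ext x
    rcases eq_or_ne x 0 with rfl | hx
    · rw [oddQuot_zero]
      exact deriv_const (0 : ℝ) (1 : ℂ)
    · simp [oddQuot_of_ne hx, h2]
  refine ContinuousLinearMap.ext fun p => ?_
  simp [calculusMatrix_apply, h1, h2, h3, borelFun_eq_opFun, hμ.one, hμ.zero]

theorem norm_calculusMatrix_le (hθ0 : 0 ≤ θ) (hθ1 : θ ≤ 1 / 2) (hφ : Measurable φ) {M : ℝ≥0}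
    (hM : normLambdaTheta θ φ ≤ M) : ‖calculusMatrix ε θ φ‖ ≤ 3 * M := by
  have hμ := isCalculus_spectralMeasure ε
  have hΛ : φ ∈ Lambda θ := ⟨hφ, hM.trans_lt ENNReal.coe_lt_top⟩
  have h1 : ‖borelFun ε (evenPart φ)‖ ≤ M := hμ.opNorm_le (boundedBorel_evenPart hΛ)
    (norm_evenPart_le fun x => (bounds_of_normLambdaTheta_le hM x).1)
  have h2 : ‖borelFun ε (cweight θ * oddQuot φ)‖ ≤ 2 * M :=
    hμ.opNorm_le (boundedBorel_cweight_oddQuot hθ0 hθ1 hΛ)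
      (norm_cweight_mul_oddQuot_le hθ0 hθ1 hM)
  have h3 : ‖borelFun ε (cweight (-θ) * (idFun * oddPart φ))‖ ≤ M :=
    hμ.opNorm_le (boundedBorel_cweight_oddPart hθ0 hΛ) (norm_cweight_mul_oddPart_le hθ0 hM)
  have hM0 : (0 : ℝ) ≤ M := M.2
  refine ContinuousLinearMap.opNorm_le_bound _ (by positivity) fun p => ?_
  have hp1 := norm_fst_le p
  have hp2 := norm_snd_le p
  have hp : 0 ≤ ‖p‖ := norm_nonneg p
  have key : ∀ {A : H →L[ℂ] H} {v : H} {C : ℝ}, ‖A‖ ≤ C → ‖v‖ ≤ ‖p‖ → ‖A v‖ ≤ C * ‖p‖ :=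
    fun {A v C} hA hv => (A.le_opNorm v).trans
      (mul_le_mul hA hv (norm_nonneg _) ((norm_nonneg _).trans hA))
  rw [calculusMatrix_apply]
  refine norm_prod_le_iff.mpr ⟨(norm_add_le _ _).trans ?_, (norm_add_le _ _).trans ?_⟩
  · have := add_le_add (key h1 hp1) (key h2 hp2)
    refine this.trans (le_of_eq ?_)
    ring
  · have := add_le_add (key h3 hp1) (key h1 hp2)
    refine this.trans ?_
    nlinarith [mul_nonneg hM0 hp]

theorem tendsto_calculusMatrix (hθ0 : 0 ≤ θ) (hθ1 : θ ≤ 1 / 2) {φn : ℕ → ℝ → ℂ}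
    (hφn : ∀ n, φn n ∈ Lambda θ) (hφ : φ ∈ Lambda θ)
    {M : ℝ≥0} (hM : ∀ n, normLambdaTheta θ (φn n) ≤ M) (h : PtConv φn φ)
    (h0 : Tendsto (fun n => oddQuot (φn n) 0) atTop (𝓝 (oddQuot φ 0)) ∨
      ∀ u, (spectralMeasure ε).measure u {0} = 0) (p : H × H) :
    Tendsto (fun n => calculusMatrix ε θ (φn n) p) atTop (𝓝 (calculusMatrix ε θ φ p)) := by
  have hμ := isCalculus_spectralMeasure ε
  have heven : ∀ x, Tendsto (fun n => evenPart (φn n) x) atTop (𝓝 (evenPart φ x)) := fun x =>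
    ((h x).add (h (-x))).div_const 2
  have hodd : ∀ x, Tendsto (fun n => oddPart (φn n) x) atTop (𝓝 (oddPart φ x)) := fun x =>
    ((h x).sub (h (-x))).div_const 2
  have hquot : ∀ x ≠ 0, Tendsto (fun n => oddQuot (φn n) x) atTop (𝓝 (oddQuot φ x)) := by
    intro x hx
    simp only [oddQuot_of_ne hx]
    exact (hodd x).div_const _
  have t1 : ∀ v, Tendsto (fun n => borelFun ε (evenPart (φn n)) v) atTop
      (𝓝 (borelFun ε (evenPart φ) v)) := fun v =>
    hμ.tendsto (fun n => (boundedBorel_evenPart (hφn n)).1)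
      (fun n => norm_evenPart_le fun x => (bounds_of_normLambdaTheta_le (hM n) x).1)
      (boundedBorel_evenPart hφ) v (Eventually.of_forall heven)
  have t2 : ∀ v, Tendsto (fun n => borelFun ε (cweight θ * oddQuot (φn n)) v) atTop
      (𝓝 (borelFun ε (cweight θ * oddQuot φ) v)) := fun v => by
    refine hμ.tendsto (fun n => (boundedBorel_cweight_oddQuot hθ0 hθ1 (hφn n)).1)
      (fun n => norm_cweight_mul_oddQuot_le hθ0 hθ1 (hM n))
      (boundedBorel_cweight_oddQuot hθ0 hθ1 hφ) v ?_
    rcases h0 with h0 | h0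
    · refine Eventually.of_forall fun x => ?_
      rcases eq_or_ne x 0 with rfl | hx
      · exact h0.const_mul _
      · exact (hquot x hx).const_mul _
    · have hae : ∀ᵐ x ∂(spectralMeasure ε).measure v, x ≠ 0 := by
        rw [ae_iff]; simpa using h0 v
      filter_upwards [hae] with x hx using (hquot x hx).const_mul _
  have t3 : ∀ v, Tendsto (fun n => borelFun ε (cweight (-θ) * (idFun * oddPart (φn n))) v) atTop
      (𝓝 (borelFun ε (cweight (-θ) * (idFun * oddPart φ)) v)) := fun v =>
    hμ.tendsto (fun n => (boundedBorel_cweight_oddPart hθ0 (hφn n)).1)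
      (fun n => norm_cweight_mul_oddPart_le hθ0 (hM n))
      (boundedBorel_cweight_oddPart hθ0 hφ) v
      (Eventually.of_forall fun x => ((hodd x).const_mul _).const_mul _)
  simp only [calculusMatrix_apply]
  exact ((t1 _).add (t2 _)).prodMk_nhds ((t3 _).add (t1 _))

/-- The operator `φ(K_{0,θ})`. -/
def chargeFun (hθ0 : 0 ≤ θ) (φ : ℝ → ℂ) : ChargeSpace ε θ →L[ℂ] ChargeSpace ε θ :=
  (chargeEquiv ε hθ0).toContinuousLinearMap ∘L calculusMatrix ε θ φ ∘L
    (chargeEquiv ε hθ0).symm.toContinuousLinearMap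

theorem chargeFun_apply (hθ0 : 0 ≤ θ) (p : H × H) :
    chargeFun ε hθ0 φ (chargeEquiv ε hθ0 p) = chargeEquiv ε hθ0 (calculusMatrix ε θ φ p) := by
  simp [chargeFun]

theorem hasMatrix_chargeFun (hE : (spectralMeasure ε).IsSpectralMeasureOf ε)
    (hθ0 : 0 ≤ θ) (hθ1 : θ ≤ 1 / 2) (hφ : φ ∈ Lambda θ) :
    HasMatrix ε θ φ (chargeFun ε hθ0 φ) := by
  intro u hu u₁ hu₁
  obtain ⟨p, rfl⟩ := (chargeEquiv ε hθ0).surjective u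
  rw [chargeEquiv_snd_eq_inner_iff] at hu₁
  have hμ := isCalculus_spectralMeasure ε
  have hw := boundedBorel_cweight (s := -θ / 2) (by linarith)
  have hw2 : cweight (-θ / 2) * cweight (-θ / 2) = cweight (-θ) := by
    rw [cweight_mul, add_halves]
  have be := boundedBorel_evenPart hφ
  have bq := boundedBorel_cweight_oddQuot hθ0 hθ1 hφ
  have bo := boundedBorel_cweight_oddPart hθ0 hφ
  have bo' := boundedBorel_oddPart hφ
  rw [chargeFun_apply]
  constructor
  · rw [chargeEquiv_fst, chargeEquiv_fst, calculusMatrix_apply, hu₁]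
    simp only [borelFun_eq_opFun, map_add, hμ.mul_apply hw be, hμ.mul_apply be hw,
      hμ.mul_apply bq hw, hμ.mul_apply hw (bq.mul hw)]
    congr 3
    · ring
    · linear_combination (cweight θ * oddQuot φ) * hw2 + oddQuot φ * cweight_mul_cweight_neg θ
  · rw [chargeEquiv_snd_eq_inner_iff, calculusMatrix_apply, hu₁, map_add]
    simp only [borelFun_eq_opFun]
    congr 1
    · refine hμ.eq_of_cutoff fun n => ?_
      have bc := boundedBorel_cutoff n
      have bci := boundedBorel_cutoff_mul continuous_idFun n
      have h1 : idFun * (cutoff n * (cweight (-θ / 2) * oddPart φ)) =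
          (cutoff n * idFun) * (cweight (-θ / 2) * oddPart φ) := by ring
      have b1 : BoundedBorel (idFun * (cutoff n * (cweight (-θ / 2) * oddPart φ))) := by
        rw [h1]; exact bci.mul (hw.mul bo')
      rw [hμ.mul_apply hw bo', hμ.mul_apply bc (hw.mul bo'),
        hE.apply_map (bc.mul (hw.mul bo')) b1]
      change _ = opFun _ _ (opFun (spectralMeasure ε).measure (cweight (-θ / 2)) p.1)
      rw [hμ.mul_apply b1 hw, hμ.mul_apply bc bo]
      congr 2
      linear_combination (-(idFun * cutoff n * oddPart φ)) * hw2
    · rw [hμ.mul_apply be hw, hμ.mul_apply hw be, mul_comm]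

end ChargeCalculus

section Resolvent

variable {H : Type*} [NormedAddCommGroup H] [InnerProductSpace ℂ H] [CompleteSpace H]
  {ε : H →ₗ.[ℂ] H} {θ : ℝ}

theorem boundedBorel_const (c : ℂ) : BoundedBorel (Function.const ℝ c) :=
  ⟨measurable_const, ‖c‖, fun _ => le_rfl⟩

theorem IsCalculus.const_apply {μ : H → Measure ℝ} (hμ : IsCalculus μ) (c : ℂ) (u : H) :
    opFun μ (Function.const ℝ c) u = c • u := by
  have : Function.const ℝ c = c • 1 := by ext; simp
  rw [this, hμ.smul c BoundedBorel.one, hμ.one]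
  rfl

theorem IsCalculus.add_apply {μ : H → Measure ℝ} (hμ : IsCalculus μ) {f g : ℝ → ℂ}
    (hf : BoundedBorel f) (hg : BoundedBorel g) (u : H) :
    opFun μ (f + g) u = opFun μ f u + opFun μ g u := by
  rw [hμ.add hf hg]
  rfl

theorem boundedBorel_cutoff_graph (θ : ℝ) (n : ℕ) :
    BoundedBorel (cutoff n * (idFun * (idFun * cweight (-θ)))) :=
  boundedBorel_cutoff_mul (continuous_idFun.mul (continuous_idFun.mul (continuous_cweight _))) n

/-- The graph of the free charge operator in the coordinates of `chargeEquiv`. -/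
theorem mem_chargeGraph_iff (hE : (spectralMeasure ε).IsSpectralMeasureOf ε) (hθ0 : 0 ≤ θ)
    (p p' : H × H) : (chargeEquiv ε hθ0 p, chargeEquiv ε hθ0 p') ∈ chargeGraph ε θ ↔
      borelFun ε (cweight (-θ / 2)) p.1 ∈ ε.domain ∧ p.2 = borelFun ε (cweight (-θ)) p'.1 ∧
        ∀ n, borelFun ε (cutoff n) p'.2 =
          borelFun ε (cutoff n * (idFun * (idFun * cweight (-θ)))) p.1 := by
  have hμ := isCalculus_spectralMeasure ε
  have hw := boundedBorel_cweight (s := -θ / 2) (by linarith)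
  have hw2 : cweight (-θ / 2) * cweight (-θ / 2) = cweight (-θ) := by
    rw [cweight_mul, add_halves]
  have h1 : (∀ w : Sobolev ε θ, (chargeEquiv ε hθ0 p).2 w =
      ⟪(w : H), (Sobolev.toH ε θ (chargeEquiv ε hθ0 p').1 : H)⟫_ℂ) ↔
      p.2 = borelFun ε (cweight (-θ)) p'.1 := by
    rw [chargeEquiv_snd_eq_inner_iff, chargeEquiv_fst, borelFun_eq_opFun, hμ.mul_apply hw hw, hw2,
      borelFun_eq_opFun]
  have bc := boundedBorel_cutoff
  have bci : ∀ n, BoundedBorel (idFun * cutoff n) := fun n => by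
    rw [mul_comm]
    exact boundedBorel_cutoff_mul continuous_idFun n
  have bG := boundedBorel_cutoff_graph θ
  -- the form of `h₀` on vectors of bounded energy
  have h2 : ∀ (n : ℕ) (c : H) (h : borelFun ε (cweight (-θ / 2)) p.1 ∈ ε.domain),
      ⟪opFun (spectralMeasure ε).measure (idFun * cutoff n)
        (opFun (spectralMeasure ε).measure (cweight (-θ / 2)) c), ε ⟨_, h⟩⟫_ℂ =
      ⟪c, opFun (spectralMeasure ε).measure (cutoff n * (idFun * (idFun * cweight (-θ)))) p.1⟫_ℂ := by
    intro n c h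
    have hs : star (idFun * cutoff n) = idFun * cutoff n := by
      ext x
      by_cases hx : x ∈ Set.Icc (-n : ℝ) n <;> simp [idFun, cutoff, hx]
    have b1 : BoundedBorel (idFun * (cweight (-θ / 2) * (idFun * cutoff n))) := by
      have := boundedBorel_cutoff_mul
        ((continuous_idFun.mul (continuous_cweight (-θ / 2))).mul continuous_idFun) n
      convert this using 1
      ring
    rw [hμ.inner_apply (bci n), hs, hμ.inner_apply hw, star_cweight, hμ.mul_apply hw (bci n),
      hE.apply_map (hw.mul (bci n)) b1]
    change ⟪c, opFun _ _ (opFun (spectralMeasure ε).measure (cweight (-θ / 2)) p.1)⟫_ℂ = _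
    rw [hμ.mul_apply b1 hw]
    congr 3
    linear_combination (idFun * idFun * cutoff n) * hw2
  constructor
  · rintro ⟨ha, hd, hb⟩
    refine ⟨hd, h1.mp ha, fun n => ext_inner_left ℂ fun d => ?_⟩
    have hs : star (cutoff n) = cutoff n := by
      ext x
      by_cases hx : x ∈ Set.Icc (-n : ℝ) n <;> simp [cutoff, hx]
    have e1 : idFun * (cweight (-θ / 2) * cutoff n) = cweight (-θ / 2) * (idFun * cutoff n) := by
      ring
    have b1 : BoundedBorel (idFun * (cweight (-θ / 2) * cutoff n)) := by
      rw [e1]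
      exact hw.mul (bci n)
    have h3 : Sobolev.toH ε θ (sobolevEquiv ε hθ0 (opFun (spectralMeasure ε).measure (cutoff n) d))
        = opFun (spectralMeasure ε).measure (cweight (-θ / 2) * cutoff n) d := by
      rw [coe_sobolevEquiv, borelFun_eq_opFun, hμ.mul_apply hw (bc n)]
    have h4 := hb (sobolevEquiv ε hθ0 (opFun (spectralMeasure ε).measure (cutoff n) d)) (by
      rw [h3]
      exact hE.mem_domain (hw.mul (bc n)) b1 d)
    simp only [h3] at h4
    rw [chargeEquiv_snd, hμ.inner_apply (bc n), hs, hE.map_apply (hw.mul (bc n)) b1, e1,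
      mul_comm (cweight _), ← hμ.mul_apply (bci n) hw] at h4
    exact h4.trans (h2 n d hd)
  · rintro ⟨hd, ha, hb⟩
    refine ⟨h1.mpr ha, hd, fun w hwd => ?_⟩
    obtain ⟨c, rfl⟩ := (sobolevEquiv ε hθ0).surjective w
    rw [chargeEquiv_snd]
    refine tendsto_nhds_unique (tendsto_const_nhds.inner (hμ.tendsto_cutoff p'.2)) ?_
    refine ((hμ.tendsto_cutoff (ε ⟨_, hwd⟩)).inner tendsto_const_nhds).congr fun n => ?_
    rw [hE.apply_map (bc n) (bci n)]
    exact (h2 n c hd).trans (by rw [← borelFun_eq_opFun, ← hb n, borelFun_eq_opFun])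

theorem chargeGraph_functional (hE : (spectralMeasure ε).IsSpectralMeasureOf ε) (hθ0 : 0 ≤ θ)
    (x : ChargeSpace ε θ × ChargeSpace ε θ) (hx : x ∈ chargeGraph ε θ) (h0 : x.1 = 0) :
    x.2 = 0 := by
  have hμ := isCalculus_spectralMeasure ε
  obtain ⟨u, v⟩ := x
  obtain ⟨p', rfl⟩ := (chargeEquiv ε hθ0).surjective v
  simp only at h0
  rw [h0, ← map_zero (chargeEquiv ε hθ0), mem_chargeGraph_iff hE] at hx
  obtain ⟨-, h1, h2⟩ := hx
  have hw := boundedBorel_cweight (s := -θ) (by linarith)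
  have e1 : p'.1 = 0 := hμ.eq_of_cutoff fun n => by
    have b := boundedBorel_cutoff_mul (continuous_cweight θ) n
    have h3 : cutoff n = (cutoff n * cweight θ) * cweight (-θ) := by
      linear_combination (-cutoff n) * cweight_mul_cweight_neg θ
    rw [h3, ← hμ.mul_apply b hw, ← hμ.mul_apply b hw, ← borelFun_eq_opFun ε (cweight (-θ)), ← h1]
    simp
  have e2 : p'.2 = 0 := hμ.eq_of_cutoff fun n => by
    have := h2 n
    simp only [Prod.fst_zero, map_zero] at this
    rw [← borelFun_eq_opFun, this, map_zero]
  have : p' = 0 := Prod.ext e1 e2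
  simp [this]

theorem mem_graph_chargeOperator_iff (hE : (spectralMeasure ε).IsSpectralMeasureOf ε)
    (hθ0 : 0 ≤ θ) (u v : ChargeSpace ε θ) :
    (u, v) ∈ chargeGraph ε θ ↔ ∃ h : u ∈ (chargeOperator ε θ).domain,
      chargeOperator ε θ ⟨u, h⟩ = v := by
  have h := Submodule.toLinearPMap_graph_eq _ (chargeGraph_functional hE hθ0)
  change (chargeOperator ε θ).graph = _ at h
  rw [← h, LinearPMap.mem_graph_iff]
  constructor
  · rintro ⟨y, hy1, hy2⟩
    simp only at hy1 hy2
    subst hy1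
    exact ⟨y.2, hy2⟩
  · rintro ⟨h, rfl⟩
    exact ⟨⟨u, h⟩, rfl, rfl⟩

/-- The function `x ↦ (x² - z²)⁻¹`. -/
def quadResolvent (z : ℂ) (x : ℝ) : ℂ := ((x : ℂ) ^ 2 - z ^ 2)⁻¹

/-- The function `x ↦ (x - z)⁻¹`. -/
def linResolvent (z : ℂ) (x : ℝ) : ℂ := ((x : ℂ) - z)⁻¹

variable {z : ℂ}

theorem sub_ne_zero_of_im (hz : z.im ≠ 0) (x : ℝ) : (x : ℂ) - z ≠ 0 := fun h => hz (by
  have := congrArg Complex.im h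
  simpa using this)

theorem add_ne_zero_of_im (hz : z.im ≠ 0) (x : ℝ) : (x : ℂ) + z ≠ 0 := fun h => hz (by
  have := congrArg Complex.im h
  simpa using this)

theorem sq_sub_sq_ne_zero (hz : z.im ≠ 0) (x : ℝ) : (x : ℂ) ^ 2 - z ^ 2 ≠ 0 := by
  rw [sq_sub_sq]
  exact mul_ne_zero (add_ne_zero_of_im hz x) (sub_ne_zero_of_im hz x)

theorem evenPart_linResolvent (hz : z.im ≠ 0) :
    evenPart (linResolvent z) = Function.const ℝ z * quadResolvent z := by
  ext x
  have h1 := sub_ne_zero_of_im hz x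
  have h2 := add_ne_zero_of_im hz x
  have h3 := sq_sub_sq_ne_zero hz x
  have h4 : -(x : ℂ) - z ≠ 0 := by
    rw [← neg_add', neg_ne_zero]; exact h2
  simp only [evenPart, linResolvent, quadResolvent, Pi.mul_apply, Function.const_apply,
    Complex.ofReal_neg]
  field_simp
  ring

theorem oddPart_linResolvent (hz : z.im ≠ 0) :
    oddPart (linResolvent z) = idFun * quadResolvent z := by
  ext x
  have h1 := sub_ne_zero_of_im hz x
  have h2 := add_ne_zero_of_im hz x
  have h3 := sq_sub_sq_ne_zero hz x
  have h4 : -(x : ℂ) - z ≠ 0 := by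
    rw [← neg_add', neg_ne_zero]; exact h2
  simp only [oddPart, linResolvent, quadResolvent, Pi.mul_apply, idFun, Complex.ofReal_neg]
  field_simp
  ring

theorem hasDerivAt_linResolvent (hz : z.im ≠ 0) :
    HasDerivAt (linResolvent z) (quadResolvent z 0) 0 := by
  have h1 : HasDerivAt (fun x : ℝ => (x : ℂ) - z) 1 0 :=
    (Complex.ofRealCLM.hasDerivAt (x := 0)).sub_const z
  have h2 := h1.inv (sub_ne_zero_of_im hz 0)
  refine h2.congr_deriv ?_
  have hz0 : z ≠ 0 := fun h => hz (by simp [h])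
  simp [quadResolvent]
  field_simp

theorem oddQuot_linResolvent (hz : z.im ≠ 0) : oddQuot (linResolvent z) = quadResolvent z := by
  ext x
  rcases eq_or_ne x 0 with rfl | hx
  · rw [oddQuot_zero, (hasDerivAt_linResolvent hz).deriv]
  · have : (x : ℂ) ≠ 0 := by exact_mod_cast hx
    rw [oddQuot_of_ne hx, oddPart_linResolvent hz, Pi.mul_apply, idFun]
    field_simp

theorem exists_resolvent_bound (hz : z.im ≠ 0) : ∃ k : ℝ, 1 ≤ k ∧
    ∀ x : ℝ, ‖linResolvent z x‖ ≤ k ∧ ‖quadResolvent z x‖ * (1 + x ^ 2) ≤ k := by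
  have hb : 0 < z.im ^ 2 := by positivity
  set k := 2 + (2 * z.re ^ 2 + 1) / z.im ^ 2 with hk
  have hk2 : 2 ≤ k := by
    have : 0 ≤ (2 * z.re ^ 2 + 1) / z.im ^ 2 := by positivity
    linarith
  have hkb : 2 * z.re ^ 2 + 1 ≤ k * z.im ^ 2 := by
    have : (2 * z.re ^ 2 + 1) / z.im ^ 2 * z.im ^ 2 = 2 * z.re ^ 2 + 1 := by field_simp
    rw [hk, add_mul, this]
    nlinarith
  have h1 : ∀ x : ℝ, 1 + x ^ 2 ≤ k * ‖(x : ℂ) - z‖ ^ 2 := fun x => by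
    rw [Complex.sq_norm, Complex.normSq_apply]
    simp only [Complex.sub_re, Complex.ofReal_re, Complex.sub_im, Complex.ofReal_im]
    nlinarith [sq_nonneg (x - z.re), sq_nonneg (x - 2 * z.re)]
  have h2 : ∀ x : ℝ, 1 + x ^ 2 ≤ k * ‖(x : ℂ) + z‖ ^ 2 := fun x => by
    rw [Complex.sq_norm, Complex.normSq_apply]
    simp only [Complex.add_re, Complex.ofReal_re, Complex.add_im, Complex.ofReal_im]
    nlinarith [sq_nonneg (x + z.re), sq_nonneg (x + 2 * z.re)]
  refine ⟨k, by linarith, fun x => ⟨?_, ?_⟩⟩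
  · have hpos := norm_pos_iff.mpr (sub_ne_zero_of_im hz x)
    rw [linResolvent, norm_inv, inv_le_iff_one_le_mul₀ hpos]
    have h3 := h1 x
    by_contra h
    push Not at h
    have h5 : ‖(x : ℂ) - z‖ ≤ 1 := by nlinarith
    nlinarith [sq_nonneg x]
  · have hpos1 := norm_pos_iff.mpr (sub_ne_zero_of_im hz x)
    have hpos2 := norm_pos_iff.mpr (add_ne_zero_of_im hz x)
    rw [quadResolvent, sq_sub_sq, norm_inv, norm_mul, inv_mul_le_iff₀ (by positivity)]
    refine le_of_sq_le_sq ?_ (by positivity)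
    have := mul_le_mul (h2 x) (h1 x) (by positivity) (by positivity)
    nlinarith

theorem linResolvent_mem_LambdaDiff (hθ0 : 0 ≤ θ) (hθ1 : θ ≤ 1 / 2) (hz : z.im ≠ 0) :
    linResolvent z ∈ LambdaDiff θ := by
  obtain ⟨k, hk1, hk⟩ := exists_resolvent_bound hz
  refine ⟨⟨?_, (normLambdaTheta_lt_top_iff θ _).mpr ⟨k, fun x => ⟨(hk x).1, fun _ => ?_, ?_⟩⟩⟩,
    (hasDerivAt_linResolvent hz).differentiableAt⟩
  · unfold linResolvent
    exact (Complex.measurable_ofReal.sub_const z).inv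
  · rcases eq_or_ne x 0 with rfl | hx
    · simp only [Complex.ofReal_zero, div_zero, norm_zero]
      linarith
    · rw [← oddQuot_of_ne hx, oddQuot_linResolvent hz]
      refine le_trans ?_ (hk x).2
      exact le_mul_of_one_le_right (norm_nonneg _) (by nlinarith [sq_nonneg x])
  · rw [oddPart_linResolvent hz, Pi.mul_apply, norm_mul, idFun, Complex.norm_real,
      Real.norm_eq_abs]
    have h1 : (1 : ℝ) ≤ √(1 + x ^ 2) := Real.one_le_sqrt.mpr (by nlinarith [sq_nonneg x])
    have h2 : √(1 + x ^ 2) ^ |4 * θ - 1| ≤ √(1 + x ^ 2) := by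
      have := Real.rpow_le_rpow_of_exponent_le h1
        (abs_le.mpr ⟨by linarith, by linarith⟩ : |4 * θ - 1| ≤ 1)
      rwa [Real.rpow_one] at this
    have h3 : |x| ≤ √(1 + x ^ 2) := Real.le_sqrt_of_sq_le (by rw [sq_abs]; linarith)
    have h4 : √(1 + x ^ 2) * √(1 + x ^ 2) = 1 + x ^ 2 := Real.mul_self_sqrt (by positivity)
    refine le_trans ?_ (hk x).2
    rw [mul_comm |x|, mul_assoc]
    refine mul_le_mul_of_nonneg_left ?_ (norm_nonneg _)
    exact (mul_le_mul h3 h2 (by positivity) (by positivity)).trans_eq h4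

end Resolvent

section ResolventOfChargeOperator

variable {H : Type*} [NormedAddCommGroup H] [InnerProductSpace ℂ H] [CompleteSpace H]
  {ε : H →ₗ.[ℂ] H} {θ : ℝ} {z : ℂ}

theorem idFun_sq_mul_quadResolvent (hz : z.im ≠ 0) : idFun * (idFun * quadResolvent z) =
    1 + Function.const ℝ z * (Function.const ℝ z * quadResolvent z) := by
  ext x
  have := sq_sub_sq_ne_zero hz x
  simp only [Pi.mul_apply, Pi.add_apply, Pi.one_apply, Function.const_apply, idFun, quadResolvent]
  field_simp
  ring

theorem measurable_quadResolvent (z : ℂ) : Measurable (quadResolvent z) := by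
  unfold quadResolvent
  exact ((Complex.measurable_ofReal.pow_const 2).sub_const _).inv

theorem boundedBorel_quadResolvent (hz : z.im ≠ 0) : BoundedBorel (quadResolvent z) := by
  obtain ⟨k, -, hk⟩ := exists_resolvent_bound hz
  refine ⟨measurable_quadResolvent z, k, fun x => le_trans ?_ (hk x).2⟩
  exact le_mul_of_one_le_right (norm_nonneg _) (by nlinarith [sq_nonneg x])

theorem weight_half_le (hθ0 : 0 ≤ θ) (hθ1 : θ ≤ 1 / 2) (x : ℝ) :
    weight (θ / 2) x ≤ √(1 + x ^ 2) := by
  calc weight (θ / 2) x ≤ ((1 + x ^ 2) ^ 2) ^ (θ / 2) :=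
        Real.rpow_le_rpow (by positivity) (by nlinarith [sq_nonneg x]) (by linarith)
    _ = (1 + x ^ 2) ^ θ := by
        rw [← Real.rpow_natCast, ← Real.rpow_mul (by positivity)]
        congr 1
        push_cast
        ring
    _ ≤ (1 + x ^ 2) ^ (1 / 2 : ℝ) :=
        Real.rpow_le_rpow_of_exponent_le (by nlinarith [sq_nonneg x]) hθ1
    _ = √(1 + x ^ 2) := (Real.sqrt_eq_rpow _).symm

theorem boundedBorel_idFun_cweight_quadResolvent (hθ0 : 0 ≤ θ) (hθ1 : θ ≤ 1 / 2)
    (hz : z.im ≠ 0) : BoundedBorel (idFun * (cweight (θ / 2) * quadResolvent z)) := by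
  obtain ⟨k, -, hk⟩ := exists_resolvent_bound hz
  refine ⟨continuous_idFun.measurable.mul
    ((continuous_cweight _).measurable.mul (measurable_quadResolvent z)), k,
    fun x => le_trans ?_ (hk x).2⟩
  rw [Pi.mul_apply, Pi.mul_apply, norm_mul, norm_mul, norm_cweight, idFun, Complex.norm_real,
    Real.norm_eq_abs, ← mul_assoc, mul_comm]
  refine mul_le_mul_of_nonneg_left ?_ (norm_nonneg _)
  have h3 : |x| ≤ √(1 + x ^ 2) := Real.le_sqrt_of_sq_le (by rw [sq_abs]; linarith)
  exact (mul_le_mul h3 (weight_half_le hθ0 hθ1 x) (weight_pos _ _).le (by positivity)).trans_eq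
    (Real.mul_self_sqrt (by positivity))

theorem isResolventAt_chargeFun (hE : (spectralMeasure ε).IsSpectralMeasureOf ε)
    (hθ0 : 0 ≤ θ) (hθ1 : θ ≤ 1 / 2) (hz : z.im ≠ 0) :
    IsResolventAt (chargeOperator ε θ) z (chargeFun ε hθ0 (linResolvent z)) := by
  have hμ := isCalculus_spectralMeasure ε
  have hΛ : linResolvent z ∈ Lambda θ := (linResolvent_mem_LambdaDiff hθ0 hθ1 hz).1
  have hq := boundedBorel_quadResolvent hz
  have hC := boundedBorel_const z
  have hCq := hC.mul hq
  have hωq := boundedBorel_cweight_oddQuot hθ0 hθ1 hΛ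
  have hE3 := boundedBorel_cweight_oddPart hθ0 hΛ
  have hw := boundedBorel_cweight (s := -θ / 2) (by linarith)
  have hω' := boundedBorel_cweight (s := -θ) (by linarith)
  have bc := boundedBorel_cutoff
  have bG := boundedBorel_cutoff_graph θ
  rw [oddQuot_linResolvent hz] at hωq
  rw [oddPart_linResolvent hz] at hE3
  have hωω := cweight_mul_cweight_neg θ
  have hid := idFun_sq_mul_quadResolvent hz
  have hm : ∀ p : H × H, calculusMatrix ε θ (linResolvent z) p =
      (opFun (spectralMeasure ε).measure (Function.const ℝ z * quadResolvent z) p.1 +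
        opFun (spectralMeasure ε).measure (cweight θ * quadResolvent z) p.2,
      opFun (spectralMeasure ε).measure (cweight (-θ) * (idFun * (idFun * quadResolvent z))) p.1 +
        opFun (spectralMeasure ε).measure (Function.const ℝ z * quadResolvent z) p.2) := by
    intro p
    rw [calculusMatrix_apply, evenPart_linResolvent hz, oddPart_linResolvent hz,
      oddQuot_linResolvent hz]
    rfl
  set μ := (spectralMeasure ε).measure with hμdef
  constructor
  · intro y
    obtain ⟨⟨a, b⟩, rfl⟩ := (chargeEquiv ε hθ0).surjective y
    have hmem : (chargeEquiv ε hθ0 (calculusMatrix ε θ (linResolvent z) (a, b)),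
        chargeEquiv ε hθ0 ((a, b) + z • calculusMatrix ε θ (linResolvent z) (a, b))) ∈
          chargeGraph ε θ := by
      rw [mem_chargeGraph_iff hE, hm]
      simp only [borelFun_eq_opFun, ← hμdef, Prod.fst_add, Prod.snd_add, Prod.smul_fst,
        Prod.smul_snd, map_add, ← hμ.const_apply z]
      refine ⟨?_, ?_, fun n => ?_⟩
      · have hi := boundedBorel_idFun_cweight_quadResolvent hθ0 hθ1 hz
        rw [hμ.mul_apply hw hCq, hμ.mul_apply hw hωq]
        refine ε.domain.add_mem (hE.mem_domain (hw.mul hCq) ?_ a)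
          (hE.mem_domain (hw.mul hωq) ?_ b)
        · have h1 : cweight (-θ / 2) = cweight (-θ) * cweight (θ / 2) := by
            rw [cweight_mul]
            congr 1
            ring
          have h2 : idFun * (cweight (-θ / 2) * (Function.const ℝ z * quadResolvent z)) =
              (cweight (-θ) * Function.const ℝ z) *
                (idFun * (cweight (θ / 2) * quadResolvent z)) := by
            rw [h1]
            ring
          rw [h2]
          exact (hω'.mul hC).mul hi
        · have h1 : cweight (-θ / 2) * cweight θ = cweight (θ / 2) := by
            rw [cweight_mul]
            congr 1
            ring
          have h2 : idFun * (cweight (-θ / 2) * (cweight θ * quadResolvent z)) =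
              idFun * (cweight (θ / 2) * quadResolvent z) := by
            rw [← h1]
            ring
          rw [h2]
          exact hi
      · rw [hμ.mul_apply hC hCq, hμ.mul_apply hC hωq, hμ.mul_apply hω' (hC.mul hCq),
          hμ.mul_apply hω' (hC.mul hωq), ← add_assoc, ← hμ.add_apply hω' (hω'.mul (hC.mul hCq))]
        congr 3
        · linear_combination cweight (-θ) * hid
        · linear_combination (-(Function.const ℝ z * quadResolvent z)) * hωω
      · rw [hμ.mul_apply hC hE3, hμ.mul_apply hC hCq, hμ.mul_apply (bc n) (hC.mul hE3),
          hμ.mul_apply (bc n) (hC.mul hCq), hμ.mul_apply (bG n) hCq, hμ.mul_apply (bG n) hωq,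
          add_left_comm, ← hμ.add_apply (bc n) ((bc n).mul (hC.mul hCq))]
        congr 3
        · ring
        · linear_combination (-cutoff n) * hid - (cutoff n * idFun * idFun * quadResolvent z) * hωω
    obtain ⟨h, h'⟩ := (mem_graph_chargeOperator_iff hE hθ0 _ _).mp hmem
    simp only [chargeFun_apply]
    refine ⟨h, ?_⟩
    rw [h', map_add, map_smul, add_sub_cancel_right]
  · intro u
    have hmem := (mem_graph_chargeOperator_iff hE hθ0 (u : ChargeSpace ε θ)
      (chargeOperator ε θ u)).mpr ⟨u.2, rfl⟩
    obtain ⟨⟨a, b⟩, hp⟩ := (chargeEquiv ε hθ0).surjective (u : ChargeSpace ε θ)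
    obtain ⟨⟨a', b'⟩, hp'⟩ := (chargeEquiv ε hθ0).surjective (chargeOperator ε θ u)
    rw [← hp, ← hp', mem_chargeGraph_iff hE] at hmem
    obtain ⟨-, hb, hb'⟩ := hmem
    simp only [borelFun_eq_opFun, ← hμdef] at hb hb'
    rw [← hp, ← hp', ← map_smul, ← map_sub, chargeFun_apply, hm]
    congr 1
    simp only [Prod.fst_sub, Prod.snd_sub, Prod.smul_fst, Prod.smul_snd, map_sub,
      ← hμ.const_apply z]
    refine Prod.ext (hμ.eq_of_cutoff fun n => ?_) (hμ.eq_of_cutoff fun n => ?_)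
    · have e1 : opFun μ (cweight θ * quadResolvent z) (opFun μ (Function.const ℝ z) b) =
          opFun μ (Function.const ℝ z * quadResolvent z) a' := by
        rw [hb, hμ.mul_apply hC hω', hμ.mul_apply hωq (hC.mul hω')]
        congr 2
        linear_combination (Function.const ℝ z * quadResolvent z) * hωω
      have e2 : opFun μ (cutoff n) (opFun μ (cweight θ * quadResolvent z) b') =
          opFun μ (cutoff n * (idFun * (idFun * quadResolvent z))) a := by
        rw [hμ.mul_apply (bc n) hωq, mul_comm, ← hμ.mul_apply hωq (bc n), hb',
          hμ.mul_apply hωq (bG n)]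
        congr 2
        linear_combination (cutoff n * idFun * idFun * quadResolvent z) * hωω
      have e3 : opFun μ (cutoff n * (idFun * (idFun * quadResolvent z))) a =
          opFun μ (cutoff n) a + opFun μ (cutoff n)
            (opFun μ (Function.const ℝ z * quadResolvent z) (opFun μ (Function.const ℝ z) a)) := by
        rw [hμ.mul_apply hCq hC, hμ.mul_apply (bc n) (hCq.mul hC),
          ← hμ.add_apply (bc n) ((bc n).mul (hCq.mul hC))]
        congr 2
        linear_combination cutoff n * hid
      rw [e1, map_add, map_sub, map_sub, e2, e3]
      abel
    · have hii : BoundedBorel (idFun * (idFun * quadResolvent z)) := by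
        rw [hid]
        exact BoundedBorel.one.add (hC.mul hCq)
      have e1 : opFun μ (cweight (-θ) * (idFun * (idFun * quadResolvent z))) a' =
          b + opFun μ (Function.const ℝ z * quadResolvent z) (opFun μ (Function.const ℝ z) b) := by
        rw [mul_comm (cweight (-θ)), ← hμ.mul_apply hii hω', ← hb, hid,
          hμ.add_apply BoundedBorel.one (hC.mul hCq), hμ.one, hμ.mul_apply hCq hC, mul_comm]
        rfl
      have e2 : opFun μ (cutoff n) (opFun μ (Function.const ℝ z * quadResolvent z) b') =
          opFun μ (cutoff n) (opFun μ (cweight (-θ) * (idFun * (idFun * quadResolvent z)))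
            (opFun μ (Function.const ℝ z) a)) := by
        rw [hμ.mul_apply (bc n) hCq, mul_comm, ← hμ.mul_apply hCq (bc n), hb',
          hμ.mul_apply hCq (bG n), hμ.mul_apply hE3 hC, hμ.mul_apply (bc n) (hE3.mul hC)]
        congr 2
        ring
      rw [e1, map_add, map_sub, map_sub, map_add, e2]
      abel

end ResolventOfChargeOperator

section Existence

variable {H : Type*} [NormedAddCommGroup H] [InnerProductSpace ℂ H] [CompleteSpace H]
  {ε : H →ₗ.[ℂ] H} {θ : ℝ}

/-- The functional calculus on an algebra of functions that are regular at `0`. -/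
def chargeCalculus (hθ0 : 0 ≤ θ) (hθ1 : θ ≤ 1 / 2) {A : Subalgebra ℂ (ℝ → ℂ)}
    (hA : A ≤ Lambda θ) (hreg : ∀ φ ∈ A, RegularAtZero ε φ) :
    A →ₗ[ℂ] (ChargeSpace ε θ →L[ℂ] ChargeSpace ε θ) where
  toFun φ := chargeFun ε hθ0 φ
  map_add' φ χ := by
    have := calculusMatrix_add ε hθ0 hθ1 (hA φ.2) (hA χ.2) (hreg φ φ.2) (hreg χ χ.2)
    refine ContinuousLinearMap.ext fun u => ?_
    simp [chargeFun, this]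
  map_smul' c φ := by
    have := calculusMatrix_smul ε hθ0 hθ1 (hA φ.2) c
    refine ContinuousLinearMap.ext fun u => ?_
    simp [chargeFun, this]

theorem exists_chargeCalculus (hE : (spectralMeasure ε).IsSpectralMeasureOf ε)
    (hθ0 : 0 ≤ θ) (hθ1 : θ ≤ 1 / 2) {A : Subalgebra ℂ (ℝ → ℂ)}
    (hA : A ≤ Lambda θ) (hA' : LambdaDiff θ ≤ A) (hreg : ∀ φ ∈ A, RegularAtZero ε φ)
    {conv : (ℕ → ℝ → ℂ) → (ℝ → ℂ) → Prop} (hconv : ∀ φn φ, conv φn φ → PtConv φn φ ∧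
      (Tendsto (fun n => oddQuot (φn n) 0) atTop (𝓝 (oddQuot φ 0)) ∨
        ∀ u, (spectralMeasure ε).measure u {0} = 0)) :
    ∃ F : A →ₗ[ℂ] (ChargeSpace ε θ →L[ℂ] ChargeSpace ε θ),
      IsBorelCalculus ε θ A conv F ∧ (F 1 = 1 ∧ ∀ φ χ, F (φ * χ) = F φ * F χ) ∧
      (∀ φ : A, HasMatrix ε θ φ (F φ)) ∧
      ∃ C : ℝ, 0 ≤ C ∧ ∀ φ, ‖F φ‖ ≤ C * (normLambdaTheta θ φ).toReal := by
  refine ⟨chargeCalculus hθ0 hθ1 hA hreg, ⟨fun z hz => ?_, ?_⟩, ⟨?_, fun φ χ => ?_⟩,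
    fun φ => hasMatrix_chargeFun ε hE hθ0 hθ1 (hA φ.2),
    ‖(chargeEquiv ε hθ0).toContinuousLinearMap‖ *
      (3 * ‖(chargeEquiv ε hθ0).symm.toContinuousLinearMap‖), by positivity, fun φ => ?_⟩
  · exact ⟨hA' (linResolvent_mem_LambdaDiff hθ0 hθ1 hz), isResolventAt_chargeFun hE hθ0 hθ1 hz⟩
  · rintro φn φ ⟨M, hM⟩ h u ℓ
    obtain ⟨h1, h2⟩ := hconv _ _ h
    have h3 := tendsto_calculusMatrix ε hθ0 hθ1 (fun n => hA (φn n).2) (hA φ.2) hM h1 h2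
      ((chargeEquiv ε hθ0).symm u)
    exact ((ℓ.continuous.comp (chargeEquiv ε hθ0).continuous).tendsto _).comp h3
  · have := calculusMatrix_one ε (θ := θ)
    refine ContinuousLinearMap.ext fun u => ?_
    change chargeFun ε hθ0 1 u = u
    simp [chargeFun, this]
  · have := calculusMatrix_mul ε hθ0 hθ1 (hA φ.2) (hA χ.2) (hreg φ φ.2) (hreg χ χ.2)
    refine ContinuousLinearMap.ext fun u => ?_
    change chargeFun ε hθ0 (φ * χ : ℝ → ℂ) u = chargeFun ε hθ0 φ (chargeFun ε hθ0 χ u)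
    simp [chargeFun, this]
  · have hlt := (hA φ.2).2
    have h1 := norm_calculusMatrix_le ε hθ0 hθ1 (hA φ.2).1
      (M := (normLambdaTheta θ φ).toNNReal) (ENNReal.coe_toNNReal hlt.ne).ge
    change ‖chargeFun ε hθ0 φ‖ ≤ _
    refine (ContinuousLinearMap.opNorm_comp_le _ _).trans ?_
    rw [mul_assoc]
    refine mul_le_mul_of_nonneg_left ?_ (norm_nonneg _)
    refine (ContinuousLinearMap.opNorm_comp_le _ _).trans ?_
    refine (mul_le_mul_of_nonneg_right h1 (norm_nonneg _)).trans_eq ?_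
    rw [ENNReal.coe_toNNReal_eq_toReal]
    ring

end Existence

section Density

variable {θ : ℝ}

theorem normLambdaTheta_le {φ : ℝ → ℂ} {K : ℝ≥0} (h1 : ∀ x, ‖φ x‖ ≤ K)
    (h2 : ∀ x : ℝ, ‖oddPart φ x / (x : ℂ)‖ ≤ K)
    (h3 : ∀ x, ‖oddPart φ x‖ * √(1 + x ^ 2) ^ |4 * θ - 1| ≤ K) :
    normLambdaTheta θ φ ≤ (4 * K : ℝ≥0) := by
  have key : ∀ y : ℂ, ‖y‖ ≤ K → ‖y‖ₑ ≤ K := fun y hy => by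
    rw [← ofReal_norm]
    exact (ENNReal.ofReal_le_ofReal hy).trans (by simp)
  have e1 : (⨆ x : ℝ, ‖φ x‖ₑ) ≤ K := iSup_le fun x => key _ (h1 x)
  have e2 : (⨆ x : ℝ, ⨆ _ : 0 ≤ x, ‖oddPart φ x / (x : ℂ)‖ₑ) ≤ K :=
    iSup₂_le fun x _ => key _ (h2 x)
  have e3 : (⨆ x : ℝ, ‖oddPart φ x‖ₑ * ENNReal.ofReal (√(1 + x ^ 2) ^ |4 * θ - 1|)) ≤ K :=
    iSup_le fun x => by
      rw [← ofReal_norm, ← ENNReal.ofReal_mul (norm_nonneg _)]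
      exact (ENNReal.ofReal_le_ofReal (h3 x)).trans (by simp)
  refine (add_le_add (add_le_add (add_le_add e1 e2) e2) e3).trans (le_of_eq ?_)
  push_cast
  ring

/-- The factor `1` of the even functions and the factor `x` of the odd functions. -/
def parityFactor (odd : Bool) : ℝ → ℂ := if odd then idFun else 1

/-- The weight that controls the norm of `Λ_θ` on the even and on the odd functions. -/
def parityWeight (θ : ℝ) (odd : Bool) (x : ℝ) : ℝ :=
  if odd then 1 + |x| * √(1 + x ^ 2) ^ |4 * θ - 1| else 1

theorem one_le_parityWeight (θ : ℝ) (o : Bool) (x : ℝ) : 1 ≤ parityWeight θ o x := by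
  cases o
  · simp [parityWeight]
  · simp only [parityWeight, if_true]
    have : 0 ≤ |x| * √(1 + x ^ 2) ^ |4 * θ - 1| := by positivity
    linarith

theorem parityWeight_le (hθ0 : 0 ≤ θ) (hθ1 : θ ≤ 1 / 2) (o : Bool) (x : ℝ) :
    parityWeight θ o x ≤ 2 * (1 + x ^ 2) := by
  cases o
  · simp only [parityWeight, Bool.false_eq_true, if_false]
    nlinarith [sq_nonneg x]
  · simp only [parityWeight, if_true]
    have h1 : (1 : ℝ) ≤ √(1 + x ^ 2) := Real.one_le_sqrt.mpr (by nlinarith [sq_nonneg x])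
    have h2 : √(1 + x ^ 2) ^ |4 * θ - 1| ≤ √(1 + x ^ 2) := by
      have := Real.rpow_le_rpow_of_exponent_le h1
        (abs_le.mpr ⟨by linarith, by linarith⟩ : |4 * θ - 1| ≤ 1)
      rwa [Real.rpow_one] at this
    have h3 : |x| ≤ √(1 + x ^ 2) := Real.le_sqrt_of_sq_le (by rw [sq_abs]; linarith)
    have h4 := (mul_le_mul h3 h2 (by positivity) (by positivity)).trans_eq
      (Real.mul_self_sqrt (by positivity : 0 ≤ 1 + x ^ 2))
    nlinarith [sq_nonneg x]

theorem oddPart_of_even {g : ℝ → ℂ} (hg : ∀ x, g (-x) = g x) (x : ℝ) : oddPart g x = 0 := by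
  simp [oddPart, hg]

theorem oddPart_idFun_mul {g : ℝ → ℂ} (hg : ∀ x, g (-x) = g x) (x : ℝ) :
    oddPart (idFun * g) x = x * g x := by
  simp only [oddPart, Pi.mul_apply, idFun, hg, Complex.ofReal_neg]
  ring

theorem normLambdaTheta_parity_le {o : Bool} {g : ℝ → ℂ} (hg : ∀ x, g (-x) = g x) {K : ℝ≥0}
    (hK : ∀ x, ‖g x‖ * parityWeight θ o x ≤ K) :
    normLambdaTheta θ (parityFactor o * g) ≤ (4 * K : ℝ≥0) := by
  have hgK : ∀ x, ‖g x‖ ≤ K := fun x =>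
    (le_mul_of_one_le_right (norm_nonneg _) (one_le_parityWeight θ o x)).trans (hK x)
  cases o
  · simp only [parityFactor, Bool.false_eq_true, if_false, one_mul]
    exact normLambdaTheta_le hgK (fun x => by simp [oddPart_of_even hg])
      fun x => by simp [oddPart_of_even hg]
  · simp only [parityFactor, if_true]
    have hx : ∀ x : ℝ, ‖(x : ℂ) * g x‖ * √(1 + x ^ 2) ^ |4 * θ - 1| ≤ K := fun x => by
      refine le_trans ?_ (hK x)
      simp only [parityWeight, if_true]
      rw [norm_mul, Complex.norm_real, Real.norm_eq_abs]
      have := norm_nonneg (g x)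
      nlinarith
    refine normLambdaTheta_le (fun x => ?_) (fun x => ?_) fun x => ?_
    · refine le_trans (le_mul_of_one_le_right (norm_nonneg _) (Real.one_le_rpow ?_
        (abs_nonneg (4 * θ - 1)))) (hx x)
      exact Real.one_le_sqrt.mpr (by nlinarith [sq_nonneg x])
    · rw [oddPart_idFun_mul hg]
      rcases eq_or_ne x 0 with rfl | h0
      · simp
      · have : (x : ℂ) ≠ 0 := by exact_mod_cast h0
        rw [mul_div_cancel_left₀ _ this]
        exact hgK x
    · rw [oddPart_idFun_mul hg]
      exact hx x

theorem deriv_zero_of_even {g : ℝ → ℂ} (hg : ∀ x, g (-x) = g x) : deriv g 0 = 0 := by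
  have h1 : (fun x => g (-x)) = g := funext hg
  have h2 := deriv_comp_neg g 0
  rw [h1, neg_zero] at h2
  linear_combination h2 / 2

theorem hasDerivAt_idFun_mul {g : ℝ → ℂ} (hc : ContinuousAt g 0) :
    HasDerivAt (idFun * g) (g 0) 0 := by
  rw [hasDerivAt_iff_tendsto_slope]
  refine (hc.tendsto.mono_left nhdsWithin_le_nhds).congr' ?_
  filter_upwards [self_mem_nhdsWithin] with x hx
  have : (x : ℂ) ≠ 0 := by exact_mod_cast hx
  simp [slope_def_module, idFun, this]

theorem oddQuot_parity {o : Bool} {g : ℝ → ℂ} (hg : ∀ x, g (-x) = g x) (hc : ContinuousAt g 0)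
    (x : ℝ) : oddQuot (parityFactor o * g) x = if o then g x else 0 := by
  cases o
  · simp only [parityFactor, Bool.false_eq_true, if_false, one_mul]
    rcases eq_or_ne x 0 with rfl | hx
    · rw [oddQuot_zero, deriv_zero_of_even hg]
    · rw [oddQuot_of_ne hx, oddPart_of_even hg, zero_div]
  · simp only [parityFactor, if_true]
    rcases eq_or_ne x 0 with rfl | hx
    · rw [oddQuot_zero, (hasDerivAt_idFun_mul hc).deriv]
    · have : (x : ℂ) ≠ 0 := by exact_mod_cast hx
      rw [oddQuot_of_ne hx, oddPart_idFun_mul hg, mul_div_cancel_left₀ _ this]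

/-- The even functions `g` such that `g` or `x g(x)` is a function of `Λ_θ` of controlled norm
which is differentiable at `0`. -/
structure Admissible (θ : ℝ) (o : Bool) (K : ℝ≥0) (g : ℝ → ℂ) : Prop where
  measurable : Measurable g
  even : ∀ x, g (-x) = g x
  le : ∀ x, ‖g x‖ * parityWeight θ o x ≤ K
  differentiableAt : DifferentiableAt ℝ g 0

theorem Admissible.mem {o : Bool} {K : ℝ≥0} {g : ℝ → ℂ} (hg : Admissible θ o K g) :
    parityFactor o * g ∈ LambdaDiff θ := by
  have hm : Measurable (parityFactor o) ∧ DifferentiableAt ℝ (parityFactor o) 0 := by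
    cases o
    · simp only [parityFactor, Bool.false_eq_true, if_false]
      exact ⟨measurable_one, differentiableAt_const (1 : ℂ)⟩
    · simp only [parityFactor, if_true]
      exact ⟨continuous_idFun.measurable, Complex.ofRealCLM.differentiableAt⟩
  exact ⟨⟨hm.1.mul hg.measurable, (normLambdaTheta_parity_le hg.even hg.le).trans_lt
    ENNReal.coe_lt_top⟩, hm.2.mul hg.differentiableAt⟩

/-- A linear space of functions in `Λ_θ` which contains the resolvent functions and is closed
under the limits of bounded sequences. -/
structure IsCalculusClosed (θ : ℝ) (N : (ℝ → ℂ) → Prop) : Prop where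
  add : ∀ φ χ, N φ → N χ → N (φ + χ)
  smul : ∀ (c : ℂ) φ, N φ → N (c • φ)
  lim : ∀ (φn : ℕ → ℝ → ℂ) (φ : ℝ → ℂ) (M : ℝ≥0), (∀ n, N (φn n)) →
    (∀ n, φn n ∈ LambdaDiff θ) → φ ∈ LambdaDiff θ →
    (∀ n, normLambdaTheta θ (φn n) ≤ M) → PtConvDiff φn φ → N φ
  resolvent : ∀ z : ℂ, z.im ≠ 0 → N (linResolvent z)

namespace IsCalculusClosed

variable {N : (ℝ → ℂ) → Prop} (hN : IsCalculusClosed θ N) {o : Bool}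
include hN

theorem parity_lim {gn : ℕ → ℝ → ℂ} {g : ℝ → ℂ} {K : ℝ≥0} (hgn : ∀ n, Admissible θ o K (gn n))
    (hg : parityFactor o * g ∈ LambdaDiff θ) (he : ∀ x, g (-x) = g x) (hc : ContinuousAt g 0)
    (h : PtConv gn g) (hn : ∀ n, N (parityFactor o * gn n)) : N (parityFactor o * g) := by
  refine hN.lim (fun n => parityFactor o * gn n) _ (4 * K) hn (fun n => (hgn n).mem) hg
    (fun n => normLambdaTheta_parity_le (hgn n).even (hgn n).le)
    ⟨fun x => (h x).const_mul _, fun x => ?_⟩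
  simp only [oddQuot_parity (hgn _).even (hgn _).differentiableAt.continuousAt,
    oddQuot_parity he hc]
  cases o
  · simp
  · simpa using h x

theorem parity_quad {d : ℝ} (hd : 0 < d) :
    N (parityFactor o * fun x : ℝ => ((d : ℂ) + (x : ℂ) ^ 2)⁻¹) := by
  have hs : 0 < √d := Real.sqrt_pos.mpr hd
  set z : ℂ := Complex.I * (√d : ℝ) with hz
  have him : z.im ≠ 0 := by simp [hz, hs.ne']
  have him' : (-z).im ≠ 0 := by simpa using him
  have hz0 : z ≠ 0 := fun h => him (by simp [h])
  have hz2 : z ^ 2 = -(d : ℂ) := by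
    rw [hz, mul_pow, Complex.I_sq, ← Complex.ofReal_pow, Real.sq_sqrt hd.le]
    ring
  have h1 := hN.resolvent z him
  have h2 := hN.resolvent (-z) him'
  have hq : ∀ x : ℝ, ((d : ℂ) + (x : ℂ) ^ 2)⁻¹ = ((x : ℂ) ^ 2 - z ^ 2)⁻¹ := fun x => by
    rw [hz2]
    congr 1
    ring
  cases o
  · have := hN.smul (1 / (2 * z)) _ (hN.add _ _ h1 (hN.smul (-1) _ h2))
    convert this using 1
    ext x
    have e1 := sub_ne_zero_of_im him x
    have e2 := add_ne_zero_of_im him x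
    have e3 := sq_sub_sq_ne_zero him x
    simp only [parityFactor, Bool.false_eq_true, if_false, one_mul, hq, Pi.smul_apply,
      Pi.add_apply, linResolvent, smul_eq_mul, sub_neg_eq_add]
    field_simp
    ring
  · have := hN.smul (1 / 2) _ (hN.add _ _ h1 h2)
    convert this using 1
    ext x
    have e1 := sub_ne_zero_of_im him x
    have e2 := add_ne_zero_of_im him x
    have e3 := sq_sub_sq_ne_zero him x
    simp only [parityFactor, if_true, Pi.mul_apply, idFun, hq, Pi.smul_apply,
      Pi.add_apply, linResolvent, smul_eq_mul, sub_neg_eq_add]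
    field_simp
    ring

end IsCalculusClosed

/-- The variable `1 / (1 + x²)` of the even functions. -/
def evenVar (x : ℝ) : ℝ := (1 + x ^ 2)⁻¹

theorem evenVar_pos (x : ℝ) : 0 < evenVar x := by unfold evenVar; positivity

theorem evenVar_le_one (x : ℝ) : evenVar x ≤ 1 := inv_le_one_of_one_le₀ (by nlinarith [sq_nonneg x])

theorem evenVar_neg (x : ℝ) : evenVar (-x) = evenVar x := by simp [evenVar]

theorem continuous_evenVar : Continuous evenVar := by
  unfold evenVar
  exact Continuous.inv₀ (by fun_prop) fun x => by positivity

theorem evenVar_zero : evenVar 0 = 1 := by simp [evenVar]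

theorem differentiable_evenVar : Differentiable ℝ evenVar := by
  unfold evenVar
  exact Differentiable.inv (by fun_prop) fun x => by positivity

theorem evenVar_mul_parityWeight_le (hθ0 : 0 ≤ θ) (hθ1 : θ ≤ 1 / 2) (o : Bool) (x : ℝ) :
    evenVar x * parityWeight θ o x ≤ 2 := by
  have h := parityWeight_le hθ0 hθ1 o x
  rw [evenVar, inv_mul_le_iff₀ (by positivity)]
  linarith

/-- The function `x ↦ y h(y)` with `y = 1 / (1 + x²)`. -/
def ofEvenVar (h : ℝ → ℂ) (x : ℝ) : ℂ := evenVar x * h (evenVar x)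

theorem admissible_ofEvenVar (hθ0 : 0 ≤ θ) (hθ1 : θ ≤ 1 / 2) (o : Bool) {h : ℝ → ℂ}
    (hm : Measurable h) {K : ℝ≥0} (hK : ∀ y ∈ Set.Icc (0 : ℝ) 1, ‖h y‖ ≤ K)
    (hd : DifferentiableAt ℝ (fun x => h (evenVar x)) 0) :
    Admissible θ o (2 * K) (ofEvenVar h) where
  measurable := (Complex.measurable_ofReal.comp continuous_evenVar.measurable).mul
    (hm.comp continuous_evenVar.measurable)
  even x := by simp only [ofEvenVar, evenVar_neg]
  le x := by
    rw [ofEvenVar, norm_mul, Complex.norm_real, Real.norm_of_nonneg (evenVar_pos x).le,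
      mul_right_comm]
    push_cast
    exact mul_le_mul (evenVar_mul_parityWeight_le hθ0 hθ1 o x)
      (hK _ ⟨(evenVar_pos x).le, evenVar_le_one x⟩) (norm_nonneg _) (by norm_num)
  differentiableAt :=
    (Complex.ofRealCLM.differentiableAt.comp 0 (differentiable_evenVar 0)).mul hd

namespace IsCalculusClosed

variable {N : (ℝ → ℂ) → Prop} (hN : IsCalculusClosed θ N) (hθ0 : 0 ≤ θ) (hθ1 : θ ≤ 1 / 2)
  {o : Bool}
include hN hθ0 hθ1

theorem parity_pow (n : ℕ) : (∀ d : ℝ, 0 < d → d ≠ 1 → N (parityFactor o *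
      fun x : ℝ => (evenVar x : ℂ) ^ n * ((d : ℂ) + (x : ℂ) ^ 2)⁻¹)) ∧
    N (parityFactor o * fun x : ℝ => (evenVar x : ℂ) ^ (n + 1)) := by
  have hden : ∀ {d : ℝ}, 0 < d → ∀ x : ℝ, (d : ℂ) + (x : ℂ) ^ 2 ≠ 0 := fun {d} hd x => by
    have : (0 : ℝ) < d + x ^ 2 := by positivity
    exact_mod_cast this.ne'
  have step : ∀ n : ℕ, (∀ d : ℝ, 0 < d → d ≠ 1 → N (parityFactor o *
      fun x : ℝ => (evenVar x : ℂ) ^ n * ((d : ℂ) + (x : ℂ) ^ 2)⁻¹)) →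
      N (parityFactor o * fun x : ℝ => (evenVar x : ℂ) ^ (n + 1)) := by
    intro n h
    have hdiffv : Differentiable ℝ fun x : ℝ => (evenVar x : ℂ) := fun x =>
      Complex.ofRealCLM.differentiableAt.comp x (differentiable_evenVar x)
    have hadm : ∀ d : ℝ, 1 ≤ d → Admissible θ o 2
        (fun x : ℝ => (evenVar x : ℂ) ^ n * ((d : ℂ) + (x : ℂ) ^ 2)⁻¹) := fun d hd => by
      have hd0 : 0 < d := by linarith
      have hdif : Differentiable ℝ
          (fun x : ℝ => (evenVar x : ℂ) ^ n * ((d : ℂ) + (x : ℂ) ^ 2)⁻¹) := by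
        refine (hdiffv.pow n).mul (Differentiable.inv ?_ (hden hd0))
        exact (differentiable_const _).add (Complex.ofRealCLM.differentiable.pow 2)
      refine ⟨hdif.continuous.measurable, fun x => by simp [evenVar_neg], fun x => ?_, hdif 0⟩
      have h1 : ‖(evenVar x : ℂ) ^ n * ((d : ℂ) + (x : ℂ) ^ 2)⁻¹‖ ≤ evenVar x := by
        rw [norm_mul, norm_pow, norm_inv, Complex.norm_real,
          Real.norm_of_nonneg (evenVar_pos x).le]
        have h2 : ‖(d : ℂ) + (x : ℂ) ^ 2‖ = d + x ^ 2 := by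
          rw [← Complex.ofReal_pow, ← Complex.ofReal_add, Complex.norm_real,
            Real.norm_of_nonneg (by positivity)]
        rw [h2]
        refine (mul_le_of_le_one_left (by positivity)
          (pow_le_one₀ (evenVar_pos x).le (evenVar_le_one x))).trans ?_
        exact inv_anti₀ (by positivity) (by linarith)
      refine (mul_le_mul_of_nonneg_right h1
        (zero_le_one.trans (one_le_parityWeight θ o x))).trans ?_
      exact evenVar_mul_parityWeight_le hθ0 hθ1 o x
    have hlim : ∀ x : ℝ, (evenVar x : ℂ) ^ n * (((1 : ℝ) : ℂ) + (x : ℂ) ^ 2)⁻¹ =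
        (evenVar x : ℂ) ^ (n + 1) := fun x => by
      have : (((1 : ℝ) : ℂ) + (x : ℂ) ^ 2)⁻¹ = evenVar x := by simp [evenVar]
      rw [this, pow_succ]
    have h1 := hadm 1 le_rfl
    have h2 := hN.parity_lim (g := fun x : ℝ =>
        (evenVar x : ℂ) ^ n * (((1 : ℝ) : ℂ) + (x : ℂ) ^ 2)⁻¹)
      (gn := fun (j : ℕ) (x : ℝ) => (evenVar x : ℂ) ^ n *
        (((1 + 1 / ((j : ℝ) + 1) : ℝ) : ℂ) + (x : ℂ) ^ 2)⁻¹)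
      (fun j => hadm _ (by
        have : (0 : ℝ) ≤ 1 / ((j : ℝ) + 1) := by positivity
        linarith)) h1.mem h1.even h1.differentiableAt.continuousAt (fun x => ?_)
      (fun j => h _ (by positivity) (by
        have : (0 : ℝ) < 1 / ((j : ℝ) + 1) := by positivity
        linarith))
    · simpa only [hlim] using h2
    · refine Tendsto.const_mul _ (Tendsto.inv₀ (Tendsto.add_const _ ?_) (hden one_pos x))
      refine (Complex.continuous_ofReal.tendsto _).comp ?_
      simpa using tendsto_one_div_add_atTop_nhds_zero_nat.const_add (1 : ℝ)
  suffices h : ∀ d : ℝ, 0 < d → d ≠ 1 → N (parityFactor o *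
      fun x : ℝ => (evenVar x : ℂ) ^ n * ((d : ℂ) + (x : ℂ) ^ 2)⁻¹) from ⟨h, step n h⟩
  induction n with
  | zero =>
    intro d hd _
    simpa using hN.parity_quad (o := o) hd
  | succ n ih =>
    intro d hd hd1
    have := hN.smul (((d : ℂ) - 1)⁻¹) _ (hN.add _ _ (step n ih) (hN.smul (-1) _ (ih d hd hd1)))
    convert this using 1
    ext x
    have e1 := hden hd x
    have e2 : (1 : ℂ) + (x : ℂ) ^ 2 ≠ 0 := by
      have := hden one_pos x
      simpa using this
    have e3 : (d : ℂ) - 1 ≠ 0 := by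
      rw [sub_ne_zero]
      exact_mod_cast hd1
    have e4 : (evenVar x : ℂ) = ((1 : ℂ) + (x : ℂ) ^ 2)⁻¹ := by simp [evenVar]
    simp only [Pi.mul_apply, Pi.smul_apply, Pi.add_apply, smul_eq_mul, pow_succ]
    have e5 : (evenVar x : ℂ) - ((d : ℂ) + (x : ℂ) ^ 2)⁻¹ =
        ((d : ℂ) - 1) * ((evenVar x : ℂ) * ((d : ℂ) + (x : ℂ) ^ 2)⁻¹) := by
      rw [e4]
      field_simp
      ring
    have e6 : ((d : ℂ) - 1)⁻¹ * ((d : ℂ) - 1) = 1 := inv_mul_cancel₀ e3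
    linear_combination (-(parityFactor o x * (evenVar x : ℂ) ^ n * ((d : ℂ) - 1)⁻¹)) * e5 -
      (parityFactor o x * (evenVar x : ℂ) ^ n * (evenVar x : ℂ) *
        ((d : ℂ) + (x : ℂ) ^ 2)⁻¹) * e6

theorem parity_polynomial (p : Polynomial ℝ) :
    N (parityFactor o * ofEvenVar fun y => ((p.eval y : ℝ) : ℂ)) := by
  induction p using Polynomial.induction_on' with
  | add p q hp hq =>
    convert hN.add _ _ hp hq using 1
    ext x
    simp only [Pi.mul_apply, Pi.add_apply, ofEvenVar, Polynomial.eval_add, Complex.ofReal_add]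
    ring
  | monomial n a =>
    convert hN.smul a _ (hN.parity_pow hθ0 hθ1 (o := o) n).2 using 1
    ext x
    simp only [Pi.mul_apply, Pi.smul_apply, smul_eq_mul, ofEvenVar, Polynomial.eval_monomial,
      Complex.ofReal_mul, Complex.ofReal_pow]
    ring

end IsCalculusClosed

end Density

section Density

variable {θ : ℝ}

theorem differentiableAt_comp_evenVar {h : ℝ → ℂ} {b : ℝ} (hb : b < 1)
    (hh : ∀ y, b ≤ y → h y = 0) : DifferentiableAt ℝ (fun x => h (evenVar x)) 0 := by
  have h1 : ∀ᶠ x in 𝓝 (0 : ℝ), b < evenVar x :=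
    continuous_evenVar.continuousAt.eventually (lt_mem_nhds (by rwa [evenVar_zero]))
  refine (differentiableAt_const (0 : ℂ)).congr_of_eventuallyEq ?_
  filter_upwards [h1] with x hx
  exact hh _ hx.le

namespace IsCalculusClosed

variable {N : (ℝ → ℂ) → Prop} (hN : IsCalculusClosed θ N) (hθ0 : 0 ≤ θ) (hθ1 : θ ≤ 1 / 2)
  {o : Bool}
include hN hθ0 hθ1

theorem parity_lim_ofEvenVar {hn : ℕ → ℝ → ℂ} {h : ℝ → ℂ} {K : ℝ≥0}
    (hm : ∀ n, Measurable (hn n)) (hK : ∀ n, ∀ y ∈ Set.Icc (0 : ℝ) 1, ‖hn n y‖ ≤ K)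
    (hd : ∀ n, DifferentiableAt ℝ (fun x => hn n (evenVar x)) 0) (hm' : Measurable h)
    (hd' : DifferentiableAt ℝ (fun x => h (evenVar x)) 0)
    (hlim : ∀ y ∈ Set.Icc (0 : ℝ) 1, Tendsto (fun n => hn n y) atTop (𝓝 (h y)))
    (hNn : ∀ n, N (parityFactor o * ofEvenVar (hn n))) : N (parityFactor o * ofEvenVar h) := by
  have h1 := admissible_ofEvenVar hθ0 hθ1 o hm'
    (fun y hy => le_of_tendsto (hlim y hy).norm (Eventually.of_forall fun n => hK n y hy)) hd'
  exact hN.parity_lim (fun n => admissible_ofEvenVar hθ0 hθ1 o (hm n) (hK n) (hd n)) h1.mem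
    h1.even h1.differentiableAt.continuousAt
    (fun x => (hlim _ ⟨(evenVar_pos x).le, evenVar_le_one x⟩).const_mul _) hNn

theorem parity_continuous {b : ℝ} (hb : b < 1) {h : ℝ → ℝ} (hc : Continuous h)
    (hh : ∀ y, b ≤ y → h y = 0) : N (parityFactor o * ofEvenVar fun y => (h y : ℂ)) := by
  have key := fun n : ℕ => exists_polynomial_near_of_continuousOn 0 1 h hc.continuousOn
    (1 / ((n : ℝ) + 1)) (by positivity)
  choose p hp using key
  obtain ⟨C, hC⟩ := isCompact_Icc.exists_bound_of_continuousOn (s := Set.Icc (0 : ℝ) 1)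
    hc.continuousOn
  have hC0 : 0 ≤ C := (norm_nonneg _).trans (hC 0 (by simp))
  refine hN.parity_lim_ofEvenVar hθ0 hθ1 (hn := fun n y => (((p n).eval y : ℝ) : ℂ))
    (K := ⟨1 + C, by positivity⟩) (fun n => ?_) (fun n y hy => ?_) (fun n => ?_)
    (Complex.measurable_ofReal.comp hc.measurable)
    (differentiableAt_comp_evenVar (h := fun y => (h y : ℂ)) hb fun y hy => by
      rw [hh y hy, Complex.ofReal_zero])
    (fun y hy => ?_) fun n => hN.parity_polynomial hθ0 hθ1 (p n)
  · exact Complex.measurable_ofReal.comp (p n).continuous.measurable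
  · rw [Complex.norm_real]
    have h1 : (1 : ℝ) / ((n : ℝ) + 1) ≤ 1 := by
      rw [div_le_one (by positivity)]
      linarith [n.cast_nonneg (α := ℝ)]
    have h2 := norm_add_le ((p n).eval y - h y) (h y)
    rw [sub_add_cancel] at h2
    exact h2.trans (add_le_add ((hp n y hy).le.trans h1) (hC y hy))
  · exact Complex.ofRealCLM.differentiableAt.comp 0
      ((p n).differentiableAt.comp 0 (differentiable_evenVar 0))
  · refine (Complex.continuous_ofReal.tendsto _).comp ?_
    rw [tendsto_iff_norm_sub_tendsto_zero]
    exact squeeze_zero (fun n => norm_nonneg _) (fun n => (hp n y hy).le)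
      tendsto_one_div_add_atTop_nhds_zero_nat

theorem parity_indicator {b : ℝ} (hb : b < 1) {f : ℝ → ℂ} (hf : BoundedBorel f) :
    N (parityFactor o * ofEvenVar ((Set.Iio b).indicator f)) := by
  have hd : ∀ f : ℝ → ℂ, DifferentiableAt ℝ (fun x => (Set.Iio b).indicator f (evenVar x)) 0 :=
    fun f => differentiableAt_comp_evenVar hb fun y hy =>
      Set.indicator_of_notMem (by exact not_lt.mpr hy) _
  have hle : ∀ (f : ℝ → ℂ) {C : ℝ}, (∀ x, ‖f x‖ ≤ C) → ∀ x,
      ‖(Set.Iio b).indicator f x‖ ≤ C.toNNReal := fun f C hC x =>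
    (norm_indicator_le_norm_self f x).trans ((hC x).trans (Real.le_coe_toNNReal C))
  have h𝒞 : IsMonotoneClass fun f => N (parityFactor o * ofEvenVar ((Set.Iio b).indicator f)) :=
    { add := fun f g _ _ hf hg => by
        convert hN.add _ _ hf hg using 1
        ext x
        have : (Set.Iio b).indicator (f + g) (evenVar x) = (Set.Iio b).indicator f (evenVar x) +
            (Set.Iio b).indicator g (evenVar x) := congrFun (Set.indicator_add _ f g) _
        simp only [Pi.mul_apply, Pi.add_apply, ofEvenVar, this]
        ring
      smul := fun c f _ hf => by
        convert hN.smul c _ hf using 1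
        ext x
        have : (Set.Iio b).indicator (c • f) (evenVar x) =
            c * (Set.Iio b).indicator f (evenVar x) := Set.indicator_const_smul_apply _ c f _
        simp only [Pi.mul_apply, Pi.smul_apply, smul_eq_mul, ofEvenVar, this]
        ring
      lim := fun fn f C hm hC hlim h => by
        refine hN.parity_lim_ofEvenVar hθ0 hθ1 (hn := fun n => (Set.Iio b).indicator (fn n))
          (fun n => (hm n).indicator measurableSet_Iio) (fun n y _ => hle _ (hC n) y)
          (fun n => hd _) ((measurable_of_tendsto_metrizable hm
            (tendsto_pi_nhds.mpr hlim)).indicator measurableSet_Iio) (hd _) (fun y _ => ?_) h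
        by_cases hy : y ∈ Set.Iio b
        · simpa only [Set.indicator_of_mem hy] using hlim y
        · simp only [Set.indicator_of_notMem hy, tendsto_const_nhds] }
  refine h𝒞.of_continuous (fun g hg ⟨C, hC⟩ => ?_) hf
  have hC' : ∀ x, ‖(g x : ℂ)‖ ≤ C := fun x => by rw [Complex.norm_real]; exact hC x
  refine hN.parity_lim_ofEvenVar hθ0 hθ1
    (hn := fun n y => ((ramp b n y * g y : ℝ) : ℂ)) (K := C.toNNReal) (fun n => ?_)
    (fun n y _ => ?_) (fun n => differentiableAt_comp_evenVar
      (h := fun y => ((ramp b n y * g y : ℝ) : ℂ)) hb fun y hy => ?_)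
    ((Complex.measurable_ofReal.comp hg.measurable).indicator measurableSet_Iio) (hd _)
    (fun y _ => ?_) fun n => hN.parity_continuous hθ0 hθ1 hb ((continuous_ramp b n).mul hg)
      fun y hy => by rw [ramp_eq_zero hy, zero_mul]
  · exact Complex.measurable_ofReal.comp ((continuous_ramp b n).mul hg).measurable
  · rw [Complex.ofReal_mul, norm_mul]
    exact (mul_le_of_le_one_left (norm_nonneg _) (norm_ramp_le b n y)).trans
      ((hC' y).trans (Real.le_coe_toNNReal C))
  · rw [ramp_eq_zero hy, zero_mul, Complex.ofReal_zero]
  · have := (tendsto_ramp b y).mul_const (g y : ℂ)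
    simp only [Complex.ofReal_mul]
    convert this using 2
    by_cases hy : y ∈ Set.Iio b
    · simp [Set.indicator_of_mem hy]
    · simp [Set.indicator_of_notMem hy]

theorem parity_of_support {g : ℝ → ℂ} (hg : BoundedBorel g) (he : ∀ x, g (-x) = g x) {a c : ℝ}
    (ha : 0 < a) (h1 : ∀ x, |x| ≤ a → g x = 0) (h2 : ∀ x, c < |x| → g x = 0) :
    N (parityFactor o * g) := by
  obtain ⟨hm, K, hK⟩ := hg
  have hK0 : 0 ≤ K := (norm_nonneg _).trans (hK 0)
  have hb : evenVar a < 1 := inv_lt_one_of_one_lt₀ (by nlinarith)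
  have habs : ∀ x, g |x| = g x := fun x => by
    rcases abs_choice x with h | h <;> rw [h]
    exact he x
  set f : ℝ → ℂ := fun t => g (√(t⁻¹ - 1)) * ((t⁻¹ : ℝ) : ℂ) with hf
  have hfb : BoundedBorel f := by
    refine ⟨(hm.comp (by fun_prop)).mul (Complex.measurable_ofReal.comp measurable_inv),
      K * (1 + c ^ 2), fun t => ?_⟩
    by_cases h0 : g (√(t⁻¹ - 1)) = 0
    · simp only [hf, h0, zero_mul, norm_zero]
      positivity
    · have h3 : 0 < √(t⁻¹ - 1) := by
        by_contra h
        exact h0 (h1 _ (by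
          rw [abs_of_nonneg (Real.sqrt_nonneg _)]
          exact (not_lt.mp h).trans ha.le))
      have h4 : √(t⁻¹ - 1) ≤ c := by
        by_contra h
        exact h0 (h2 _ (by rwa [abs_of_nonneg (Real.sqrt_nonneg _), ← not_le]))
      have h5 : 0 < t⁻¹ - 1 := Real.sqrt_pos.mp h3
      have h6 : t⁻¹ - 1 ≤ c ^ 2 := by
        rw [← Real.sq_sqrt h5.le]
        exact pow_le_pow_left₀ h3.le h4 2
      simp only [hf]
      rw [norm_mul, Complex.norm_real, Real.norm_of_nonneg (by linarith : 0 ≤ t⁻¹)]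
      exact mul_le_mul (hK _) (by linarith) (by linarith) hK0
  have hfx : ∀ x, f (evenVar x) = g x * (((evenVar x)⁻¹ : ℝ) : ℂ) := fun x => by
    have : √((evenVar x)⁻¹ - 1) = |x| := by
      rw [evenVar, inv_inv, add_sub_cancel_left, Real.sqrt_sq_eq_abs]
    simp only [hf, this, habs]
  convert hN.parity_indicator hθ0 hθ1 (o := o) hb hfb using 2
  ext x
  have hv : (evenVar x : ℂ) ≠ 0 := by exact_mod_cast (evenVar_pos x).ne'
  by_cases hx : evenVar x < evenVar a
  · rw [ofEvenVar, Set.indicator_of_mem (by exact hx), hfx, Complex.ofReal_inv]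
    field_simp
  · rw [ofEvenVar, Set.indicator_of_notMem (by exact hx), mul_zero]
    refine h1 x (not_lt.mp fun h => hx ?_)
    have : a ^ 2 < x ^ 2 := sq_lt_sq.mpr (by rwa [abs_of_pos ha])
    exact inv_strictAnti₀ (by positivity) (by linarith)

theorem parity_of_continuousAt {g : ℝ → ℂ} (hm : Measurable g) (he : ∀ x, g (-x) = g x)
    (hc : ContinuousAt g 0) {K : ℝ≥0} (hK : ∀ x, ‖g x‖ * parityWeight θ o x ≤ K)
    (hg : parityFactor o * g ∈ LambdaDiff θ) : N (parityFactor o * g) := by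
  have hgK : ∀ x, ‖g x‖ ≤ K := fun x =>
    (le_mul_of_one_le_right (norm_nonneg _) (one_le_parityWeight θ o x)).trans (hK x)
  set a : ℕ → ℝ := fun n => 1 / ((n : ℝ) + 1) with ha
  have ha0 : ∀ n, 0 < a n := fun n => by simp only [ha]; positivity
  set T : ℕ → Set ℝ := fun n => {x | a n < |x| ∧ |x| ≤ n} with hT
  have hTm : ∀ n, MeasurableSet (T n) := fun n =>
    (measurableSet_lt measurable_const continuous_abs.measurable).inter
      (measurableSet_le continuous_abs.measurable measurable_const)
  have hTneg : ∀ n x, -x ∈ T n ↔ x ∈ T n := fun n x => by simp [hT]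
  have hvar : N (parityFactor o * fun x => (evenVar x : ℂ)) := by
    simpa using (hN.parity_pow hθ0 hθ1 (o := o) 0).2
  have hcut : ∀ n (k : ℝ → ℂ), BoundedBorel k → (∀ x, k (-x) = k x) →
      N (parityFactor o * (T n).indicator k) := fun n k hk hke => by
    refine hN.parity_of_support hθ0 hθ1 (hk.indicator (hTm n)) (fun x => ?_) (ha0 n) (c := n)
      (fun x hx => Set.indicator_of_notMem (fun h => hx.not_gt h.1) _)
      (fun x hx => Set.indicator_of_notMem (fun h => hx.not_ge h.2) _)
    by_cases h : x ∈ T n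
    · rw [Set.indicator_of_mem h, Set.indicator_of_mem ((hTneg n x).mpr h), hke]
    · rw [Set.indicator_of_notMem h, Set.indicator_of_notMem (mt (hTneg n x).mp h)]
  have hvb : BoundedBorel fun x => (evenVar x : ℂ) :=
    ⟨Complex.measurable_ofReal.comp continuous_evenVar.measurable, 1, fun x => by
      rw [Complex.norm_real, Real.norm_of_nonneg (evenVar_pos x).le]
      exact evenVar_le_one x⟩
  set gn : ℕ → ℝ → ℂ := fun n => (T n).indicator g + g 0 • ((fun x => (evenVar x : ℂ)) +
    (-1 : ℂ) • (T n).indicator fun x => (evenVar x : ℂ)) with hgn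
  have hmem : ∀ n x, x ∈ T n → gn n x = g x := fun n x hx => by
    simp [hgn, hx]
  have hnotMem : ∀ n x, x ∉ T n → gn n x = g 0 * evenVar x := fun n x hx => by
    simp [hgn, hx]
  have hNgn : ∀ n, N (parityFactor o * gn n) := fun n => by
    convert hN.add _ _ (hcut n g ⟨hm, K, hgK⟩ he) (hN.smul (g 0) _ (hN.add _ _ hvar
      (hN.smul (-1) _ (hcut n _ hvb fun x => by rw [evenVar_neg])))) using 1
    ext x
    simp only [hgn, Pi.mul_apply, Pi.add_apply, Pi.smul_apply, smul_eq_mul]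
    ring
  refine hN.parity_lim (gn := gn) (K := 2 * K) (fun n => ⟨?_, fun x => ?_, fun x => ?_, ?_⟩) hg he
    hc (fun x => ?_) hNgn
  · exact (hm.indicator (hTm n)).add ((hvb.1.add ((hvb.1.indicator (hTm n)).const_smul
      (-1 : ℂ))).const_smul (g 0))
  · by_cases h : x ∈ T n
    · rw [hmem n _ h, hmem n _ ((hTneg n x).mpr h), he]
    · rw [hnotMem n _ h, hnotMem n _ (mt (hTneg n x).mp h), evenVar_neg]
  · have hK0 : (0 : ℝ) ≤ K := K.2
    push_cast
    by_cases h : x ∈ T n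
    · rw [hmem n _ h]
      exact (hK x).trans (by linarith)
    · rw [hnotMem n _ h, norm_mul, Complex.norm_real, Real.norm_of_nonneg (evenVar_pos x).le,
        mul_assoc, mul_comm 2]
      exact mul_le_mul (hgK 0) (evenVar_mul_parityWeight_le hθ0 hθ1 o x)
        (mul_nonneg (evenVar_pos x).le
          (zero_le_one.trans (one_le_parityWeight θ o x))) hK0
  · have h1 : DifferentiableAt ℝ (fun x => g 0 * (evenVar x : ℂ)) 0 :=
      (Complex.ofRealCLM.differentiableAt.comp 0 (differentiable_evenVar 0)).const_mul _
    refine h1.congr_of_eventuallyEq ?_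
    filter_upwards [Metric.ball_mem_nhds (0 : ℝ) (ha0 n)] with x hx
    refine hnotMem n x fun h => ?_
    rw [mem_ball_zero_iff, Real.norm_eq_abs] at hx
    exact hx.not_gt h.1
  · rcases eq_or_ne x 0 with rfl | hx
    · have : ∀ n, gn n 0 = g 0 := fun n => by
        rw [hnotMem n 0 fun h => (ha0 n).not_gt (by simpa using h.1), evenVar_zero]
        simp
      simp only [this, tendsto_const_nhds]
    · refine tendsto_const_nhds.congr' ?_
      filter_upwards [tendsto_one_div_add_atTop_nhds_zero_nat.eventually
        (gt_mem_nhds (abs_pos.mpr hx)), tendsto_natCast_atTop_atTop.eventually_ge_atTop |x|]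
        with n h1 h2
      exact (hmem n x ⟨h1, h2⟩).symm

theorem of_mem_LambdaDiff {φ : ℝ → ℂ} (hφ : φ ∈ LambdaDiff θ) : N φ := by
  obtain ⟨M, hM⟩ := exists_bound_of_mem_Lambda hφ.1
  obtain ⟨⟨hm, -⟩, hd⟩ := hφ
  have hb := bounds_of_normLambdaTheta_le hM
  have hd' : DifferentiableAt ℝ (fun x => φ (-x)) 0 :=
    DifferentiableAt.comp 0 (by rwa [neg_zero]) (by fun_prop)
  have hde : DifferentiableAt ℝ (evenPart φ) 0 := (hd.add hd').div_const 2
  have hdo : DifferentiableAt ℝ (oddPart φ) 0 := (hd.sub hd').div_const 2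
  have hKe : ∀ x, ‖evenPart φ x‖ * parityWeight θ false x ≤ M := fun x => by
    simpa [parityWeight] using norm_evenPart_le (fun x => (hb x).1) x
  have hKo : ∀ x, ‖oddQuot φ x‖ * parityWeight θ true x ≤ (2 * M : ℝ≥0) := fun x => by
    have h1 := congrArg norm (congrFun (idFun_mul_oddQuot φ) x)
    rw [Pi.mul_apply, norm_mul, idFun, Complex.norm_real, Real.norm_eq_abs] at h1
    have h2 := (hb x).2.2
    have h3 := norm_oddQuot_le hM x
    rw [← h1] at h2
    simp only [parityWeight, if_true, NNReal.coe_mul, NNReal.coe_ofNat]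
    linarith
  have hee : ∀ x, evenPart φ (-x) = evenPart φ x := fun x => by
    simp only [evenPart, neg_neg, add_comm]
  have heo : ∀ x, oddQuot φ (-x) = oddQuot φ x := fun x => by
    rcases eq_or_ne x 0 with rfl | hx
    · rw [neg_zero]
    · rw [oddQuot_of_ne hx, oddQuot_of_ne (neg_ne_zero.mpr hx), Complex.ofReal_neg,
        ← neg_div_neg_eq, neg_neg]
      congr 1
      simp only [oddPart, neg_neg]
      ring
  have hpo : parityFactor true * oddQuot φ = oddPart φ := idFun_mul_oddQuot φ
  have hpe : parityFactor false * evenPart φ = evenPart φ := one_mul _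
  have h1 : N (evenPart φ) := by
    have h := normLambdaTheta_parity_le hee hKe
    rw [← hpe]
    refine hN.parity_of_continuousAt hθ0 hθ1 (measurable_evenPart hm) hee hde.continuousAt hKe ?_
    rw [hpe] at h ⊢
    exact ⟨⟨measurable_evenPart hm, h.trans_lt ENNReal.coe_lt_top⟩, hde⟩
  have h2 : N (oddPart φ) := by
    have h := normLambdaTheta_parity_le heo hKo
    rw [← hpo]
    refine hN.parity_of_continuousAt hθ0 hθ1 (measurable_oddQuot hm) heo ?_ hKo ?_
    · rw [continuousAt_iff_punctured_nhds, oddQuot_zero]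
      refine (tendsto_oddPart_div hd).congr' ?_
      filter_upwards [self_mem_nhdsWithin] with x hx
      exact (oddQuot_of_ne hx).symm
    · rw [hpo] at h ⊢
      exact ⟨⟨measurable_oddPart hm, h.trans_lt ENNReal.coe_lt_top⟩, hdo⟩
  convert hN.add _ _ h1 h2 using 1
  ext x
  simp only [Pi.add_apply, evenPart, oddPart]
  ring

end IsCalculusClosed

end Density

section Uniqueness

variable {H : Type*} [NormedAddCommGroup H] [InnerProductSpace ℂ H] [CompleteSpace H]
  {ε : H →ₗ.[ℂ] H} {θ : ℝ}

theorem IsResolventAt.eq {X : Type*} [NormedAddCommGroup X] [NormedSpace ℂ X] {T : X →ₗ.[ℂ] X}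
    {z : ℂ} {R S : X →L[ℂ] X} (hR : IsResolventAt T z R) (hS : IsResolventAt T z S) : R = S := by
  refine ContinuousLinearMap.ext fun y => ?_
  obtain ⟨h, hy⟩ := hR.1 y
  have h1 := hS.2 ⟨R y, h⟩
  rw [hy] at h1
  exact h1.symm

theorem eq_of_tendsto_weakly {X : Type*} [NormedAddCommGroup X] [NormedSpace ℂ X]
    {Tn : ℕ → X →L[ℂ] X} {R S : X →L[ℂ] X}
    (hR : ∀ (u : X) (ℓ : StrongDual ℂ X), Tendsto (fun n => ℓ (Tn n u)) atTop (𝓝 (ℓ (R u))))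
    (hS : ∀ (u : X) (ℓ : StrongDual ℂ X), Tendsto (fun n => ℓ (Tn n u)) atTop (𝓝 (ℓ (S u)))) :
    R = S :=
  ContinuousLinearMap.ext fun u => (SeparatingDual.eq_iff_forall_dual_eq (R := ℂ)).mpr fun ℓ =>
    tendsto_nhds_unique (hR u ℓ) (hS u ℓ)

theorem IsBorelCalculus.unique_LambdaDiff (hθ0 : 0 ≤ θ) (hθ1 : θ ≤ 1 / 2)
    {F G : LambdaDiff θ →ₗ[ℂ] (ChargeSpace ε θ →L[ℂ] ChargeSpace ε θ)}
    (hG : IsBorelCalculus ε θ (LambdaDiff θ) PtConvDiff G)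
    (hF : IsBorelCalculus ε θ (LambdaDiff θ) PtConvDiff F) : G = F := by
  have hN : IsCalculusClosed θ
      fun φ => ∃ h : φ ∈ LambdaDiff θ, G ⟨φ, h⟩ = F ⟨φ, h⟩ :=
    { add := by
        rintro φ χ ⟨hφ, h1⟩ ⟨hχ, h2⟩
        refine ⟨(LambdaDiff θ).add_mem hφ hχ, ?_⟩
        have h3 := map_add G ⟨φ, hφ⟩ ⟨χ, hχ⟩
        rw [h1, h2, ← map_add] at h3
        exact h3
      smul := by
        rintro c φ ⟨hφ, h1⟩
        refine ⟨(LambdaDiff θ).smul_mem hφ c, ?_⟩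
        have h3 := map_smul G c ⟨φ, hφ⟩
        rw [h1, ← map_smul] at h3
        exact h3
      lim := by
        intro φn φ M h hmem hφ hM hconv
        have hG' := hG.2 (fun n => ⟨φn n, hmem n⟩) ⟨φ, hφ⟩ ⟨M, hM⟩ hconv
        have hF' := hF.2 (fun n => ⟨φn n, hmem n⟩) ⟨φ, hφ⟩ ⟨M, hM⟩ hconv
        have heq : ∀ n, G ⟨φn n, hmem n⟩ = F ⟨φn n, hmem n⟩ := fun n => (h n).2
        simp only [heq] at hG'
        exact ⟨hφ, eq_of_tendsto_weakly hG' hF'⟩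
      resolvent := by
        intro z hz
        obtain ⟨h, h1⟩ := hG.1 z hz
        obtain ⟨h', h2⟩ := hF.1 z hz
        exact ⟨h, h1.eq h2⟩ }
  exact LinearMap.ext fun φ => (hN.of_mem_LambdaDiff hθ0 hθ1 φ.2).2

theorem LambdaDiff_le_Lambda : LambdaDiff θ ≤ Lambda θ := fun _ h => h.1

theorem IsBorelCalculus.restrict
    {F : Lambda θ →ₗ[ℂ] (ChargeSpace ε θ →L[ℂ] ChargeSpace ε θ)}
    (hF : IsBorelCalculus ε θ (Lambda θ) PtConv F) (hθ0 : 0 ≤ θ) (hθ1 : θ ≤ 1 / 2) :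
    IsBorelCalculus ε θ (LambdaDiff θ) PtConvDiff
      (F ∘ₗ (Subalgebra.inclusion LambdaDiff_le_Lambda).toLinearMap) := by
  refine ⟨fun z hz => ⟨linResolvent_mem_LambdaDiff hθ0 hθ1 hz, (hF.1 z hz).2⟩,
    fun φn φ hM h u ℓ => ?_⟩
  exact hF.2 (fun n => Subalgebra.inclusion LambdaDiff_le_Lambda (φn n))
    (Subalgebra.inclusion LambdaDiff_le_Lambda φ) hM h.1 u ℓ

/-- The functions in `Λ_θ` are the limits of bounded sequences of functions in `Λ_θ` that are
constant near `0`. -/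
theorem exists_approx_LambdaDiff {φ : ℝ → ℂ} (hφ : φ ∈ Lambda θ) :
    ∃ (φn : ℕ → ℝ → ℂ) (M : ℝ≥0), (∀ n, φn n ∈ LambdaDiff θ) ∧
      (∀ n, normLambdaTheta θ (φn n) ≤ M) ∧ PtConv φn φ := by
  obtain ⟨M, hM⟩ := exists_bound_of_mem_Lambda hφ
  have hb := bounds_of_normLambdaTheta_le hM
  set a : ℕ → ℝ := fun n => 1 / ((n : ℝ) + 1) with ha
  have ha0 : ∀ n, 0 < a n := fun n => by simp only [ha]; positivity
  classical
  set φn : ℕ → ℝ → ℂ := fun n x => if a n < |x| then φ x else φ 0 with hφn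
  have hodd : ∀ n x, oddPart (φn n) x = if a n < |x| then oddPart φ x else 0 := fun n x => by
    simp only [oddPart, hφn, abs_neg]
    split_ifs <;> simp
  have hnorm : ∀ n, normLambdaTheta θ (φn n) ≤ (4 * M : ℝ≥0) := fun n => by
    refine normLambdaTheta_le (fun x => ?_) (fun x => ?_) fun x => ?_
    · simp only [hφn]
      split_ifs
      exacts [(hb x).1, (hb 0).1]
    · rw [hodd]
      split_ifs
      · exact (hb x).2.1
      · simp
    · rw [hodd]
      split_ifs
      · exact (hb x).2.2
      · simp
  refine ⟨φn, 4 * M, fun n => ⟨⟨?_, (hnorm n).trans_lt ENNReal.coe_lt_top⟩, ?_⟩, hnorm,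
    fun x => ?_⟩
  · exact Measurable.ite (measurableSet_lt measurable_const continuous_abs.measurable) hφ.1
      measurable_const
  · refine (differentiableAt_const (φ 0)).congr_of_eventuallyEq ?_
    filter_upwards [Metric.ball_mem_nhds (0 : ℝ) (ha0 n)] with x hx
    rw [mem_ball_zero_iff, Real.norm_eq_abs] at hx
    exact if_neg hx.not_gt
  · rcases eq_or_ne x 0 with rfl | hx
    · simp only [hφn, ite_self, tendsto_const_nhds]
    · refine tendsto_const_nhds.congr' ?_
      filter_upwards [tendsto_one_div_add_atTop_nhds_zero_nat.eventually
        (gt_mem_nhds (abs_pos.mpr hx))] with n hn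
      exact (if_pos hn).symm

theorem IsBorelCalculus.unique_Lambda (hθ0 : 0 ≤ θ) (hθ1 : θ ≤ 1 / 2)
    {F G : Lambda θ →ₗ[ℂ] (ChargeSpace ε θ →L[ℂ] ChargeSpace ε θ)}
    (hG : IsBorelCalculus ε θ (Lambda θ) PtConv G)
    (hF : IsBorelCalculus ε θ (Lambda θ) PtConv F) : G = F := by
  have hres := (hG.restrict hθ0 hθ1).unique_LambdaDiff hθ0 hθ1 (hF.restrict hθ0 hθ1)
  refine LinearMap.ext fun φ => ?_
  obtain ⟨φn, M, hmem, hM, hconv⟩ := exists_approx_LambdaDiff φ.2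
  have heq : ∀ n, G ⟨φn n, (hmem n).1⟩ = F ⟨φn n, (hmem n).1⟩ := fun n =>
    LinearMap.congr_fun hres ⟨φn n, hmem n⟩
  have hG' := hG.2 (fun n => ⟨φn n, (hmem n).1⟩) φ ⟨M, hM⟩ hconv
  have hF' := hF.2 (fun n => ⟨φn n, (hmem n).1⟩) φ ⟨M, hM⟩ hconv
  simp only [heq] at hG'
  exact eq_of_tendsto_weakly hG' hF'

end Uniqueness

end KleinGordon

end

theorem mainTheorem10 {H : Type*} [NormedAddCommGroup H] [InnerProductSpace ℂ H] [CompleteSpace H]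
    (ε : H →ₗ.[ℂ] H) (hε : IsSelfAdjoint ε) (hpos : ∀ u : ε.domain, 0 ≤ (⟪(u : H), ε u⟫_ℂ).re)
    (θ : ℝ) (hθ0 : 0 ≤ θ) (hθ1 : θ ≤ 1 / 2) :
    (∃ F : LambdaDiff θ →ₗ[ℂ] (ChargeSpace ε θ →L[ℂ] ChargeSpace ε θ),
      IsBorelCalculus ε θ (LambdaDiff θ) PtConvDiff F ∧
      (∀ G, IsBorelCalculus ε θ (LambdaDiff θ) PtConvDiff G → G = F) ∧
      (F 1 = 1 ∧ ∀ φ χ, F (φ * χ) = F φ * F χ) ∧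
      (∀ φ : LambdaDiff θ, HasMatrix ε θ φ (F φ)) ∧
      ∃ C : ℝ, 0 ≤ C ∧ ∀ φ, ‖F φ‖ ≤ C * (normLambdaTheta θ φ).toReal) ∧
    ((∀ u : ε.domain, ε u = 0 → (u : H) = 0) →
      ∃ F : Lambda θ →ₗ[ℂ] (ChargeSpace ε θ →L[ℂ] ChargeSpace ε θ),
        IsBorelCalculus ε θ (Lambda θ) PtConv F ∧
        (∀ G, IsBorelCalculus ε θ (Lambda θ) PtConv G → G = F) ∧
        (F 1 = 1 ∧ ∀ φ χ, F (φ * χ) = F φ * F χ) ∧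
        (∀ φ : Lambda θ, HasMatrix ε θ φ (F φ)) ∧
        ∃ C : ℝ, 0 ≤ C ∧ ∀ φ, ‖F φ‖ ≤ C * (normLambdaTheta θ φ).toReal) := by
  have hE := spectralMeasure_spec hε hpos
  refine ⟨?_, fun hinj => ?_⟩
  · obtain ⟨F, h1, h2⟩ := exists_chargeCalculus (conv := PtConvDiff) hE hθ0 hθ1
      LambdaDiff_le_Lambda le_rfl (fun φ hφ => Or.inl hφ.2) fun φn φ h => ⟨h.1, Or.inl (h.2 0)⟩
    exact ⟨F, h1, fun G hG => hG.unique_LambdaDiff hθ0 hθ1 h1, h2⟩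
  · obtain ⟨F, h1, h2⟩ := exists_chargeCalculus (conv := PtConv) hE hθ0 hθ1 le_rfl
      LambdaDiff_le_Lambda (fun φ _ => Or.inr (hE.measure_zero hinj))
      fun φn φ h => ⟨h, Or.inr (hE.measure_zero hinj)⟩
    exact ⟨F, h1, fun G hG => hG.unique_Lambda hθ0 hθ1 h1, h2⟩
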